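/- Let $\Lambda:=U^{\oplus 3}\oplus E_8(-1)^{\oplus 2}\oplus I_1(-2)$ (the lattice $H^2(X,\mathbf Z)$ of hyperkähler fourfolds $X$ of $\mathrm{K3}^{[2]}$-type), where $U$ is the hyperbolic plane and $I_1(-2)$ is $\mathbf Z$ with the form $-2x^2$, let $n$ be a positive integer, let $\gamma\in\{1,2\}$, and let $h\in\Lambda$ be a primitive vector with $h^2=2n$ and divisibility $\gamma$ (that is, $h\cdot\Lambda=\gamma\mathbf Z$). Set $$\Omega_h:=\{[x]\in\mathbf P(\Lambda\otimes\mathbf C)\mid x\cdot h=x\cdot x=0,\ x\cdot\bar x>0\},\qquad {}^2\mathcal P^{(\gamma)}_{2n}:=\widehat O(\Lambda,h)\backslash\Omega_h,$$ where $\widehat O(\Lambda,h)$ is the group of isometries of $\Lambda$ that fix $h$ and act as $\pm\mathrm{Id}$ on the discriminant group $\Lambda^\vee/\Lambda$. For each positive integer $d$, let ${}^2\mathcal D^{(\gamma)}_{2n,d}\subset{}^2\mathcal P^{(\gamma)}_{2n}$ be the union of the images of $\mathbf P(K^\perp\otimes\mathbf C)\cap\Omega_h$, where $K$ runs over all primitive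 sublattices of $\Lambda$ of rank $2$ and signature $(1,1)$ that contain $h$ and satisfy $\mathrm{disc}(K^\perp)=-d$. If ${}^2\mathcal D^{(\gamma)}_{2n,d}$ is nonempty, the integer $d$ is even. Write $d=2e$, where $e$ is a positive integer. (1) Let $\gamma=1$. (a) ${}^2\mathcal D^{(1)}_{2n,2e}$ is nonempty if and only if either $e$ or $e-n$ is a square modulo $4n$. (b) If $n$ is square-free, $n\mid e$, and $e$ satisfies the condition in (a), then ${}^2\mathcal D^{(1)}_{2n,2e}$ is an irreducible hypersurface, except when $n\equiv 1\pmod 4$ and $e\equiv n\pmod{4n}$, or when $n\equiv -1\pmod 4$ and $e\equiv 0\pmod{4n}$, in which cases it is a hypersurface with exactly two irreducible components. (c) If $n$ is prime and $e$ satisfies the condition in (a), then ${}^2\mathcal D^{(1)}_{2n,2e}$ is an irreducible hypersurface, except when $n\equiv 1\pmod 4$ and $e\equiv 1\pmod 4$, or when $n\equiv -1\pmod 4$ and $e\equiv 0\pmod 4$, in which cases it is a hypersurface with exactly two irreducible components. (2) Let $\gamma=2$ and $n\equiv -1\pmod 4$. (a) ${}^2\mathcal D^{(2)}_{2n,2e}$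 is nonempty if and only if $e$ is a square modulo $n$. (b) If $n$ is square-free and $n\mid e$, then ${}^2\mathcal D^{(2)}_{2n,2e}$ is an irreducible hypersurface. (c) If $n$ is prime and $e$ is a square modulo $n$, then ${}^2\mathcal D^{(2)}_{2n,2e}$ is an irreducible hypersurface. Here a number is a square modulo $N$ if it is congruent to the square of some integer modulo $N$ ($0$ and non-units are allowed); hypersurfaces, irreducibility and irreducible components are those of closed analytic subsets of the complex analytic space ${}^2\mathcal P^{(\gamma)}_{2n}$ (for closed algebraic subsets they agree with the algebraic notions). -/

import Mathlib

open scoped Matrix LinearAlgebra.Projectivization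

noncomputable section

namespace HK

/-! ### The lattice `U^{⊕3} ⊕ E₈(-1)^{⊕2} ⊕ I₁(-2)` -/

/-- Index set of the standard basis: three copies of `U`, two copies of `E₈(-1)`, one of `I₁(-2)`. -/
abbrev Idx : Type := (Fin 3 × Fin 2) ⊕ ((Fin 2 × Fin 8) ⊕ Unit)

/-- Gram matrix of `U^{⊕3} ⊕ E₈(-1)^{⊕2} ⊕ I₁(-2)`; the Cartan matrix of type `E₈` is the Gram
matrix of the positive definite lattice `E₈` in a basis of simple roots. -/
def gram : Matrix Idx Idx ℤ :=
  Matrix.fromBlocks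
    (Matrix.reindex (Equiv.prodComm _ _) (Equiv.prodComm _ _)
      (Matrix.blockDiagonal fun _ : Fin 3 => !![0, 1; 1, 0]))
    0 0
    (Matrix.fromBlocks
      (Matrix.reindex (Equiv.prodComm _ _) (Equiv.prodComm _ _)
        (Matrix.blockDiagonal fun _ : Fin 2 => -CartanMatrix.E₈))
      0 0
      (Matrix.of fun _ _ => -2))

/-- The second cohomology lattice `Λ` of hyperkähler manifolds of `K3^[2]`-type. -/
abbrev K3Lat : Type := Idx → ℤ

/-- The bilinear form of `Λ`, extended to `Λ ⊗ R`. -/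
def form (R : Type) [CommRing R] : LinearMap.BilinForm R (Idx → R) :=
  Matrix.toBilin' (gram.map (Int.castRingHom R))

/-- The canonical map `Λ → Λ ⊗ R`. -/
def toR (R : Type) [CommRing R] (x : K3Lat) : Idx → R := fun i => (x i : R)

/-- `x` is nonzero and is not a proper multiple of another element. -/
def IsPrimitiveVector (x : K3Lat) : Prop :=
  x ≠ 0 ∧ ∀ (k : ℤ) (y : K3Lat), x = k • y → IsUnit k

/-- `γ` is the divisibility of `x`: the positive generator of the subgroup `x · Λ` of `ℤ`. -/
def HasDivisibility (x : K3Lat) (γ : ℕ) : Prop :=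
  0 < γ ∧ LinearMap.range (form ℤ x) = Ideal.span {(γ : ℤ)}

/-- `h` represents the polarization type of square `2n` and divisibility `γ`. -/
def IsPolarization (n γ : ℕ) (h : K3Lat) : Prop :=
  IsPrimitiveVector h ∧ form ℤ h h = 2 * (n : ℤ) ∧ HasDivisibility h γ

/-! ### Sublattices -/

/-- The quadratic form `x ↦ x · x` of a sublattice. -/
def quad (K : Submodule ℤ K3Lat) : QuadraticForm ℤ K := (form ℤ).toQuadraticMap.restrict K

/-- Discriminant of a sublattice: the determinant of its Gram matrix in a `ℤ`-basis (the choice of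
the basis does not matter). -/
def disc (K : Submodule ℤ K3Lat) : ℤ :=
  (LinearMap.BilinForm.toMatrix (Module.finBasis ℤ K) ((form ℤ).restrict K)).det

/-- The orthogonal `K^⊥` in `Λ`. -/
def orth (K : Submodule ℤ K3Lat) : Submodule ℤ K3Lat := (form ℤ).orthogonal K

/-- `K` is a primitive sublattice of `Λ` (that is, `Λ / K` is torsion-free). -/
def IsPrimitiveSublattice (K : Submodule ℤ K3Lat) : Prop :=
  ∀ (k : ℤ) (x : K3Lat), k ≠ 0 → k • x ∈ K → x ∈ K

/-- `K` is a primitive sublattice of `Λ` of rank 2 and signature `(1,1)` that contains `h`. -/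
def IsHyperbolicPlaneThrough (h : K3Lat) (K : Submodule ℤ K3Lat) : Prop :=
  IsPrimitiveSublattice K ∧ Module.finrank ℤ K = 2 ∧
    sigPos (quad K) = 1 ∧ sigNeg (quad K) = 1 ∧ h ∈ K

/-! ### The group `Ô(Λ, h)` -/

/-- The dual lattice `Λ^∨ ⊂ Λ ⊗ ℚ`. -/
def dualLat : Set (Idx → ℚ) :=
  {x | ∀ y : K3Lat, ∃ k : ℤ, form ℚ x (toR ℚ y) = (k : ℚ)}

/-- `g` acts on the discriminant group `D(Λ) = Λ^∨ / Λ` as multiplication by `ε`. -/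
def ActsOnDisc (g : GL Idx ℤ) (ε : ℤˣ) : Prop :=
  ∀ x ∈ dualLat, ∃ y : K3Lat,
    (g.1.map (Int.castRingHom ℚ)) *ᵥ x = ((ε : ℤ) : ℚ) • x + toR ℚ y

theorem map_mulVec_toR (g : Matrix Idx Idx ℤ) (y : K3Lat) :
    (g.map (Int.castRingHom ℚ)) *ᵥ toR ℚ y = toR ℚ (g *ᵥ y) := by
  ext i
  simp [Matrix.mulVec, dotProduct, toR]

theorem toR_smul (k : ℤ) (y : K3Lat) : toR ℚ (k • y) = (k : ℚ) • toR ℚ y := by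
  ext i
  simp [toR]

theorem toR_add (x y : K3Lat) : toR ℚ (x + y) = toR ℚ x + toR ℚ y := by
  ext i
  simp [toR]

theorem actsOnDisc_one : ActsOnDisc 1 1 := by
  intro x _
  refine ⟨0, ?_⟩
  have : toR ℚ 0 = 0 := by ext i; simp [toR]
  simp [this]

theorem ActsOnDisc.mul {g g' : GL Idx ℤ} {ε ε' : ℤˣ} (hg : ActsOnDisc g ε)
    (hg' : ActsOnDisc g' ε') : ActsOnDisc (g * g') (ε * ε') := by
  intro x hx
  obtain ⟨y, hy⟩ := hg x hx
  obtain ⟨y', hy'⟩ := hg' x hx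
  refine ⟨(ε' : ℤ) • y + g.1 *ᵥ y', ?_⟩
  rw [Units.val_mul, Matrix.map_mul, ← Matrix.mulVec_mulVec, hy', Matrix.mulVec_add,
    Matrix.mulVec_smul, hy, map_mulVec_toR, toR_add, toR_smul]
  push_cast
  module

theorem ActsOnDisc.inv {g : GL Idx ℤ} {ε : ℤˣ} (hg : ActsOnDisc g ε) :
    ActsOnDisc g⁻¹ ε := by
  intro x hx
  obtain ⟨y, hy⟩ := hg x hx
  have key : x = ((ε : ℤ) : ℚ) • ((g⁻¹).1.map (Int.castRingHom ℚ)) *ᵥ x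
      + toR ℚ ((g⁻¹).1 *ᵥ y) := by
    rw [← map_mulVec_toR, ← Matrix.mulVec_smul, ← Matrix.mulVec_add, ← hy,
      Matrix.mulVec_mulVec, ← Matrix.map_mul, ← Units.val_mul]
    simp
  have hε : ((ε : ℤ) : ℚ) * ((ε : ℤ) : ℚ) = 1 := by
    rcases Int.units_eq_one_or ε with h | h <;> simp [h]
  refine ⟨(-(ε : ℤ)) • ((g⁻¹).1 *ᵥ y), ?_⟩
  rw [toR_smul]
  nth_rewrite 2 [key]
  rw [smul_add, smul_smul, hε]
  push_cast
  module

/-- The group `Ô(Λ, h)` of isometries of `Λ` that fix `h` and act as `± Id` on `D(Λ)`. -/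
def Ohat (h : K3Lat) : Subgroup (GL Idx ℤ) where
  carrier := {g | (∀ x y : K3Lat, form ℤ (g.1 *ᵥ x) (g.1 *ᵥ y) = form ℤ x y) ∧
    g.1 *ᵥ h = h ∧ ∃ ε : ℤˣ, ActsOnDisc g ε}
  one_mem' := ⟨by simp, by simp, 1, actsOnDisc_one⟩
  mul_mem' := by
    rintro g g' ⟨h1, h2, ε, h3⟩ ⟨h1', h2', ε', h3'⟩
    refine ⟨fun x y => ?_, ?_, ε * ε', h3.mul h3'⟩
    · rw [Units.val_mul, ← Matrix.mulVec_mulVec, ← Matrix.mulVec_mulVec, h1, h1']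
    · rw [Units.val_mul, ← Matrix.mulVec_mulVec, h2', h2]
  inv_mem' := by
    rintro g ⟨h1, h2, ε, h3⟩
    have e : ∀ x : K3Lat, g.1 *ᵥ ((g⁻¹).1 *ᵥ x) = x := fun x => by
      rw [Matrix.mulVec_mulVec, ← Units.val_mul]; simp
    have e' : ∀ x : K3Lat, (g⁻¹).1 *ᵥ (g.1 *ᵥ x) = x := fun x => by
      rw [Matrix.mulVec_mulVec, ← Units.val_mul]; simp
    refine ⟨fun x y => ?_, ?_, ε, h3.inv⟩
    · rw [← h1, e, e]
    · nth_rewrite 1 [← h2]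
      exact e' h

/-! ### The period space -/

/-- The complex vector space `Λ ⊗ ℂ`. -/
abbrev K3LatC : Type := Idx → ℂ

/-- `Ω_h = {[x] ∈ P(Λ ⊗ ℂ) | x · h = x · x = 0, x · x̄ > 0}`. -/
def Omega (h : K3Lat) : Set (ℙ ℂ K3LatC) :=
  {p | form ℂ p.rep (toR ℂ h) = 0 ∧ form ℂ p.rep p.rep = 0 ∧
    0 < (form ℂ p.rep (star p.rep)).re}

/-- Two points of `Ω_h` are equivalent when they are in the same orbit of `Ô(Λ, h)`. -/
def periodSetoid (h : K3Lat) : Setoid (Omega h) :=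
  (MulAction.orbitRel
    ((Ohat h).map (Matrix.GeneralLinearGroup.map (n := Idx) (Int.castRingHom ℂ)))
    (ℙ ℂ K3LatC)).comap Subtype.val

/-- The period space `Ô(Λ, h) \ Ω_h`. -/
def PeriodSpace (h : K3Lat) : Type := Quotient (periodSetoid h)

/-- The quotient map `Ω_h → Ô(Λ, h) \ Ω_h`. -/
def proj (h : K3Lat) (p : Omega h) : PeriodSpace h := Quotient.mk (periodSetoid h) p

/-- The image in the period space of `P(K^⊥ ⊗ ℂ) ∩ Ω_h`. -/
def NLDivisor (h : K3Lat) (K : Submodule ℤ K3Lat) : Set (PeriodSpace h) :=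
  proj h '' {p : Omega h | ∀ k ∈ K, form ℂ p.1.rep (toR ℂ k) = 0}

/-- The Noether–Lefschetz locus of discriminant `d`. -/
def NLLocus (h : K3Lat) (d : ℕ) : Set (PeriodSpace h) :=
  ⋃ K ∈ {K : Submodule ℤ K3Lat | IsHyperbolicPlaneThrough h K ∧ disc (orth K) = -(d : ℤ)},
    NLDivisor h K

/-! ### Analytic subsets of the period space

The period space is a normal quasi-projective variety. The irreducible components of a closed
algebraic subset are those of the underlying analytic subset. A subset of `Γ \ Ω` is closed
analytic (of a given pure dimension) exactly when its inverse image in `Ω` is, or equivalently its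
inverse image in the cone over `Ω`, a complex submanifold of `Λ ⊗ ℂ` that is a `ℂˣ`-bundle
over `Ω`. -/

/-- The inverse image of `Z` in the cone over `Ω_h`. -/
def cone (h : K3Lat) (Z : Set (PeriodSpace h)) : Set K3LatC :=
  {x | ∃ (hx : x ≠ 0) (hp : Projectivization.mk ℂ x hx ∈ Omega h),
    proj h ⟨Projectivization.mk ℂ x hx, hp⟩ ∈ Z}

/-- `Z` is a closed analytic subset: near each point of the cone over `Ω_h`, its inverse image is
the set of common zeros of finitely many holomorphic functions. -/
def IsAnalyticSubset (h : K3Lat) (Z : Set (PeriodSpace h)) : Prop :=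
  ∀ x ∈ cone h Set.univ, ∃ V : Set K3LatC, IsOpen V ∧ x ∈ V ∧
    ∃ (k : ℕ) (f : Fin k → K3LatC → ℂ), (∀ i, AnalyticOnNhd ℂ (f i) V) ∧
      ∀ y ∈ V ∩ cone h Set.univ, y ∈ cone h Z ↔ ∀ i, f i y = 0

/-- `Z` is a hypersurface: it is nonempty and, near each point of the cone over `Ω_h`, its inverse
image is the zero set of one holomorphic function which vanishes on no nonempty open subset of
the cone. -/
def IsHypersurface (h : K3Lat) (Z : Set (PeriodSpace h)) : Prop :=
  Z.Nonempty ∧ ∀ x ∈ cone h Set.univ, ∃ V : Set K3LatC, IsOpen V ∧ x ∈ V ∧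
    ∃ f : K3LatC → ℂ, AnalyticOnNhd ℂ f V ∧
      (∀ y ∈ V ∩ cone h Set.univ, y ∈ cone h Z ↔ f y = 0) ∧
      ∀ W ⊆ V, IsOpen W → (W ∩ cone h Set.univ).Nonempty →
        ∃ y ∈ W ∩ cone h Set.univ, f y ≠ 0

/-- `Z` is an irreducible closed analytic subset: it is nonempty and not the union of two proper
closed analytic subsets. -/
def IsIrreducibleAnalytic (h : K3Lat) (Z : Set (PeriodSpace h)) : Prop :=
  IsAnalyticSubset h Z ∧ Z.Nonempty ∧
    ∀ A B : Set (PeriodSpace h), IsAnalyticSubset h A → IsAnalyticSubset h B →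
      Z = A ∪ B → Z = A ∨ Z = B

/-- The irreducible components of `Z`: its maximal irreducible closed analytic subsets. -/
def components (h : K3Lat) (Z : Set (PeriodSpace h)) : Set (Set (PeriodSpace h)) :=
  {C | Maximal (fun C' => IsIrreducibleAnalytic h C' ∧ C' ⊆ Z) C}

/-- `Z` is an irreducible hypersurface. -/
def IsIrreducibleHypersurface (h : K3Lat) (Z : Set (PeriodSpace h)) : Prop :=
  IsHypersurface h Z ∧ IsIrreducibleAnalytic h Z

/-- `Z` is a hypersurface with exactly two irreducible components. -/
def IsHypersurfaceWithTwoComponents (h : K3Lat) (Z : Set (PeriodSpace h)) : Prop :=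
  IsHypersurface h Z ∧ (components h Z).ncard = 2

/-- `a` is a square modulo `N`. -/
def IsSquareMod (a : ℤ) (N : ℕ) : Prop := ∃ x : ℤ, x ^ 2 ≡ a [ZMOD (N : ℤ)]

end HK

end

/-!
Write `x · y` for the form of `Λ` and `Ô` for the group `Ô(Λ, h)`. A primitive plane `K` that
contains `h` is spanned by `h` and a vector `v`, which is unique up to sign and the addition of
multiples of `h`. Everything follows from a classification of the planes `K = ⟨h, v⟩` up to `Ô`, and
from the irreducibility of the divisor of a single plane.

**Planes.** Because `Λ` contains three hyperbolic planes, the orthogonal of any vector contains two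
(`exists_isFrame`). With the Eichler transvections, which belong to `Ô`, a descent on the pairing
of `v` with an isotropic vector `f` brings `v` into a normal form in which `v · f` generates the
ideal `v · h^⊥` (`IsFrame.exists_normal_form`), and two vectors in normal form which agree modulo
`(v · f) Λ` and have the same square and the same pairing with `h` are equivalent
(`mem_orb_of_sub_eq`). The discriminant group of `Λ` has order two, so few planes are possible.

* If `h` has divisibility `1`, then `v · h^⊥` is `ℤ` (type A), or it is `2ℤ` and `v / 2` can be
  taken in the dual lattice (type B). With `b = h · v`, respectively `2 b = h · v`, the plane
  contributes to the discriminant `2e` exactly if `b² ≡ e`, respectively `b² ≡ e - n`, modulo `4n`,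
  and its orbit is determined by its type and by `± b` modulo `2n`.
* If `h` has divisibility `2`, then `v · h^⊥ = ℤ`. With `2 b = h · v`, the plane contributes to the
  discriminant `2e` exactly if `b² ≡ e` modulo `n`, and its orbit is determined by `± b` modulo `n`.

Every solution of these congruences comes from a plane (`exists_plane_of_isDivOn_one`,
`exists_plane_of_isDivOn_two`), which gives the conditions for the locus to be nonempty. If `n` is
prime, or square-free and a divisor of `e`, the solutions are unique up to sign
(`uniqueSqrt_of_squarefree`, `uniqueSqrt_of_prime`), so that there is at most one orbit of each
type. Both types occur exactly in the exceptional classes of `n` and `e` modulo `4`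
(`isExceptional_of_isSquareMod`, `isSquareMod_of_isExceptional`).

**Hypersurfaces.** In the cone over `Ω_h` the locus is the union of the hyperplanes orthogonal to
the projections `κ` of the vectors `v` to `h^⊥`, whose squares are bounded. The orthogonal in
`h^⊥ ⊗ ℝ` of a point of the cone is negative definite, uniformly near that point, so these
hyperplanes are locally finite (`exists_finite_nhds`) and the locus is locally the zero set of a
finite product of linear forms (`isHypersurface_of_cone`).

**Irreducibility.** The normal form of `v` leaves a hyperbolic plane `⟨e', f'⟩` orthogonal to `K`.
It identifies the section of `Ω_h` by `K^⊥` with a tube domain: the vectors `z` of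
`⟨h, v, e', f'⟩^⊥ ⊗ ℂ` whose imaginary part has positive square, by `z ↦ z + e' - (z² / 2) f'`. The
tube domain has two convex halves, which are exchanged by the reflection `e' ↦ -e'`, `f' ↦ -f'` of
`Ô` (`IsTubeData.exists_tube`). Hence the divisor of `K` is the image of a connected complex
manifold, and the identity theorem shows that it is irreducible
(`isIrreducibleAnalytic_NLDivisor`).

**Components.** If planes of both types occur, the two divisors are the components. The planes of
type B have even pairing with `h^⊥` and those of type A do not, so no `κ` of the first type is
proportional to one of the second (`smul_nrm_add_smul_nrm_ne_zero`). By local finiteness, neither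
divisor contains the other (`not_NLDivisor_subset`).
-/


open scoped Topology

namespace HK

/-! ### The form of `Λ` in coordinates -/

/-- The form of `E₈`, in a basis of simple roots. -/
def e8 (R : Type) [CommRing R] (x y : Fin 8 → R) : R :=
  ∑ a, ∑ b, x a * (CartanMatrix.E₈ a b : R) * y b

theorem form_eq (R : Type) [CommRing R] (x y : Idx → R) :
    form R x y =
      (∑ i : Fin 3, (x (.inl (i, 0)) * y (.inl (i, 1)) + x (.inl (i, 1)) * y (.inl (i, 0))))
      - (∑ j : Fin 2, e8 R (fun a => x (.inr (.inl (j, a)))) fun a => y (.inr (.inl (j, a))))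
      - 2 * (x (.inr (.inr ())) * y (.inr (.inr ()))) := by
  simp only [form, Matrix.toBilin'_apply, Fintype.sum_sum_type, Fintype.sum_prod_type, gram,
    Matrix.map_apply, Matrix.fromBlocks_apply₁₁, Matrix.fromBlocks_apply₁₂,
    Matrix.fromBlocks_apply₂₁, Matrix.fromBlocks_apply₂₂, Matrix.zero_apply, map_zero, mul_zero,
    zero_mul, Finset.sum_const_zero, add_zero, zero_add, Matrix.reindex_apply,
    Matrix.submatrix_apply, Equiv.prodComm_symm, Equiv.prodComm_apply, Prod.swap_prod_mk,
    Matrix.blockDiagonal_apply, Finset.univ_unique, Finset.sum_singleton, e8]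
  have h1 : (∑ i : Fin 3, ∑ a : Fin 2, ∑ i' : Fin 3, ∑ b : Fin 2, x (.inl (i, a)) *
      (Int.castRingHom R) (if i = i' then !![0, 1; 1, 0] a b else 0) * y (.inl (i', b)))
      = ∑ i : Fin 3, (x (.inl (i, 0)) * y (.inl (i, 1)) + x (.inl (i, 1)) * y (.inl (i, 0))) := by
    simp [Fin.sum_univ_succ]
  have h2 : (∑ j : Fin 2, ∑ a : Fin 8, ∑ j' : Fin 2, ∑ b : Fin 8, x (.inr (.inl (j, a))) *
      (Int.castRingHom R) (if j = j' then (-CartanMatrix.E₈) a b else 0) * y (.inr (.inl (j', b))))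
      = -∑ j : Fin 2, ∑ a : Fin 8, ∑ b : Fin 8,
        x (.inr (.inl (j, a))) * (CartanMatrix.E₈ a b : R) * y (.inr (.inl (j, b))) := by
    rw [← Finset.sum_neg_distrib]
    refine Finset.sum_congr rfl fun j _ => ?_
    rw [← Finset.sum_neg_distrib]
    refine Finset.sum_congr rfl fun a _ => ?_
    rw [Finset.sum_eq_single j]
    · rw [← Finset.sum_neg_distrib]
      refine Finset.sum_congr rfl fun b _ => ?_
      simp
    · intro j' _ hj
      simp [hj.symm]
    · simp
  rw [h1, h2]
  simp
  ring

theorem e8_comm (R : Type) [CommRing R] (x y : Fin 8 → R) : e8 R x y = e8 R y x := by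
  have hE : ∀ a b : Fin 8, CartanMatrix.E₈ b a = CartanMatrix.E₈ a b :=
    fun a b => congrFun (congrFun (show CartanMatrix.E₈ᵀ = CartanMatrix.E₈ by decide) a) b
  unfold e8
  rw [Finset.sum_comm]
  refine Finset.sum_congr rfl fun a _ => Finset.sum_congr rfl fun b _ => ?_
  rw [hE]
  ring

theorem e8_self (R : Type) [CommRing R] (x : Fin 8 → R) :
    e8 R x x = 2 * (x 0 ^ 2 + x 1 ^ 2 + x 2 ^ 2 + x 3 ^ 2 + x 4 ^ 2 + x 5 ^ 2 + x 6 ^ 2 + x 7 ^ 2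
      - x 0 * x 2 - x 1 * x 3 - x 2 * x 3 - x 3 * x 4 - x 4 * x 5 - x 5 * x 6 - x 6 * x 7) := by
  simp [e8, Fin.sum_univ_eight, CartanMatrix.E₈]
  ring

/-- Completing squares along the three arms of the Dynkin diagram; the branch vertex is left with
the coefficient `1 / 30`. -/
theorem e8_self_real (x : Fin 8 → ℝ) :
    e8 ℝ x x = 2 * (x 7 - x 6 / 2) ^ 2 + 3 / 2 * (x 6 - 2 / 3 * x 5) ^ 2
      + 4 / 3 * (x 5 - 3 / 4 * x 4) ^ 2 + 5 / 4 * (x 4 - 4 / 5 * x 3) ^ 2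
      + 2 * (x 0 - x 2 / 2) ^ 2 + 3 / 2 * (x 2 - 2 / 3 * x 3) ^ 2 + 2 * (x 1 - x 3 / 2) ^ 2
      + 1 / 30 * x 3 ^ 2 := by
  rw [e8_self]
  ring

theorem e8_nonneg (x : Fin 8 → ℝ) : 0 ≤ e8 ℝ x x := by
  rw [e8_self_real]
  positivity

theorem e8_eq_zero {x : Fin 8 → ℝ} (h : e8 ℝ x x ≤ 0) : x = 0 := by
  rw [e8_self_real] at h
  have h3 : x 3 = 0 := by
    have : x 3 ^ 2 ≤ 0 := by
      nlinarith [sq_nonneg (x 7 - x 6 / 2), sq_nonneg (x 6 - 2 / 3 * x 5),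
        sq_nonneg (x 5 - 3 / 4 * x 4), sq_nonneg (x 4 - 4 / 5 * x 3), sq_nonneg (x 0 - x 2 / 2),
        sq_nonneg (x 2 - 2 / 3 * x 3), sq_nonneg (x 1 - x 3 / 2)]
    exact pow_eq_zero_iff (two_ne_zero) |>.1 (le_antisymm this (sq_nonneg _))
  rw [h3] at h
  have key : ∀ a b c d e f g : ℝ, 2 * a ^ 2 + 3 / 2 * b ^ 2 + 4 / 3 * c ^ 2 + 5 / 4 * d ^ 2
      + 2 * e ^ 2 + 3 / 2 * f ^ 2 + 2 * g ^ 2 + 1 / 30 * (0 : ℝ) ^ 2 ≤ 0 →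
      a = 0 ∧ b = 0 ∧ c = 0 ∧ d = 0 ∧ e = 0 ∧ f = 0 ∧ g = 0 := by
    intro a b c d e f g h
    refine ⟨?_, ?_, ?_, ?_, ?_, ?_, ?_⟩ <;>
    · rw [← pow_eq_zero_iff two_ne_zero]
      refine le_antisymm ?_ (sq_nonneg _)
      linarith [sq_nonneg a, sq_nonneg b, sq_nonneg c, sq_nonneg d, sq_nonneg e, sq_nonneg f,
        sq_nonneg g]
  obtain ⟨h7, h6, h5, h4, h0, h2, h1⟩ := key _ _ _ _ _ _ _ h
  ext i
  fin_cases i <;> simp <;> linarith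

theorem form_comm (R : Type) [CommRing R] (x y : Idx → R) : form R x y = form R y x := by
  rw [form_eq, form_eq]
  simp_rw [e8_comm R (fun a => x _) _]
  congr 1
  · congr 1
    refine Finset.sum_congr rfl fun i _ => by ring
  · ring

theorem form_even (x : K3Lat) : Even (form ℤ x x) := by
  rw [form_eq]
  refine ((Finset.even_sum _ fun i _ => ?_).sub (Finset.even_sum _ fun j _ => ?_)).sub
    (even_two_mul _)
  · exact ⟨x (.inl (i, 0)) * x (.inl (i, 1)), by ring⟩
  · rw [e8_self]
    exact even_two_mul _

theorem form_toR (R : Type) [CommRing R] (x y : K3Lat) :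
    form R (toR R x) (toR R y) = (form ℤ x y : R) := by
  simp [form_eq, e8, toR]

/-- The inverse of the Cartan matrix of type `E₈`. -/
def e8Inv : Matrix (Fin 8) (Fin 8) ℤ :=
  !![4, 5, 7, 10, 8, 6, 4, 2;
     5, 8, 10, 15, 12, 9, 6, 3;
     7, 10, 14, 20, 16, 12, 8, 4;
     10, 15, 20, 30, 24, 18, 12, 6;
     8, 12, 16, 24, 20, 15, 10, 5;
     6, 9, 12, 18, 15, 12, 8, 4;
     4, 6, 8, 12, 10, 8, 6, 3;
     2, 3, 4, 6, 5, 4, 3, 2]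

theorem e8Inv_mul : e8Inv * CartanMatrix.E₈ = 1 := by decide +kernel

theorem dvd_of_e8 {s : ℤ} {x : Fin 8 → ℤ}
    (h : ∀ y, s ∣ e8 ℤ x y) (a : Fin 8) : s ∣ x a := by
  have hE : ∀ a, s ∣ (CartanMatrix.E₈ *ᵥ x) a := fun a => by
    have := h (Pi.single a 1)
    rw [e8_comm] at this
    simpa [e8, Pi.single_apply, Matrix.mulVec, dotProduct] using this
  have : x = e8Inv *ᵥ (CartanMatrix.E₈ *ᵥ x) := by
    rw [Matrix.mulVec_mulVec, e8Inv_mul, Matrix.one_mulVec]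
  rw [this]
  exact Finset.dvd_sum (s := Finset.univ) fun b _ => (hE b).mul_left (e8Inv a b)

/-- The coordinate along the generator of `I₁(-2)`. -/
abbrev dIdx : Idx := .inr (.inr ())

theorem dvd_coord {s : ℤ} {u : K3Lat} (h : ∀ y, s ∣ form ℤ u y) (i : Idx) (hi : i ≠ dIdx) :
    s ∣ u i := by
  match i with
  | .inl (i, 0) =>
    have := h (Pi.single (.inl (i, 1)) 1)
    rw [form_eq] at this
    simpa [Pi.single_apply, e8] using this
  | .inl (i, 1) =>
    have := h (Pi.single (.inl (i, 0)) 1)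
    rw [form_eq] at this
    simpa [Pi.single_apply, e8] using this
  | .inr (.inl (j, a)) =>
    refine dvd_of_e8 (x := fun a => u (.inr (.inl (j, a)))) (fun y => ?_) a
    have := h (fun i => match i with
      | .inr (.inl (j', a)) => if j' = j then y a else 0
      | _ => 0)
    rw [form_eq, Finset.sum_eq_single (f := fun j' : Fin 2 => e8 ℤ _ _) j] at this
    · simpa using this
    · intro j' _ hj
      simp [hj, e8]
    · simp
  | .inr (.inr ()) => exact absurd rfl hi

/-- The discriminant group of `Λ` is killed by `2`. -/
theorem exists_two_smul_eq {s : ℤ} {u : K3Lat} (h : ∀ y, s ∣ form ℤ u y) :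
    ∃ w : K3Lat, (2 : ℤ) • u = s • w := by
  have : ∀ i, s ∣ 2 * u i := by
    intro i
    by_cases hi : i = dIdx
    · subst hi
      have := h (Pi.single dIdx 1)
      rw [form_eq] at this
      simpa [Pi.single_apply, e8] using this
    · exact (dvd_coord h i hi).mul_left 2
  choose w hw using this
  exact ⟨w, by ext i; simpa using hw i⟩

theorem odd_coord {u : K3Lat} (h : ∀ y, 2 ∣ form ℤ u y) (h2 : ∀ w : K3Lat, u ≠ (2 : ℤ) • w) :
    ¬ 2 ∣ u dIdx := by
  intro hd
  have : ∀ i, 2 ∣ u i := by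
    intro i
    by_cases hi : i = dIdx
    · rwa [hi]
    · exact dvd_coord h i hi
  choose w hw using this
  exact h2 w (by ext i; simpa using hw i)

/-- The discriminant group of `Λ` has a single nonzero element. -/
theorem exists_sub_eq_two_smul {u u' : K3Lat} (h : ∀ y, 2 ∣ form ℤ u y)
    (h' : ∀ y, 2 ∣ form ℤ u' y) (h2 : ∀ w : K3Lat, u ≠ (2 : ℤ) • w)
    (h2' : ∀ w : K3Lat, u' ≠ (2 : ℤ) • w) : ∃ w : K3Lat, u - u' = (2 : ℤ) • w := by
  have : ∀ i, 2 ∣ u i - u' i := by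
    intro i
    by_cases hi : i = dIdx
    · have := odd_coord h h2
      have := odd_coord h' h2'
      subst hi
      omega
    · exact dvd_sub (dvd_coord h i hi) (dvd_coord h' i hi)
  choose w hw using this
  exact ⟨w, by ext i; simpa using hw i⟩

/-- The discriminant quadratic form of `Λ` takes the value `-1/2` at its nonzero element. -/
theorem exists_form_self_eq {u : K3Lat} (h : ∀ y, 2 ∣ form ℤ u y)
    (h2 : ∀ w : K3Lat, u ≠ (2 : ℤ) • w) : ∃ k : ℤ, form ℤ u u = 8 * k - 2 := by
  obtain ⟨z, hz⟩ : Odd (u dIdx) := by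
    rw [← Int.not_even_iff_odd, even_iff_two_dvd]
    exact odd_coord h h2
  set d : K3Lat := Pi.single dIdx 1 with hd
  have hud : ∀ i, 2 ∣ (u - d) i := by
    intro i
    by_cases hi : i = dIdx
    · subst hi
      simp [hd, hz]
    · simpa [hd, hi] using dvd_coord h i hi
  choose w hw using hud
  have hu : u = (2 : ℤ) • w + d := by
    ext i
    have := hw i
    simp at this ⊢
    linarith
  have hdd : form ℤ d d = -2 := by
    rw [form_eq]
    simp [hd, e8]
  have hdw : form ℤ w d = -2 * w dIdx := by
    rw [form_eq]
    simp [hd, e8]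
  obtain ⟨k, hk⟩ := form_even w
  refine ⟨k - w dIdx, ?_⟩
  rw [hu]
  simp only [map_add, LinearMap.add_apply, map_smul, LinearMap.smul_apply, smul_eq_mul, hdd,
    form_comm ℤ d w, hdw, hk]
  ring

theorem det_gram : gram.det = 2 := by
  have h8 : (-CartanMatrix.E₈).det ^ 2 = 1 := by
    have h := congrArg Matrix.det e8Inv_mul
    rw [Matrix.det_mul, Matrix.det_one] at h
    have h' : IsUnit (CartanMatrix.E₈.det) := IsUnit.of_mul_eq_one_right _ h
    rw [Matrix.det_neg]
    rcases Int.isUnit_iff.1 h' with h | h <;> simp [h]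
  rw [gram, Matrix.det_fromBlocks_zero₂₁, Matrix.det_fromBlocks_zero₂₁, Matrix.det_reindex_self,
    Matrix.det_reindex_self, Matrix.det_blockDiagonal, Matrix.det_blockDiagonal]
  simp only [Finset.prod_const, Finset.card_univ, Fintype.card_fin, h8]
  simp [Matrix.det_fin_two]

/-! ### Eichler transvections -/

theorem form_eq_dotProduct (R : Type) [CommRing R] (c : K3Lat) (x : Idx → R) :
    form R (toR R c) x = toR R (c ᵥ* gram) ⬝ᵥ x := by
  rw [form, Matrix.toBilin'_apply', Matrix.dotProduct_mulVec]
  congr 1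
  ext i
  simp [toR, Matrix.vecMul, dotProduct]

/-- The matrix of `x ↦ x + (c₁ · x) d₁ + (c₂ · x) d₂`. -/
def rankTwo (c₁ d₁ c₂ d₂ : K3Lat) : Matrix Idx Idx ℤ :=
  1 + Matrix.vecMulVec d₁ (c₁ ᵥ* gram) + Matrix.vecMulVec d₂ (c₂ ᵥ* gram)

theorem rankTwo_map_mulVec (R : Type) [CommRing R] (c₁ d₁ c₂ d₂ : K3Lat) (x : Idx → R) :
    (rankTwo c₁ d₁ c₂ d₂).map (Int.castRingHom R) *ᵥ x =
      x + form R (toR R c₁) x • toR R d₁ + form R (toR R c₂) x • toR R d₂ := by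
  have h : ∀ c d : K3Lat, (Matrix.vecMulVec d (c ᵥ* gram)).map (Int.castRingHom R) =
      Matrix.vecMulVec (toR R d) (toR R (c ᵥ* gram)) := fun c d => by
    ext i j
    simp [Matrix.vecMulVec_apply, toR]
  rw [rankTwo, Matrix.map_add _ (map_add _), Matrix.map_add _ (map_add _),
    Matrix.map_one _ (map_zero _) (map_one _), h, h, Matrix.add_mulVec, Matrix.add_mulVec,
    Matrix.one_mulVec, Matrix.vecMulVec_mulVec, Matrix.vecMulVec_mulVec, form_eq_dotProduct,
    form_eq_dotProduct]
  simp

theorem toR_int (x : K3Lat) : toR ℤ x = x := by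
  ext i
  simp [toR]

theorem rankTwo_mulVec (c₁ d₁ c₂ d₂ : K3Lat) (x : K3Lat) :
    rankTwo c₁ d₁ c₂ d₂ *ᵥ x = x + form ℤ c₁ x • d₁ + form ℤ c₂ x • d₂ := by
  have := rankTwo_map_mulVec ℤ c₁ d₁ c₂ d₂ x
  simp only [toR_int] at this
  rw [← this]
  congr 1

theorem transpose_mul_gram_mul {M : Matrix Idx Idx ℤ}
    (h : ∀ x y, form ℤ (M *ᵥ x) (M *ᵥ y) = form ℤ x y) : Mᵀ * gram * M = gram := by
  refine Matrix.toBilin'.injective ?_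
  rw [← Matrix.toBilin'_comp]
  refine LinearMap.BilinForm.ext fun x y => ?_
  have := h x y
  rw [form, show gram.map (Int.castRingHom ℤ) = gram by ext; simp] at this
  simpa using this

theorem isUnit_of_isometry {M : Matrix Idx Idx ℤ}
    (h : ∀ x y, form ℤ (M *ᵥ x) (M *ᵥ y) = form ℤ x y) : IsUnit M := by
  have h2 := congrArg Matrix.det (transpose_mul_gram_mul h)
  rw [Matrix.det_mul, Matrix.det_mul, Matrix.det_transpose, det_gram] at h2
  rw [Matrix.isUnit_iff_isUnit_det]
  exact IsUnit.of_mul_eq_one M.det (by linarith)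

/-- An isometry `x ↦ x + (c₁ · x) d₁ + (c₂ · x) d₂` with `c₁, c₂ ∈ h^⊥` belongs to `Ô(Λ, h)`: it
fixes `h`, and it acts trivially on the discriminant group because `cᵢ · x` is an integer for `x`
in the dual lattice. -/
theorem exists_mem_Ohat {h c₁ d₁ c₂ d₂ : K3Lat}
    (hiso : ∀ x y, form ℤ (x + form ℤ c₁ x • d₁ + form ℤ c₂ x • d₂)
      (y + form ℤ c₁ y • d₁ + form ℤ c₂ y • d₂) = form ℤ x y)
    (h₁ : form ℤ c₁ h = 0) (h₂ : form ℤ c₂ h = 0) :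
    ∃ g ∈ Ohat h, (∀ x : K3Lat, g.1 *ᵥ x = x + form ℤ c₁ x • d₁ + form ℤ c₂ x • d₂) ∧
      ∀ z : K3LatC, g.1.map (Int.castRingHom ℂ) *ᵥ z =
        z + form ℂ (toR ℂ c₁) z • toR ℂ d₁ + form ℂ (toR ℂ c₂) z • toR ℂ d₂ := by
  obtain ⟨g, hg⟩ := isUnit_of_isometry (M := rankTwo c₁ d₁ c₂ d₂) fun x y => by
    rw [rankTwo_mulVec, rankTwo_mulVec, hiso]
  refine ⟨g, ⟨fun x y => ?_, ?_, 1, fun x hx => ?_⟩, fun x => ?_, fun z => ?_⟩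
  · rw [hg, rankTwo_mulVec, rankTwo_mulVec, hiso]
  · rw [hg, rankTwo_mulVec, h₁, h₂]
    simp
  · obtain ⟨k₁, hk₁⟩ := hx c₁
    obtain ⟨k₂, hk₂⟩ := hx c₂
    refine ⟨k₁ • d₁ + k₂ • d₂, ?_⟩
    rw [hg, rankTwo_map_mulVec, form_comm, hk₁, form_comm, hk₂, toR_add, toR_smul, toR_smul]
    simp [add_assoc]
  · rw [hg, rankTwo_mulVec]
  · rw [hg, rankTwo_map_mulVec]

/-- The Eichler transvection of the isotropic vector `e` and of the vector `a` orthogonal to `e`,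
where `q` stands for half the square of `a`. -/
def transv (e a : K3Lat) (q : ℤ) (x : K3Lat) : K3Lat :=
  x - form ℤ a x • e + form ℤ e x • a - (q * form ℤ e x) • e

theorem form_transv (e a : K3Lat) (q : ℤ) (x y : K3Lat) :
    form ℤ (transv e a q x) y = form ℤ x y - form ℤ a x * form ℤ e y + form ℤ e x * form ℤ a y
      - q * form ℤ e x * form ℤ e y := by
  simp [-zsmul_eq_mul, transv, mul_comm]

/-- The orbit of `v` under `Ô(Λ, h)`. -/
def orb (h v : K3Lat) : Set K3Lat := {w | ∃ g ∈ Ohat h, g.1 *ᵥ v = w}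

theorem self_mem_orb (h v : K3Lat) : v ∈ orb h v := ⟨1, one_mem _, by simp⟩

theorem orb_trans {h v w x : K3Lat} (hw : w ∈ orb h v) (hx : x ∈ orb h w) : x ∈ orb h v := by
  obtain ⟨g, hg, rfl⟩ := hw
  obtain ⟨g', hg', rfl⟩ := hx
  exact ⟨g' * g, mul_mem hg' hg, by rw [Units.val_mul, Matrix.mulVec_mulVec]⟩

theorem transv_mem_orb {h e a v : K3Lat} {q : ℤ} (hee : form ℤ e e = 0)
    (hea : form ℤ e a = 0) (heh : form ℤ e h = 0) (hah : form ℤ a h = 0)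
    (haa : form ℤ a a = 2 * q) : transv e a q v ∈ orb h v := by
  have key : ∀ x, x + form ℤ (-a) x • e + form ℤ e x • (a - q • e) = transv e a q x := by
    intro x
    simp only [transv, map_neg, LinearMap.neg_apply]
    module
  obtain ⟨g, hg, hgx, -⟩ := exists_mem_Ohat (h := h) (c₁ := -a) (d₁ := e) (c₂ := e)
    (d₂ := a - q • e) (fun x y => by
      rw [key, key, form_transv, form_comm ℤ x, form_comm ℤ e (transv _ _ _ _),
        form_comm ℤ a (transv _ _ _ _), form_transv, form_transv, form_transv, hee, hea,
        form_comm ℤ a e, hea, haa, form_comm ℤ y x, form_comm ℤ y e, form_comm ℤ y a]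
      ring) (by simp [-zsmul_eq_mul, hah]) heh
  exact ⟨g, hg, by rw [hgx, key]⟩

/-- The isometry `e ↦ -e`, `f ↦ -f`, identity on the orthogonal of the hyperbolic plane spanned
by `e` and `f`. -/
theorem exists_reflection {h e f : K3Lat} (hee : form ℤ e e = 0) (hff : form ℤ f f = 0)
    (hef : form ℤ e f = 1) (heh : form ℤ e h = 0) (hfh : form ℤ f h = 0) :
    ∃ g ∈ Ohat h, (∀ x : K3Lat, g.1 *ᵥ x = x - (2 * form ℤ f x) • e - (2 * form ℤ e x) • f) ∧
      ∀ z : K3LatC, g.1.map (Int.castRingHom ℂ) *ᵥ z =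
        z - (2 * form ℂ (toR ℂ f) z) • toR ℂ e - (2 * form ℂ (toR ℂ e) z) • toR ℂ f := by
  have hfe : form ℤ f e = 1 := by rw [form_comm, hef]
  have t2 : ∀ x : K3Lat, toR ℂ (-(2 : ℤ) • x) = -(2 : ℂ) • toR ℂ x := fun x => by
    ext i
    simp [-zsmul_eq_mul, toR]
  obtain ⟨g, hg, hgx, hgz⟩ := exists_mem_Ohat (h := h) (c₁ := -(2 : ℤ) • f) (d₁ := e)
    (c₂ := -(2 : ℤ) • e) (d₂ := f) (fun x y => by
      simp only [map_add, map_smul, LinearMap.add_apply, LinearMap.smul_apply, smul_eq_mul,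
        hee, hff, hef, hfe, form_comm ℤ x e, form_comm ℤ x f]
      ring) (by simp [-zsmul_eq_mul, hfh]) (by simp [-zsmul_eq_mul, heh])
  refine ⟨g, hg, fun x => ?_, fun z => ?_⟩
  · rw [hgx]
    simp only [map_smul, LinearMap.smul_apply, smul_eq_mul]
    module
  · rw [hgz, t2, t2]
    simp only [map_smul, LinearMap.smul_apply, smul_eq_mul]
    module

/-! ### Eichler's criterion -/

/-- The vectors `e, f, e', f'` are the standard basis of a sublattice `U ⊕ U` of `h^⊥`. In the
names of the fields a subscript `2` stands for the second plane, and the capital letters `E` and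
`F` for `e'` and `f'` in a product with a vector of the first plane. -/
structure IsFrame (h e f e' f' : K3Lat) : Prop where
  ee : form ℤ e e = 0
  ff : form ℤ f f = 0
  ef : form ℤ e f = 1
  ee₂ : form ℤ e' e' = 0
  ff₂ : form ℤ f' f' = 0
  ef₂ : form ℤ e' f' = 1
  eE : form ℤ e e' = 0
  eF : form ℤ e f' = 0
  fE : form ℤ f e' = 0
  fF : form ℤ f f' = 0
  eh : form ℤ e h = 0
  fh : form ℤ f h = 0
  eh₂ : form ℤ e' h = 0
  fh₂ : form ℤ f' h = 0

namespace IsFrame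

variable {h e f e' f' : K3Lat}

theorem fe (F : IsFrame h e f e' f') : form ℤ f e = 1 := by rw [form_comm, F.ef]
theorem fe₂ (F : IsFrame h e f e' f') : form ℤ f' e' = 1 := by rw [form_comm, F.ef₂]
theorem Fe (F : IsFrame h e f e' f') : form ℤ f' e = 0 := by rw [form_comm, F.eF]
theorem Ef (F : IsFrame h e f e' f') : form ℤ e' f = 0 := by rw [form_comm, F.fE]
theorem Ff (F : IsFrame h e f e' f') : form ℤ f' f = 0 := by rw [form_comm, F.fF]

theorem swap₂ (F : IsFrame h e f e' f') : IsFrame h e f f' e' :=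
  ⟨F.ee, F.ff, F.ef, F.ff₂, F.ee₂, F.fe₂, F.eF, F.eE, F.fF, F.fE, F.eh, F.fh, F.fh₂, F.eh₂⟩

/-- If no vector of the orbit has a smaller pairing with `f`, the pairing with `f'` is a multiple
of it. -/
theorem dvd_form_right (F : IsFrame h e f e' f') {v : K3Lat} {m : ℤ}
    (hm : (∀ w ∈ orb h v, ¬ (0 < form ℤ w f ∧ form ℤ w f < m)) ∧ 0 < m ∨
      (∀ w ∈ orb h v, form ℤ w f = 0) ∧ m = 0)
    {w : K3Lat} (hw : w ∈ orb h v) (hwm : form ℤ w f = m) : m ∣ form ℤ w f' := by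
  set k := -(form ℤ w f' / m) with hk
  set w₁ := transv f (k • e') 0 w with hw₁
  have m₁ : w₁ ∈ orb h v := orb_trans hw <| transv_mem_orb F.ff (by simp [-zsmul_eq_mul, F.fE]) F.fh
    (by simp [-zsmul_eq_mul, F.eh₂]) (by simp [-zsmul_eq_mul, F.ee₂])
  have f₁ : form ℤ w₁ f = m := by
    rw [hw₁, form_transv]
    simp [-zsmul_eq_mul, F.ff, F.Ef, hwm]
  have g₁ : form ℤ w₁ f' = form ℤ w f' % m := by
    rw [hw₁, form_transv, form_comm ℤ f w, hwm]
    simp only [F.fF, map_smul, LinearMap.smul_apply, F.ef₂, smul_eq_mul, hk]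
    have := Int.emod_add_mul_ediv (form ℤ w f') m
    linear_combination (-1 : ℤ) * this
  set w₂ := transv e f' 0 w₁ with hw₂
  have m₂ : w₂ ∈ orb h v := orb_trans m₁ <| transv_mem_orb F.ee F.eF F.eh F.fh₂ (by
    simp [-zsmul_eq_mul, F.ff₂])
  have f₂ : form ℤ w₂ f = m - form ℤ w f' % m := by
    rw [hw₂, form_transv, form_comm ℤ f' w₁, g₁, f₁, F.ef, F.Ff]
    ring
  apply Int.dvd_of_emod_eq_zero
  rcases hm with ⟨hm, hm0⟩ | ⟨hm, rfl⟩
  · have := hm w₂ m₂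
    rw [f₂] at this
    have h1 := Int.emod_nonneg (form ℤ w f') hm0.ne'
    have h2 := Int.emod_lt_of_pos (form ℤ w f') hm0
    omega
  · have := hm w₂ m₂
    omega

/-- The descent behind Eichler's criterion: a vector `w` of the orbit whose pairing `m` with `f` is
minimal satisfies `m ∣ w · l` for all `l ∈ h^⊥`. -/
theorem dvd_form (F : IsFrame h e f e' f') {v : K3Lat} {m : ℤ}
    (hm : (∀ w ∈ orb h v, ¬ (0 < form ℤ w f ∧ form ℤ w f < m)) ∧ 0 < m ∨
      (∀ w ∈ orb h v, form ℤ w f = 0) ∧ m = 0)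
    {w : K3Lat} (hw : w ∈ orb h v) (hwm : form ℤ w f = m) {l : K3Lat} (hl : form ℤ l h = 0) :
    m ∣ form ℤ w l := by
  have hf' := F.dvd_form_right hm hw hwm
  have he' := F.swap₂.dvd_form_right hm hw hwm
  have he : m ∣ form ℤ w e := by
    obtain ⟨k, hk⟩ := he'
    set w₁ := transv f (-k • f') 0 w with hw₁
    have m₁ : w₁ ∈ orb h v := orb_trans hw <| transv_mem_orb F.ff
      (by simp [-zsmul_eq_mul, F.fF]) F.fh
      (by simp [-zsmul_eq_mul, F.fh₂]) (by simp [-zsmul_eq_mul, F.ff₂])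
    have f₁ : form ℤ w₁ f = m := by
      rw [hw₁, form_transv]
      simp [-zsmul_eq_mul, F.ff, F.Ff, hwm]
    have g₁ : form ℤ w₁ e' = 0 := by
      rw [hw₁, form_transv, form_comm ℤ f w, hwm, hk]
      simp [-zsmul_eq_mul, F.fE, F.fe₂]
    have h₁ : form ℤ w₁ e = form ℤ w e + k * form ℤ w f' := by
      rw [hw₁, form_transv]
      simp [-zsmul_eq_mul, F.fe, F.Fe, form_comm ℤ f' w]
    set w₂ := transv e e' 0 w₁ with hw₂
    have m₂ : w₂ ∈ orb h v := orb_trans m₁ <|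
      transv_mem_orb F.ee F.eE F.eh F.eh₂ (by simp [-zsmul_eq_mul, F.ee₂])
    have f₂ : form ℤ w₂ f = m := by
      rw [hw₂, form_transv, form_comm ℤ e' w₁, g₁, f₁, F.Ef]
      ring
    have := F.dvd_form_right hm m₂ f₂
    rw [hw₂, form_transv, form_comm ℤ e' w₁, g₁, F.ef₂, form_comm ℤ e w₁, h₁, F.eF] at this
    have h3 := F.dvd_form_right hm m₁ f₁
    have h4 : m ∣ form ℤ w e + k * form ℤ w f' := by
      have := dvd_sub this h3
      ring_nf at this ⊢
      exact this
    exact (dvd_add_left (hf'.mul_left k)).1 h4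
  set a := l - form ℤ l f • e - form ℤ l e • f - form ℤ l f' • e' - form ℤ l e' • f' with ha
  have a1 : form ℤ a e' = 0 := by
    simp [-zsmul_eq_mul, ha, F.eE, F.fE, F.ee₂, F.fe₂]
  have a2 : form ℤ a h = 0 := by simp [-zsmul_eq_mul, ha, hl, F.eh, F.fh, F.eh₂, F.fh₂]
  have a3 : form ℤ a f = 0 := by
    simp [-zsmul_eq_mul, ha, F.ef, F.ff, F.Ef, F.Ff]
  have a4 : form ℤ a f' = 0 := by
    simp [-zsmul_eq_mul, ha, F.eF, F.fF, F.ef₂, F.ff₂]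
  have hwa : m ∣ form ℤ w a := by
    obtain ⟨q, hq⟩ := form_even a
    set w₁ := transv e' a q w with hw₁
    have m₁ : w₁ ∈ orb h v := orb_trans hw <| transv_mem_orb F.ee₂ (by rw [form_comm, a1]) F.eh₂
      a2 (by rw [hq]; ring)
    have f₁ : form ℤ w₁ f = m := by
      rw [hw₁, form_transv]
      simp [-zsmul_eq_mul, F.Ef, a3, hwm]
    have := F.dvd_form_right hm m₁ f₁
    rw [hw₁, form_transv, a4, F.ef₂, form_comm ℤ a w, form_comm ℤ e' w] at this
    have h4 : form ℤ w a = form ℤ w f' - q * form ℤ w e' - (form ℤ w f' - form ℤ w a * 1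
        + form ℤ w e' * 0 - q * form ℤ w e' * 1) := by ring
    rw [h4]
    exact dvd_sub (dvd_sub hf' (he'.mul_left q)) this
  have hl' : form ℤ w l = form ℤ w a + form ℤ l f * form ℤ w e + form ℤ l e * form ℤ w f
      + form ℤ l f' * form ℤ w e' + form ℤ l e' * form ℤ w f' := by
    simp only [ha, map_sub, map_smul, smul_eq_mul]
    ring
  rw [hl', hwm]
  exact dvd_add (dvd_add (dvd_add (dvd_add hwa (he.mul_left _)) (dvd_mul_left _ _))
    (he'.mul_left _)) (hf'.mul_left _)

/-- Every vector can be moved by `Ô(Λ, h)` to one that is orthogonal to the second hyperbolic plane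
and whose pairing with `f` is its divisibility as a functional on `h^⊥`. -/
theorem exists_normal_form (F : IsFrame h e f e' f') (v : K3Lat) :
    ∃ w ∈ orb h v, 0 ≤ form ℤ w f ∧ form ℤ w e' = 0 ∧ form ℤ w f' = 0 ∧
      ∀ l, form ℤ l h = 0 → form ℤ w f ∣ form ℤ w l := by
  obtain ⟨m, w, hw, hwm, hm0, hm⟩ : ∃ m : ℤ, ∃ w ∈ orb h v, form ℤ w f = m ∧ 0 ≤ m ∧
      ((∀ w ∈ orb h v, ¬ (0 < form ℤ w f ∧ form ℤ w f < m)) ∧ 0 < m ∨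
        (∀ w ∈ orb h v, form ℤ w f = 0) ∧ m = 0) := by
    classical
    by_cases hex : ∃ n : ℕ, 0 < n ∧ ∃ w ∈ orb h v, form ℤ w f = n
    · obtain ⟨h1, w, hw, hwn⟩ := Nat.find_spec hex
      refine ⟨Nat.find hex, w, hw, hwn, by positivity, .inl ⟨fun w' hw' hlt => ?_, by
        exact_mod_cast h1⟩⟩
      refine Nat.find_min hex (m := (form ℤ w' f).toNat) (by omega) ⟨by omega, w', hw', by omega⟩
    · have hle : ∀ w ∈ orb h v, ¬ 0 < form ℤ w f := fun w hw h0 =>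
        hex ⟨(form ℤ w f).toNat, by omega, w, hw, by omega⟩
      refine ⟨_, v, self_mem_orb h v, rfl, ?_⟩
      have hz : ∀ w ∈ orb h v, form ℤ w f = 0 := by
        intro w hw
        obtain ⟨g, hg, hgx, -⟩ := exists_reflection F.ee F.ff F.ef F.eh F.fh
        have := hle _ (orb_trans hw ⟨g, hg, rfl⟩)
        rw [hgx] at this
        simp only [map_sub, map_smul, LinearMap.sub_apply, LinearMap.smul_apply, F.ef, F.ff,
          form_comm ℤ f w, smul_eq_mul] at this
        have := hle w hw
        omega
      rw [hz v (self_mem_orb h v)]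
      exact ⟨le_rfl, .inr ⟨hz, rfl⟩⟩
  obtain ⟨k, hk⟩ := F.dvd_form hm hw hwm F.eh₂
  obtain ⟨k', hk'⟩ := F.dvd_form hm hw hwm F.fh₂
  -- translating by a vector of the second plane kills the component of `w` in it
  set a := -k' • e' - k • f' with ha
  have a1 : form ℤ f a = 0 := by simp [-zsmul_eq_mul, ha, F.fE, F.fF]
  have a2 : form ℤ a h = 0 := by simp [-zsmul_eq_mul, ha, F.eh₂, F.fh₂]
  set w₁ := transv f a (k * k') w with hw₁
  have m₁ : w₁ ∈ orb h v := orb_trans hw <| transv_mem_orb F.ff a1 F.fh a2 (by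
    simp [-zsmul_eq_mul, ha, F.ee₂, F.ff₂, F.ef₂, F.fe₂]
    ring)
  have f₁ : form ℤ w₁ f = m := by
    rw [hw₁, form_transv, F.ff, form_comm ℤ a f, a1, hwm]
    ring
  refine ⟨w₁, m₁, f₁ ▸ hm0, ?_, ?_, fun l hl => f₁ ▸ F.dvd_form hm m₁ f₁ hl⟩
  · rw [hw₁, form_transv, F.fE, form_comm ℤ f w, hwm, hk]
    simp [-zsmul_eq_mul, ha, F.ee₂, F.fe₂]
  · rw [hw₁, form_transv, F.fF, form_comm ℤ f w, hwm, hk']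
    simp [-zsmul_eq_mul, ha, F.ff₂, F.ef₂]

end IsFrame

/-- Eichler's criterion for vectors in normal form. -/
theorem mem_orb_of_sub_eq {h f w w' l : K3Lat} {s : ℤ} (hff : form ℤ f f = 0)
    (hfh : form ℤ f h = 0) (hlh : form ℤ l h = 0) (hs : s ≠ 0) (hw : form ℤ w f = s)
    (hw' : form ℤ w' f = s) (hl : w' - w = s • l) (hww : form ℤ w' w' = form ℤ w w) :
    w' ∈ orb h w := by
  have hw'' : w' = w + s • l := by rw [← hl]; abel
  have hlf : form ℤ f l = 0 := by
    have : s * form ℤ l f = 0 := by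
      rw [hw''] at hw'
      simp only [map_add, map_smul, LinearMap.add_apply, LinearMap.smul_apply, smul_eq_mul] at hw'
      linarith
    rw [form_comm]
    exact (mul_eq_zero.1 this).resolve_left hs
  obtain ⟨q, hq⟩ := form_even l
  have hkey : form ℤ l w + q * s = 0 := by
    rw [hw''] at hww
    simp only [map_add, map_smul, LinearMap.add_apply, LinearMap.smul_apply, smul_eq_mul,
      form_comm ℤ w l, hq] at hww
    have : 2 * s * (form ℤ l w + q * s) = 0 := by linear_combination hww
    exact (mul_eq_zero.1 this).resolve_left (by simpa using hs)
  have : w' = transv f l q w := by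
    rw [hw'', transv, form_comm ℤ f w, hw]
    have : form ℤ l w = -(q * s) := by linarith
    rw [this]
    module
  rw [this]
  exact transv_mem_orb hff hlf hfh hlh (by rw [hq]; ring)

/-! ### Discriminants -/

theorem det_toMatrix_form {ι : Type} [Fintype ι] [DecidableEq ι] (B : Module.Basis ι ℤ K3Lat) :
    (LinearMap.BilinForm.toMatrix B (form ℤ)).det = 2 := by
  set S := Pi.basisFun ℤ Idx
  set e := B.indexEquiv S
  have h1 : LinearMap.BilinForm.toMatrix S (form ℤ) = gram := by
    rw [LinearMap.BilinForm.toMatrix_basisFun, form, LinearMap.BilinForm.toMatrix'_toBilin']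
    ext
    simp
  have h2 : LinearMap.BilinForm.toMatrix (B.reindex e) (form ℤ) =
      (LinearMap.BilinForm.toMatrix B (form ℤ)).submatrix e.symm e.symm := by
    ext i j
    simp [LinearMap.BilinForm.toMatrix_apply]
  have h3 := LinearMap.BilinForm.toMatrix_mul_basis_toMatrix S (B.reindex e) (form ℤ)
  have h4 := congrArg Matrix.det h3
  rw [Matrix.det_mul, Matrix.det_mul, Matrix.det_transpose, h1, det_gram, h2,
    Matrix.det_submatrix_equiv_self] at h4
  have h5 : IsUnit (S.toMatrix (B.reindex e)).det := by
    have := Module.Basis.toMatrix_mul_toMatrix_flip S (B.reindex e)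
    exact IsUnit.of_mul_eq_one _ (by rw [← Matrix.det_mul, this, Matrix.det_one])
  rcases Int.isUnit_iff.1 h5 with h | h <;> rw [h] at h4 <;> linarith

/-- The discriminant of the common kernel `M` of two functionals `(k₁ · x) / c₁`, `(k₂ · x) / c₂`
on `Λ` that define a surjection onto `ℤ²`. -/
theorem disc_of_orthogonal {k₁ k₂ w₁ w₂ : K3Lat} {c₁ c₂ : ℤ} (hc₁ : c₁ ≠ 0) (hc₂ : c₂ ≠ 0)
    (h₁ : ∀ x, c₁ ∣ form ℤ k₁ x) (h₂ : ∀ x, c₂ ∣ form ℤ k₂ x) (h₁₁ : form ℤ k₁ w₁ = c₁)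
    (h₁₂ : form ℤ k₁ w₂ = 0) (h₂₁ : form ℤ k₂ w₁ = 0) (h₂₂ : form ℤ k₂ w₂ = c₂)
    {M : Submodule ℤ K3Lat} (hM : ∀ x, x ∈ M ↔ form ℤ k₁ x = 0 ∧ form ℤ k₂ x = 0) :
    c₁ ^ 2 * c₂ ^ 2 * disc M =
      2 * (form ℤ k₁ k₁ * form ℤ k₂ k₂ - form ℤ k₁ k₂ ^ 2) := by
  choose φ₁ hφ₁ using h₁
  choose φ₂ hφ₂ using h₂
  set b := Module.finBasis ℤ M with hb
  set w : Fin 2 → K3Lat := ![w₁, w₂]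
  set k : Fin 2 → K3Lat := ![k₁, k₂]
  set c : Fin 2 → ℤ := ![c₁, c₂]
  have hkw : ∀ i j, form ℤ (k i) (w j) = if i = j then c i else 0 := by
    intro i j
    fin_cases i <;> fin_cases j <;> simp [k, w, c, h₁₁, h₁₂, h₂₁, h₂₂]
  have hkM : ∀ i, ∀ x : M, form ℤ (k i) x = 0 := by
    intro i x
    have := (hM x).1 x.2
    fin_cases i
    exacts [this.1, this.2]
  let ψ : ((Fin 2 → ℤ) × M) →ₗ[ℤ] K3Lat :=
    (Fintype.linearCombination ℤ w).coprod M.subtype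
  have hψ : ∀ y, ψ y = y.1 0 • w₁ + y.1 1 • w₂ + y.2 := by
    intro y
    simp [ψ, w, Fintype.linearCombination_apply, Fin.sum_univ_two, -zsmul_eq_mul]
  have hbij : Function.Bijective ψ := by
    refine ⟨(injective_iff_map_eq_zero ψ).2 fun y hy => ?_, fun x => ?_⟩
    · rw [hψ] at hy
      have e1 := congrArg (form ℤ k₁) hy
      have e2 := congrArg (form ℤ k₂) hy
      have hm := (hM y.2).1 y.2.2
      simp only [map_add, map_smul, h₁₁, h₁₂, h₂₁, h₂₂, hm.1, hm.2, smul_eq_mul, map_zero,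
        mul_zero, add_zero, zero_add, mul_eq_zero, hc₁, hc₂, or_false] at e1 e2
      rw [e1, e2] at hy
      simp only [zero_smul, zero_add] at hy
      refine Prod.ext (funext fun i => ?_) (Subtype.ext hy)
      fin_cases i
      exacts [e1, e2]
    · have hx : x - φ₁ x • w₁ - φ₂ x • w₂ ∈ M := by
        rw [hM]
        simp only [map_sub, map_smul, h₁₁, h₁₂, h₂₁, h₂₂, hφ₁ x, hφ₂ x, smul_eq_mul]
        constructor <;> ring
      refine ⟨(![φ₁ x, φ₂ x], ⟨_, hx⟩), ?_⟩
      rw [hψ]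
      simp [-zsmul_eq_mul]
  set B := ((Pi.basisFun ℤ (Fin 2)).prod b).map (LinearEquiv.ofBijective ψ hbij) with hB
  have hBl : ∀ i, B (.inl i) = w i := by
    intro i
    simp only [hB, Module.Basis.map_apply, LinearEquiv.ofBijective_apply, hψ]
    fin_cases i <;> simp [w, -zsmul_eq_mul]
  have hBr : ∀ j, B (.inr j) = b j := by
    intro i
    simp only [hB, Module.Basis.map_apply, LinearEquiv.ofBijective_apply, hψ]
    simp
  set y : Fin 2 ⊕ Fin (Module.finrank ℤ M) → K3Lat := Sum.elim k (fun j => (b j : K3Lat)) with hy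
  set X : Matrix _ _ ℤ := Matrix.of fun i j => B.repr (y i) j with hX
  set N : Matrix _ _ ℤ := Matrix.of fun i j => form ℤ (y i) (B j) with hN
  have hXB : ∀ i, y i = ∑ l, X i l • B l := fun i => (B.sum_repr (y i)).symm
  have hNX : N = X * LinearMap.BilinForm.toMatrix B (form ℤ) := by
    ext i j
    rw [Matrix.mul_apply, hN, Matrix.of_apply, hXB]
    simp [LinearMap.BilinForm.toMatrix_apply, -zsmul_eq_mul]
  set P : Matrix (Fin 2) (Fin 2) ℤ := X.toBlocks₁₁
  have hXblocks : X = Matrix.fromBlocks P X.toBlocks₁₂ 0 1 := by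
    rw [← Matrix.fromBlocks_toBlocks X]
    congr 1
    · ext i j
      simp [Matrix.toBlocks₂₁, hX, hy, ← hBr]
    · ext i j
      simp [Matrix.toBlocks₂₂, hX, hy, ← hBr, Matrix.one_apply, Finsupp.single_apply]
  have hNblocks : N = Matrix.fromBlocks (Matrix.diagonal c) 0 N.toBlocks₂₁
      (LinearMap.BilinForm.toMatrix b ((form ℤ).restrict M)) := by
    rw [← Matrix.fromBlocks_toBlocks N]
    congr 1
    · ext i j
      simp [Matrix.toBlocks₁₁, hN, hy, hBl, hkw, Matrix.diagonal_apply]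
    · ext i j
      simp [Matrix.toBlocks₁₂, hN, hy, hBr, hkM]
    · ext i j
      simp [Matrix.toBlocks₂₂, hN, hy, hBr, LinearMap.BilinForm.toMatrix_apply,
        LinearMap.BilinForm.restrict_apply]
  have hdet := congrArg Matrix.det hNX
  rw [hNblocks, Matrix.det_fromBlocks_zero₁₂, Matrix.det_mul, det_toMatrix_form, hXblocks,
    Matrix.det_fromBlocks_zero₂₁, Matrix.det_one, Matrix.det_diagonal] at hdet
  change _ * disc M = _ at hdet
  have hGram : ∀ i l, form ℤ (k i) (k l) = c i * P l i := by
    intro i l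
    have h1 : form ℤ (k i) (k l) = form ℤ (k i) (∑ j, X (.inl l) j • B j) := by
      rw [← hXB]
      rfl
    rw [h1, map_sum, Fintype.sum_sum_type, Finset.sum_eq_single i, Finset.sum_eq_zero, add_zero,
      map_smul, hBl, hkw, if_pos rfl, smul_eq_mul, mul_comm]
    · rfl
    · intro j _
      rw [map_smul, hBr, hkM, smul_zero]
    · intro j _ hj
      rw [map_smul, hBl, hkw, if_neg hj.symm, smul_zero]
    · exact fun h => absurd (Finset.mem_univ i) h
  have g11 := hGram 0 0
  have g12 := hGram 0 1
  have g21 := hGram 1 0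
  have g22 := hGram 1 1
  simp only [k, c, Matrix.cons_val_zero, Matrix.cons_val_one] at g11 g12 g21 g22
  rw [Matrix.det_fin_two, Fin.prod_univ_two] at hdet
  simp only [c, Matrix.cons_val_zero, Matrix.cons_val_one, mul_one] at hdet
  have hx : form ℤ k₁ k₂ ^ 2 = c₁ * P 1 0 * (c₂ * P 0 1) := by
    rw [sq]
    nth_rewrite 1 [g12]
    rw [form_comm, g21]
  rw [hx, g11, g22]
  linear_combination c₁ * c₂ * hdet

/-! ### Polarizations and hyperbolic planes -/

/-- The sublattice spanned by `h` and `v`. -/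
def plane (h v : K3Lat) : Submodule ℤ K3Lat := Submodule.span ℤ {h, v}

theorem mem_plane {h v x : K3Lat} : x ∈ plane h v ↔ ∃ a b : ℤ, a • h + b • v = x :=
  Submodule.mem_span_pair

theorem left_mem_plane (h v : K3Lat) : h ∈ plane h v := mem_plane.2 ⟨1, 0, by simp⟩

theorem right_mem_plane (h v : K3Lat) : v ∈ plane h v := mem_plane.2 ⟨0, 1, by simp⟩

theorem mem_orth_plane {h v x : K3Lat} :
    x ∈ orth (plane h v) ↔ form ℤ h x = 0 ∧ form ℤ v x = 0 := by
  rw [orth, LinearMap.BilinForm.mem_orthogonal_iff]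
  refine ⟨fun H => ⟨H h (left_mem_plane h v), H v (right_mem_plane h v)⟩, fun H n hn => ?_⟩
  obtain ⟨a, b, rfl⟩ := mem_plane.1 hn
  simp [-zsmul_eq_mul, H.1, H.2]

/-- The independence of `h` and `v`, in coordinates. -/
def IsIndep (h v : K3Lat) : Prop := ∀ a b : ℤ, a • h + b • v = 0 → a = 0 ∧ b = 0

theorem IsIndep.eq_of_eq {h v : K3Lat} (H : IsIndep h v) {a b a' b' : ℤ}
    (h' : a • h + b • v = a' • h + b' • v) : a = a' ∧ b = b' := by
  have := H (a - a') (b - b') (by rw [sub_smul, sub_smul, ← sub_eq_zero.2 h']; abel)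
  exact ⟨by linarith [this.1], by linarith [this.2]⟩

theorem exists_eq_plane {h : K3Lat} (hh : IsPrimitiveVector h) {K : Submodule ℤ K3Lat}
    (hK : Module.finrank ℤ K = 2) (hhK : h ∈ K) : ∃ v, K = plane h v ∧ IsIndep h v := by
  set b := Module.finBasisOfFinrankEq ℤ K hK
  have hrep : ∀ x ∈ K, ∃ p q : ℤ, x = p • (b 0 : K3Lat) + q • (b 1 : K3Lat) := by
    intro x hx
    have := congrArg Subtype.val (b.sum_repr ⟨x, hx⟩)
    rw [Fin.sum_univ_two] at this
    exact ⟨_, _, this.symm⟩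
  obtain ⟨p, q, hpq⟩ := hrep h hhK
  have hcop : IsCoprime p q := by
    rw [Int.isCoprime_iff_gcd_eq_one]
    have h1 : IsUnit ((Int.gcd p q : ℕ) : ℤ) := by
      obtain ⟨p', hp⟩ := Int.gcd_dvd_left p q
      obtain ⟨q', hq⟩ := Int.gcd_dvd_right p q
      refine hh.2 _ (p' • (b 0 : K3Lat) + q' • (b 1 : K3Lat)) ?_
      rw [smul_add, smul_smul, smul_smul, ← hp, ← hq, hpq]
    rcases Int.isUnit_iff.1 h1 with h | h <;> omega
  obtain ⟨u, w, huw⟩ := hcop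
  have hb : ∀ x y : ℤ, x • (b 0 : K3Lat) + y • (b 1 : K3Lat) = 0 → x = 0 ∧ y = 0 := by
    intro x y hxy
    have := LinearIndependent.pair_iff.1 (show LinearIndependent ℤ ![b 0, b 1] by
      have := b.linearIndependent
      rwa [show ⇑b = ![b 0, b 1] by ext i; fin_cases i <;> rfl] at this) x y
    exact this (Subtype.ext (by simpa [-zsmul_eq_mul] using hxy))
  set v : K3Lat := (-w) • (b 0 : K3Lat) + u • (b 1 : K3Lat) with hv
  have e0 : (b 0 : K3Lat) = u • h - q • v := by
    calc (b 0 : K3Lat) = (u * p + w * q) • (b 0 : K3Lat) := by rw [huw, one_smul]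
      _ = _ := by
        rw [hv, hpq]
        module
  have e1 : (b 1 : K3Lat) = w • h + p • v := by
    calc (b 1 : K3Lat) = (u * p + w * q) • (b 1 : K3Lat) := by rw [huw, one_smul]
      _ = _ := by
        rw [hv, hpq]
        module
  have hvK : v ∈ K := K.add_mem (K.smul_mem _ (b 0).2) (K.smul_mem _ (b 1).2)
  refine ⟨v, le_antisymm (fun x hx => ?_) ?_, fun α β h0 => ?_⟩
  · obtain ⟨α, β, rfl⟩ := hrep x hx
    rw [mem_plane]
    refine ⟨α * u + β * w, -(α * q) + β * p, ?_⟩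
    rw [e0, e1]
    module
  · rw [plane, Submodule.span_le]
    rintro x (rfl | rfl)
    exacts [hhK, hvK]
  · have := hb (α * p - β * w) (α * q + β * u) (by
      rw [← h0, hv, hpq]
      module)
    constructor
    · linear_combination u * this.1 + w * this.2 - α * huw
    · linear_combination p * this.2 - q * this.1 - β * huw

/-- A plane that contains a vector of positive square and has negative discriminant is
hyperbolic. -/
theorem signature_plane {h v : K3Lat} (hi : IsIndep h v) (hh : 0 < form ℤ h h)
    (hd : form ℤ h h * form ℤ v v - form ℤ h v ^ 2 < 0) :
    Module.finrank ℤ (plane h v) = 2 ∧ sigPos (quad (plane h v)) = 1 ∧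
      sigNeg (quad (plane h v)) = 1 := by
  have hr : Module.finrank ℤ (plane h v) = 2 := by
    have := finrank_span_eq_card (LinearIndependent.pair_iff.2 hi)
    rw [Matrix.range_cons, Matrix.range_cons, Matrix.range_empty, Set.union_empty] at this
    rw [plane, ← Set.singleton_union]
    exact this
  have hq : ∀ x : plane h v, quad (plane h v) x = form ℤ x x := fun x => rfl
  have one_le : ∀ (Q : QuadraticForm ℤ (plane h v)) (y : plane h v), 0 < Q y →
      1 ≤ sigPos Q := by
    intro Q y hy
    have hy0 : y ≠ 0 := by
      rintro rfl
      simp at hy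
    have hpd : (Q.restrict (Submodule.span ℤ {y})).PosDef := by
      rintro ⟨x, hx⟩ hx0
      obtain ⟨a, rfl⟩ := Submodule.mem_span_singleton.1 hx
      have ha : a ≠ 0 := by
        rintro rfl
        exact hx0 (Subtype.ext (zero_smul ℤ y))
      rw [QuadraticMap.restrict_apply, QuadraticMap.map_smul, smul_eq_mul]
      have := mul_self_pos.2 ha
      positivity
    have : Nontrivial (Submodule.span ℤ {y}) :=
      ⟨⟨⟨y, Submodule.mem_span_singleton_self y⟩, 0, fun h => hy0 (congrArg Subtype.val h)⟩⟩
    exact (Nat.succ_le_of_lt (Module.finrank_pos (R := ℤ) (M := Submodule.span ℤ {y}))).trans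
      (le_sigPos_of_posDef Q hpd)
  have hpos := one_le (quad (plane h v)) ⟨h, left_mem_plane h v⟩ (by rw [hq]; exact hh)
  have hneg := one_le (-quad (plane h v))
    ⟨form ℤ h h • v - form ℤ h v • h, sub_mem (Submodule.smul_mem _ _ (right_mem_plane h v))
      (Submodule.smul_mem _ _ (left_mem_plane h v))⟩ (by
    rw [neg_apply, hq]
    simp only [map_sub, map_smul, LinearMap.sub_apply, LinearMap.smul_apply, smul_eq_mul,
      form_comm ℤ v h]
    nlinarith)
  obtain ⟨V, hV, hVp⟩ := exists_finrank_eq_sigPos_and_posDef (quad (plane h v))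
  obtain ⟨W, hW, hWn⟩ := exists_finrank_eq_sigNeg_and_negDef (quad (plane h v))
  have hsum : Module.finrank ℤ V + Module.finrank ℤ W ≤ 2 := by
    rw [← hr, ← Module.finrank_prod]
    refine LinearMap.finrank_le_finrank_of_injective (f := V.subtype.coprod W.subtype) ?_
    refine (injective_iff_map_eq_zero _).2 fun y hy => ?_
    simp only [LinearMap.coprod_apply, Submodule.subtype_apply] at hy
    have e : (y.1 : plane h v) = -y.2 := eq_neg_of_add_eq_zero_left hy
    by_cases h0 : y.2 = 0
    · refine Prod.ext (Subtype.ext ?_) h0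
      rw [e, h0]
      simp
    · exfalso
      have h1 : y.1 ≠ 0 := by
        intro h1
        rw [h1] at e
        exact h0 (Subtype.ext (by simpa using e.symm))
      have a1 := hVp y.1 h1
      have a2 := hWn y.2 h0
      rw [QuadraticMap.restrict_apply] at a1 a2
      rw [e, QuadraticMap.map_neg] at a1
      rw [neg_apply] at a2
      linarith
  change 1 ≤ sigNeg _ at hneg
  refine ⟨hr, ?_, ?_⟩ <;> omega

theorem exists_form_eq {h : K3Lat} {γ : ℕ} (hγ : HasDivisibility h γ) :
    (∀ x, (γ : ℤ) ∣ form ℤ h x) ∧ ∃ y, form ℤ h y = γ := by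
  constructor
  · intro x
    have : form ℤ h x ∈ LinearMap.range (form ℤ h) := ⟨x, rfl⟩
    rw [hγ.2] at this
    exact Ideal.mem_span_singleton.1 this
  · have : (γ : ℤ) ∈ LinearMap.range (form ℤ h) := by
      rw [hγ.2]
      exact Ideal.mem_span_singleton_self _
    exact this

theorem orb_symm {h v w : K3Lat} (hw : w ∈ orb h v) : v ∈ orb h w := by
  obtain ⟨g, hg, rfl⟩ := hw
  refine ⟨g⁻¹, inv_mem hg, ?_⟩
  rw [Matrix.mulVec_mulVec, ← Units.val_mul]
  simp

theorem form_of_mem_orb {h v w : K3Lat} (hw : w ∈ orb h v) :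
    form ℤ w w = form ℤ v v ∧ form ℤ w h = form ℤ v h := by
  obtain ⟨g, hg, rfl⟩ := hw
  refine ⟨hg.1 v v, ?_⟩
  nth_rewrite 1 [← hg.2.1]
  exact hg.1 v h

/-- The `i`-th hyperbolic plane of `Λ`. -/
def stdU (i : Fin 3) (j : Fin 2) : K3Lat := Pi.single (.inl (i, j)) 1

theorem form_stdU (i i' : Fin 3) (j j' : Fin 2) :
    form ℤ (stdU i j) (stdU i' j') = if i = i' ∧ j ≠ j' then 1 else 0 := by
  rw [form_eq]
  revert i i' j j'
  simp only [stdU, e8, Pi.single_apply]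
  decide

/-- The orthogonal of a vector contains two orthogonal hyperbolic planes. -/
theorem exists_isFrame (h : K3Lat) : ∃ e f e' f', IsFrame h e f e' f' := by
  have F₀ : IsFrame 0 (stdU 0 0) (stdU 0 1) (stdU 1 0) (stdU 1 1) := by
    constructor <;> simp [form_stdU]
  obtain ⟨w, hw, -, h1, h2, hdiv⟩ := F₀.exists_normal_form h
  obtain ⟨k, hk⟩ := hdiv (stdU 2 0) (by simp)
  obtain ⟨k', hk'⟩ := hdiv (stdU 2 1) (by simp)
  have F : IsFrame w (stdU 1 0) (stdU 1 1) (stdU 2 0 - k • stdU 0 1)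
      (stdU 2 1 - k' • stdU 0 1) := by
    constructor <;>
      simp only [map_sub, map_smul, LinearMap.sub_apply, LinearMap.smul_apply, form_stdU,
        form_comm ℤ _ w, h1, h2, hk, hk', smul_eq_mul] <;> first | simp | ring
  obtain ⟨g, hg, hgw⟩ := orb_symm hw
  have hg' := hg.1
  rw [← hgw]
  refine ⟨g.1 *ᵥ stdU 1 0, g.1 *ᵥ stdU 1 1, g.1 *ᵥ (stdU 2 0 - k • stdU 0 1),
    g.1 *ᵥ (stdU 2 1 - k' • stdU 0 1), ?_⟩
  obtain ⟨a1, a2, a3, a4, a5, a6, a7, a8, a9, a10, a11, a12, a13, a14⟩ := F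
  constructor <;> rw [hg'] <;> assumption

/-! ### Classification of the hyperbolic planes through `h` -/

/-- The functional `v · l` of `l ∈ h^⊥` has divisibility `s`. -/
def IsDivOn (h v : K3Lat) (s : ℤ) : Prop :=
  (∀ l, form ℤ l h = 0 → s ∣ form ℤ v l) ∧ ∃ l, form ℤ l h = 0 ∧ form ℤ v l = s

theorem form_of_orb_eq {h v : K3Lat} {g : GL Idx ℤ} (hg : g ∈ Ohat h) (l : K3Lat) :
    form ℤ (g.1 *ᵥ v) l = form ℤ v ((g⁻¹).1 *ᵥ l) ∧ form ℤ ((g⁻¹).1 *ᵥ l) h = form ℤ l h := by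
  have e : ∀ x : K3Lat, g.1 *ᵥ ((g⁻¹).1 *ᵥ x) = x := fun x => by
    rw [Matrix.mulVec_mulVec, ← Units.val_mul]; simp
  constructor
  · rw [← hg.1 v, e]
  · rw [← hg.1, e, hg.2.1]

theorem IsDivOn.of_mem_orb {h v w : K3Lat} {s : ℤ} (hw : w ∈ orb h v) (H : IsDivOn h w s) :
    IsDivOn h v s := by
  obtain ⟨g, hg, hgv⟩ := orb_symm hw
  rw [← hgv]
  refine ⟨fun l hl => ?_, ?_⟩
  · rw [(form_of_orb_eq hg l).1]
    exact H.1 _ (by rw [(form_of_orb_eq (v := h) hg l).2, hl])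
  · obtain ⟨l, hl, hls⟩ := H.2
    refine ⟨g.1 *ᵥ l, ?_, by rw [hg.1, hls]⟩
    nth_rewrite 1 [← hg.2.1]
    rw [hg.1, hl]

theorem IsDivOn.unique {h v : K3Lat} {s s' : ℤ} (H : IsDivOn h v s) (H' : IsDivOn h v s')
    (hs : 0 ≤ s) (hs' : 0 ≤ s') : s = s' := by
  obtain ⟨l, hl, hls⟩ := H.2
  obtain ⟨l', hl', hls'⟩ := H'.2
  exact Int.dvd_antisymm hs hs' (hls' ▸ H.1 l' hl') (hls ▸ H'.1 l hl)

/-- A vector of given divisibility on `h^⊥` has a normal form. -/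
theorem IsFrame.exists_normal_form_isDivOn {h e f e' f' : K3Lat} (F : IsFrame h e f e' f')
    (v : K3Lat) : ∃ w ∈ orb h v, form ℤ w e' = 0 ∧ form ℤ w f' = 0 ∧ 0 ≤ form ℤ w f ∧
      IsDivOn h v (form ℤ w f) := by
  obtain ⟨w, hw, h0, h1, h2, hdiv⟩ := F.exists_normal_form v
  exact ⟨w, hw, h1, h2, h0, IsDivOn.of_mem_orb hw ⟨hdiv, f, F.fh, rfl⟩⟩

theorem mem_orb_of_isDivOn {h v v' : K3Lat} {s : ℤ} (hs : 0 < s) (H : IsDivOn h v s)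
    (H' : IsDivOn h v' s) (hh : form ℤ v h = form ℤ v' h) (hv : form ℤ v v = form ℤ v' v')
    (hsub : ∀ w ∈ orb h v, ∀ w' ∈ orb h v', ∃ l, w' - w = s • l) : v' ∈ orb h v := by
  obtain ⟨e, f, e', f', F⟩ := exists_isFrame h
  obtain ⟨w, hw, -, -, h0, hd⟩ := F.exists_normal_form_isDivOn v
  obtain ⟨w', hw', -, -, h0', hd'⟩ := F.exists_normal_form_isDivOn v'
  obtain ⟨l, hl⟩ := hsub w hw w' hw'
  have a := form_of_mem_orb hw
  have a' := form_of_mem_orb hw'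
  have hlh : form ℤ l h = 0 := by
    have := congrArg (fun x => form ℤ x h) hl
    simp only [map_sub, map_smul, LinearMap.sub_apply, LinearMap.smul_apply, smul_eq_mul, a.2,
      a'.2, hh, sub_self] at this
    exact (mul_eq_zero.1 this.symm).resolve_left hs.ne'
  have := mem_orb_of_sub_eq (h := h) (f := f) (w := w) (w' := w') F.ff F.fh hlh hs.ne'
    (hd.unique H h0 hs.le) (hd'.unique H' h0' hs.le) hl (by rw [a.1, a'.1, hv])
  exact orb_trans (orb_trans hw this) (orb_symm hw')

/-- Vectors of divisibility `1` on `h^⊥` with the same square and the same pairing with `h` are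
equivalent. -/
theorem mem_orb_of_isDivOn_one {h v v' : K3Lat} (H : IsDivOn h v 1) (H' : IsDivOn h v' 1)
    (hh : form ℤ v h = form ℤ v' h) (hv : form ℤ v v = form ℤ v' v') : v' ∈ orb h v :=
  mem_orb_of_isDivOn one_pos H H' hh hv fun w _ w' _ => ⟨w' - w, by simp⟩

/-- `v / 2` is a nonzero element of the discriminant group of `Λ`. -/
def IsHalf (v : K3Lat) : Prop := (∀ y, 2 ∣ form ℤ v y) ∧ ∀ w : K3Lat, v ≠ (2 : ℤ) • w

theorem IsHalf.of_mem_orb {h v w : K3Lat} (hw : w ∈ orb h v) (H : IsHalf v) : IsHalf w := by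
  obtain ⟨g, hg, rfl⟩ := hw
  refine ⟨fun y => ?_, fun w hw => ?_⟩
  · rw [(form_of_orb_eq hg y).1]
    exact H.1 _
  · refine H.2 ((g⁻¹).1 *ᵥ w) ?_
    rw [← Matrix.mulVec_smul, ← hw, Matrix.mulVec_mulVec, ← Units.val_mul]
    simp

theorem IsHalf.exists_sub_eq {v v' : K3Lat} (H : IsHalf v) (H' : IsHalf v') :
    ∃ w : K3Lat, v - v' = (2 : ℤ) • w :=
  exists_sub_eq_two_smul H.1 H'.1 H.2 H'.2

theorem IsHalf.exists_form_self {v : K3Lat} (H : IsHalf v) : ∃ k : ℤ, form ℤ v v = 8 * k - 2 :=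
  exists_form_self_eq H.1 H.2

theorem mem_orb_of_isDivOn_two {h v v' : K3Lat} (H : IsDivOn h v 2) (H' : IsDivOn h v' 2)
    (hv₂ : IsHalf v) (hv₂' : IsHalf v') (hh : form ℤ v h = form ℤ v' h)
    (hv : form ℤ v v = form ℤ v' v') : v' ∈ orb h v :=
  mem_orb_of_isDivOn two_pos H H' hh hv fun _ hw _ hw' =>
    (hv₂'.of_mem_orb hw').exists_sub_eq (hv₂.of_mem_orb hw)

/-- If the functional `v` on `h^⊥` is divisible by `s`, then `γ v` differs by a multiple of `h` from
an element of `γ s Λ^∨`. -/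
theorem exists_dvd_form {h v f₁ : K3Lat} {γ s : ℤ} (hdiv : ∀ x, γ ∣ form ℤ h x)
    (hf₁ : form ℤ h f₁ = γ) (H : ∀ l, form ℤ l h = 0 → s ∣ form ℤ v l) (x : K3Lat) :
    γ * s ∣ form ℤ (γ • v - form ℤ v f₁ • h) x := by
  obtain ⟨k, hk⟩ := hdiv x
  have h1 := H (x - k • f₁) (by
    simp only [map_sub, map_smul, LinearMap.sub_apply, LinearMap.smul_apply, form_comm ℤ _ h, hk,
      hf₁, smul_eq_mul]
    ring)
  have h2 : form ℤ (γ • v - form ℤ v f₁ • h) x = γ * form ℤ v (x - k • f₁) := by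
    simp only [map_sub, map_smul, LinearMap.sub_apply, LinearMap.smul_apply, hk, smul_eq_mul]
    ring
  rw [h2]
  exact mul_dvd_mul_left _ h1

theorem eq_one_or_two_of_isDivOn_of_one {h v : K3Lat} {s : ℤ} (hγ : HasDivisibility h 1)
    (hp : IsPrimitiveSublattice (plane h v)) (hi : IsIndep h v) (hs : 0 ≤ s)
    (H : IsDivOn h v s) :
    s = 1 ∨ s = 2 ∧ ∃ v', plane h v' = plane h v ∧ IsIndep h v' ∧ IsHalf v' ∧ IsDivOn h v' 2 := by
  obtain ⟨hdiv, f₁, hf₁⟩ := exists_form_eq hγ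
  have key := exists_dvd_form (v := v) hdiv hf₁ H.1
  simp only [one_mul, one_smul, Nat.cast_one] at key
  set c := form ℤ v f₁
  obtain ⟨y, hy⟩ := exists_two_smul_eq key
  have hs0 : s ≠ 0 := by
    rintro rfl
    have := hi (2 * -c) 2 (by rw [zero_smul] at hy; rw [← hy]; module)
    omega
  have hyK : y ∈ plane h v := hp s y hs0 (by
    rw [← hy]
    exact mem_plane.2 ⟨2 * -c, 2, by module⟩)
  obtain ⟨a, b, rfl⟩ := mem_plane.1 hyK
  have h2 := (hi.eq_of_eq (a := 2 * -c) (b := 2) (a' := s * a) (b' := s * b) (by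
    rw [show (2 * -c) • h + (2 : ℤ) • v = (2 : ℤ) • (v - c • h) by module, hy]
    module)).2
  have hs2 : s ∣ 2 := ⟨b, h2⟩
  have hle := Int.le_of_dvd two_pos hs2
  interval_cases s
  · exact absurd rfl hs0
  · exact .inl rfl
  · refine .inr ⟨rfl, v - c • h, ?_, ?_, ⟨key, ?_⟩, ?_⟩
    · ext x
      rw [mem_plane, mem_plane]
      constructor
      · rintro ⟨a, b, rfl⟩
        exact ⟨a - b * c, b, by module⟩
      · rintro ⟨a, b, rfl⟩
        exact ⟨a + b * c, b, by module⟩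
    · intro a b hab
      have := hi (a - b * c) b (by rw [← hab]; module)
      refine ⟨?_, this.2⟩
      simpa [this.2] using this.1
    · intro w hw
      have hwK : w ∈ plane h v := hp 2 w two_ne_zero (by
        rw [← hw]
        exact mem_plane.2 ⟨-c, 1, by module⟩)
      obtain ⟨a, b, rfl⟩ := mem_plane.1 hwK
      have := (hi.eq_of_eq (a := -c) (b := 1) (a' := 2 * a) (b' := 2 * b) (by
        rw [show (-c) • h + (1 : ℤ) • v = v - c • h by module, hw]
        module)).2
      omega
    · have e : ∀ l, form ℤ l h = 0 → form ℤ (v - c • h) l = form ℤ v l := by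
        intro l hl
        simp [-zsmul_eq_mul, form_comm ℤ h l, hl]
      obtain ⟨l, hl, hls⟩ := H.2
      exact ⟨fun l hl => by rw [e l hl]; exact H.1 l hl, l, hl, by rw [e l hl, hls]⟩

theorem not_eq_two_smul {h v w : K3Lat} {a b : ℤ} (hp : IsPrimitiveSublattice (plane h v))
    (hi : IsIndep h v) (hw : a • h + b • v = (2 : ℤ) • w) : 2 ∣ a ∧ 2 ∣ b := by
  have hwK : w ∈ plane h v := hp 2 w two_ne_zero (by
    rw [← hw]
    exact mem_plane.2 ⟨a, b, rfl⟩)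
  obtain ⟨a', b', rfl⟩ := mem_plane.1 hwK
  have := hi.eq_of_eq (a := a) (b := b) (a' := 2 * a') (b' := 2 * b') (by rw [hw]; module)
  omega

theorem eq_one_of_isDivOn_of_two {h v : K3Lat} {s : ℤ} (hγ : HasDivisibility h 2)
    (hp : IsPrimitiveSublattice (plane h v)) (hi : IsIndep h v) (hs : 0 ≤ s)
    (H : IsDivOn h v s) : s = 1 := by
  obtain ⟨hdiv, f₁, hf₁⟩ := exists_form_eq hγ
  have key := exists_dvd_form (v := v) hdiv hf₁ H.1
  simp only [Nat.cast_ofNat] at key hdiv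
  set c := form ℤ v f₁
  obtain ⟨y, hy⟩ := exists_two_smul_eq key
  have hy : s • y = (2 : ℤ) • v - c • h := by
    refine smul_right_injective K3Lat (two_ne_zero (α := ℤ)) ?_
    simp only
    rw [hy]
    module
  have hs0 : s ≠ 0 := by
    rintro rfl
    have := hi (-c) 2 (by rw [zero_smul] at hy; rw [hy]; module)
    omega
  have hyK : y ∈ plane h v := hp s y hs0 (by
    rw [hy]
    exact mem_plane.2 ⟨-c, 2, by module⟩)
  obtain ⟨a, b, rfl⟩ := mem_plane.1 hyK
  obtain ⟨h1, h2⟩ := hi.eq_of_eq (a := -c) (b := 2) (a' := s * a) (b' := s * b) (by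
    rw [show (-c) • h + (2 : ℤ) • v = (2 : ℤ) • v - c • h by module, ← hy]
    module)
  have hs2 : s ∣ 2 := ⟨b, h2⟩
  have hle := Int.le_of_dvd two_pos hs2
  interval_cases s
  · exact absurd rfl hs0
  · rfl
  -- otherwise `h` and `v + a h` have the same nonzero class in the discriminant group
  · exfalso
    have e1 : (2 : ℤ) • v - c • h = (2 : ℤ) • (v + a • h) := by
      rw [show c = -(2 * a) by linarith]
      module
    have hh : IsHalf h := ⟨hdiv, fun w hw => by
      have := not_eq_two_smul hp hi (a := 1) (b := 0) (w := w) (by rw [← hw]; module)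
      omega⟩
    have hv : IsHalf (v + a • h) := by
      refine ⟨fun y => ?_, fun w hw => ?_⟩
      · have := key y
        rw [e1, map_smul, LinearMap.smul_apply, smul_eq_mul] at this
        exact Int.dvd_of_mul_dvd_mul_left two_ne_zero this
      · have := not_eq_two_smul hp hi (a := a) (b := 1) (w := w) (by rw [← hw]; module)
        omega
    obtain ⟨w, hw⟩ := hv.exists_sub_eq hh
    have := not_eq_two_smul hp hi (a := a - 1) (b := 1) (w := w) (by rw [← hw]; module)
    omega

/-! ### The planes of a Noether–Lefschetz locus -/

/-- The planes that contribute to the Noether–Lefschetz locus of discriminant `d`. -/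
def NLPlanes (h : K3Lat) (d : ℕ) : Set (Submodule ℤ K3Lat) :=
  {K | IsHyperbolicPlaneThrough h K ∧ disc (orth K) = -(d : ℤ)}

/-- The discriminant of `⟨h, v⟩^⊥`, when `v / s` is in the dual lattice and `s` is the divisibility
of `v` on `h^⊥`: then `h / γ` and `v / s` define a surjection of `Λ` onto `ℤ²`. -/
theorem disc_orth_plane_of_isDivOn {h v : K3Lat} {γ : ℕ} {s : ℤ} (hγ : HasDivisibility h γ)
    (hs : s ≠ 0) (H : IsDivOn h v s) (hv : ∀ y, s ∣ form ℤ v y) :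
    (γ : ℤ) ^ 2 * s ^ 2 * disc (orth (plane h v)) =
      2 * (form ℤ h h * form ℤ v v - form ℤ h v ^ 2) := by
  obtain ⟨hdiv, f₁, hf₁⟩ := exists_form_eq hγ
  obtain ⟨l, hl, hls⟩ := H.2
  obtain ⟨c, hc⟩ := hv f₁
  refine disc_of_orthogonal (w₁ := f₁ - c • l) (w₂ := l) (by exact_mod_cast hγ.1.ne') hs hdiv hv
    ?_ ?_ ?_ hls fun x => mem_orth_plane
  · rw [map_sub, map_smul, hf₁, form_comm ℤ h l, hl]
    simp
  · rw [form_comm, hl]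
  · rw [map_sub, map_smul, hc, hls, smul_eq_mul]
    ring

/-- For a polarization of divisibility `1`, the discriminant group of order `2` leaves two types of
planes through `h`. -/
theorem exists_of_mem_NLPlanes_one {n d : ℕ} {h : K3Lat} (hh : IsPolarization n 1 h)
    {K : Submodule ℤ K3Lat} (hK : K ∈ NLPlanes h d) :
    ∃ v, K = plane h v ∧ IsIndep h v ∧
      (IsDivOn h v 1 ∧ (d : ℤ) = 2 * (form ℤ h v ^ 2 - 2 * n * form ℤ v v) ∨
        IsDivOn h v 2 ∧ IsHalf v ∧ 2 * (d : ℤ) = form ℤ h v ^ 2 - 2 * n * form ℤ v v) := by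
  obtain ⟨⟨hp, hr, -, -, hhK⟩, hd⟩ := hK
  obtain ⟨v, rfl, hi⟩ := exists_eq_plane hh.1 hr hhK
  obtain ⟨e, f, e', f', F⟩ := exists_isFrame h
  obtain ⟨w, -, -, -, h0, hdiv⟩ := F.exists_normal_form_isDivOn v
  rcases eq_one_or_two_of_isDivOn_of_one hh.2.2 hp hi h0 hdiv with hs | ⟨-, v', hv', hi', hh', hd'⟩
  · rw [hs] at hdiv
    refine ⟨v, rfl, hi, .inl ⟨hdiv, ?_⟩⟩
    have := disc_orth_plane_of_isDivOn hh.2.2 one_ne_zero hdiv (by simp)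
    rw [hd, hh.2.1] at this
    push_cast at this
    linarith
  · refine ⟨v', hv'.symm, hi', .inr ⟨hd', hh', ?_⟩⟩
    have := disc_orth_plane_of_isDivOn hh.2.2 two_ne_zero hd' hh'.1
    rw [hv', hd, hh.2.1] at this
    push_cast at this
    linarith

theorem exists_of_mem_NLPlanes_two {n d : ℕ} {h : K3Lat} (hh : IsPolarization n 2 h)
    {K : Submodule ℤ K3Lat} (hK : K ∈ NLPlanes h d) :
    ∃ v, K = plane h v ∧ IsIndep h v ∧ IsDivOn h v 1 ∧
      2 * (d : ℤ) = form ℤ h v ^ 2 - 2 * n * form ℤ v v := by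
  obtain ⟨⟨hp, hr, -, -, hhK⟩, hd⟩ := hK
  obtain ⟨v, rfl, hi⟩ := exists_eq_plane hh.1 hr hhK
  obtain ⟨e, f, e', f', F⟩ := exists_isFrame h
  obtain ⟨w, -, -, -, h0, hdiv⟩ := F.exists_normal_form_isDivOn v
  rw [eq_one_of_isDivOn_of_two hh.2.2 hp hi h0 hdiv] at hdiv
  refine ⟨v, rfl, hi, hdiv, ?_⟩
  have := disc_orth_plane_of_isDivOn hh.2.2 one_ne_zero hdiv (by simp)
  rw [hd, hh.2.1] at this
  push_cast at this
  linarith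

/-- The action of `Ô(Λ, h)` on sublattices. -/
def act (g : GL Idx ℤ) (K : Submodule ℤ K3Lat) : Submodule ℤ K3Lat := K.map (Matrix.mulVecLin g.1)

theorem act_plane (g : GL Idx ℤ) (h v : K3Lat) :
    act g (plane h v) = plane (g.1 *ᵥ h) (g.1 *ᵥ v) := by
  rw [act, plane, Submodule.map_span, plane, Set.image_pair]
  rfl

theorem plane_add_smul {h v : K3Lat} {ε m : ℤ} (hε : ε * ε = 1) :
    plane h (ε • v + m • h) = plane h v := by
  ext x
  rw [mem_plane, mem_plane]
  constructor
  · rintro ⟨a, b, rfl⟩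
    exact ⟨a + b * m, b * ε, by module⟩
  · rintro ⟨a, b, rfl⟩
    refine ⟨a - b * ε * m, b * ε, ?_⟩
    have : b • v = (b * (ε * ε)) • v := by rw [hε, mul_one]
    rw [this]
    module

theorem IsDivOn.add_smul {h v : K3Lat} {s ε m : ℤ} (hε : ε * ε = 1) (H : IsDivOn h v s) :
    IsDivOn h (ε • v + m • h) s := by
  have e : ∀ l, form ℤ l h = 0 → form ℤ (ε • v + m • h) l = ε * form ℤ v l := by
    intro l hl
    simp [-zsmul_eq_mul, form_comm ℤ h l, hl]
  obtain ⟨l, hl, hls⟩ := H.2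
  refine ⟨fun l hl => by rw [e l hl]; exact (H.1 l hl).mul_left _, ε • l, ?_, ?_⟩
  · simp [-zsmul_eq_mul, hl]
  · rw [e _ (by simp [-zsmul_eq_mul, hl]), map_smul, hls, smul_eq_mul, ← mul_assoc, hε, one_mul]

theorem form_self_of_form_eq {n : ℕ} {h v v' : K3Lat} {ε m : ℤ} (hn : 0 < n)
    (hh : form ℤ h h = 2 * n) (hε : ε * ε = 1)
    (hb : form ℤ h v' = ε * form ℤ h v + 2 * n * m)
    (hd : form ℤ h v ^ 2 - 2 * n * form ℤ v v = form ℤ h v' ^ 2 - 2 * n * form ℤ v' v') :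
    form ℤ (ε • v + m • h) h = form ℤ v' h ∧
      form ℤ (ε • v + m • h) (ε • v + m • h) = form ℤ v' v' := by
  have e1 : form ℤ (ε • v + m • h) h = form ℤ v' h := by
    simp only [map_add, map_smul, LinearMap.add_apply, LinearMap.smul_apply, smul_eq_mul, hh,
      form_comm ℤ _ h, hb]
    ring
  refine ⟨e1, ?_⟩
  have hn' : (2 * n : ℤ) ≠ 0 := by positivity
  refine mul_left_cancel₀ hn' ?_
  rw [hb] at hd
  simp only [map_add, map_smul, LinearMap.add_apply, LinearMap.smul_apply, smul_eq_mul, hh,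
    form_comm ℤ v h]
  linear_combination (-1 : ℤ) * hd + (2 * n * form ℤ v v - form ℤ h v ^ 2) * hε

theorem exists_act_eq {h v v' : K3Lat} {ε m : ℤ} (hε : ε * ε = 1)
    (H : v' ∈ orb h (ε • v + m • h)) : ∃ g ∈ Ohat h, act g (plane h v) = plane h v' := by
  obtain ⟨g, hg, hgv⟩ := H
  exact ⟨g, hg, by rw [← plane_add_smul (m := m) hε, act_plane, hgv, hg.2.1]⟩

/-- Planes of divisibility `1` on `h^⊥` with the same discriminant are equivalent when the pairings
of `h` with their generators agree up to sign modulo `2n`: the generator of a plane is unique up to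
sign and the addition of multiples of `h`. -/
theorem exists_act_eq_of_isDivOn_one {n : ℕ} {h v v' : K3Lat} {ε m : ℤ} (hn : 0 < n)
    (hh : form ℤ h h = 2 * n) (H : IsDivOn h v 1) (H' : IsDivOn h v' 1) (hε : ε * ε = 1)
    (hb : form ℤ h v' = ε * form ℤ h v + 2 * n * m)
    (hd : form ℤ h v ^ 2 - 2 * n * form ℤ v v = form ℤ h v' ^ 2 - 2 * n * form ℤ v' v') :
    ∃ g ∈ Ohat h, act g (plane h v) = plane h v' := by
  obtain ⟨e1, e2⟩ := form_self_of_form_eq hn hh hε hb hd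
  exact exists_act_eq hε (mem_orb_of_isDivOn_one (H.add_smul hε) H' e1 e2)

theorem exists_act_eq_of_isDivOn_two {n : ℕ} {h v v' : K3Lat} {ε m : ℤ} (hn : 0 < n)
    (hh : form ℤ h h = 2 * n) (H : IsDivOn h v 2) (H' : IsDivOn h v' 2) (hv : IsHalf v)
    (hv' : IsHalf v') (hε : ε * ε = 1)
    (hb : form ℤ h v' = ε * form ℤ h v + 2 * n * (2 * m))
    (hd : form ℤ h v ^ 2 - 2 * n * form ℤ v v = form ℤ h v' ^ 2 - 2 * n * form ℤ v' v') :
    ∃ g ∈ Ohat h, act g (plane h v) = plane h v' := by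
  obtain ⟨e1, e2⟩ := form_self_of_form_eq hn hh hε hb hd
  refine exists_act_eq hε (mem_orb_of_isDivOn_two (H.add_smul hε) H' ⟨fun y => ?_, fun w hw => ?_⟩
    hv' e1 e2)
  · simp only [map_add, map_smul, LinearMap.add_apply, LinearMap.smul_apply, smul_eq_mul]
    exact dvd_add ((hv.1 y).mul_left _) ⟨m * form ℤ h y, by ring⟩
  · refine hv.2 (ε • (w - m • h)) ?_
    have : v = (ε * ε) • v := by rw [hε, one_smul]
    rw [this, mul_smul, eq_sub_of_add_eq hw]
    module

theorem IsPrimitiveVector.exists_eq_smul {h y : K3Lat} (hh : IsPrimitiveVector h) {k α : ℤ}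
    (hk : k ≠ 0) (H : k • y = α • h) : ∃ c : ℤ, y = c • h := by
  obtain ⟨g, k', α', hg, hco, rfl, rfl⟩ := Int.exists_gcd_one' (m := k) (n := α)
    (Int.gcd_pos_of_ne_zero_left _ hk)
  have hg0 : (g : ℤ) ≠ 0 := by exact_mod_cast hg.ne'
  obtain ⟨u, w, huw⟩ := Int.isCoprime_iff_gcd_eq_one.2 hco
  have H' : k' • y = α' • h := by
    refine smul_right_injective K3Lat hg0 ?_
    simp only
    rw [smul_smul, smul_smul, mul_comm, H, mul_comm]
  have hu := hh.2 k' (u • h + w • y) (by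
    calc h = (u * k' + w * α') • h := by rw [huw, one_smul]
      _ = (u * k') • h + w • (α' • h) := by module
      _ = _ := by rw [← H']; module)
  rcases Int.isUnit_iff.1 hu with rfl | rfl
  · exact ⟨α', by rw [← H', one_smul]⟩
  · exact ⟨-α', by rw [neg_smul, ← H']; module⟩

theorem mem_NLPlanes_of_plane {n d : ℕ} {h v : K3Lat} {c : ℤ} (hn : 0 < n)
    (hh : form ℤ h h = 2 * n) (hp : IsPrimitiveSublattice (plane h v)) (hi : IsIndep h v)
    (hd : 0 < d) (hc : c ≠ 0)
    (hc₁ : c ^ 2 * d = 2 * (form ℤ h v ^ 2 - 2 * n * form ℤ v v))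
    (hc₂ : c ^ 2 * disc (orth (plane h v)) =
      2 * (form ℤ h h * form ℤ v v - form ℤ h v ^ 2)) : plane h v ∈ NLPlanes h d := by
  have hc' : 0 < c ^ 2 := by positivity
  have hd' : (0 : ℤ) < d := by exact_mod_cast hd
  obtain ⟨h1, h2, h3⟩ := signature_plane hi (by rw [hh]; positivity) (by
    rw [hh]
    nlinarith [mul_pos hc' hd'])
  refine ⟨⟨hp, h1, h2, h3, left_mem_plane h v⟩, mul_left_cancel₀ hc'.ne' ?_⟩
  rw [hc₂, hh]
  linear_combination hc₁

theorem IsFrame.exists_orthogonal {h e f e' f' : K3Lat} (F : IsFrame h e f e' f') (x : K3Lat) :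
    ∃ y, form ℤ h y = form ℤ h x ∧ form ℤ y e = 0 ∧ form ℤ y f = 0 := by
  refine ⟨x - form ℤ x f • e - form ℤ x e • f, ?_, ?_, ?_⟩
  · simp [-zsmul_eq_mul, form_comm ℤ h e, form_comm ℤ h f, F.eh, F.fh]
  · simp [-zsmul_eq_mul, F.ee, F.fe]
  · simp [-zsmul_eq_mul, F.ef, F.ff]

/-- Planes of divisibility `1` on `h^⊥` with prescribed invariants. -/
theorem exists_plane_of_isDivOn_one {n γ d : ℕ} {h : K3Lat} (hh : IsPolarization n γ h)
    (hn : 0 < n) (hd : 0 < d) {b q : ℤ}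
    (hbq : (γ : ℤ) ^ 2 * d = 2 * ((γ * b) ^ 2 - 2 * n * (2 * q))) :
    ∃ v, IsDivOn h v 1 ∧ form ℤ h v = γ * b ∧ form ℤ v v = 2 * q ∧ plane h v ∈ NLPlanes h d := by
  obtain ⟨e, f, e', f', F⟩ := exists_isFrame h
  obtain ⟨hdiv, f₀, hf₀⟩ := exists_form_eq hh.2.2
  obtain ⟨f₁, h1, h2, h3⟩ := F.exists_orthogonal f₀
  rw [hf₀] at h1
  obtain ⟨j, hj⟩ := form_even f₁
  set v := e + (q - b ^ 2 * j) • f + b • f₁ with hv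
  have hvf : form ℤ v f = 1 := by
    simp [hv, -zsmul_eq_mul, F.ef, F.ff, h3]
  have hvh : form ℤ h v = γ * b := by
    simp [hv, -zsmul_eq_mul, form_comm ℤ h e, form_comm ℤ h f, F.eh, F.fh, h1, mul_comm]
  have hvv : form ℤ v v = 2 * q := by
    simp only [hv, map_add, map_smul, LinearMap.add_apply, LinearMap.smul_apply, smul_eq_mul,
      F.ee, F.ef, F.fe, F.ff, h2, h3, form_comm ℤ e f₁, form_comm ℤ f f₁, hj]
    ring
  have hi : IsIndep h v := by
    intro α β hαβ
    have e1 := congrArg (fun x => form ℤ x f) hαβ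
    simp only [map_add, map_smul, LinearMap.add_apply, LinearMap.smul_apply, hvf, form_comm ℤ h f,
      F.fh, smul_eq_mul, map_zero, LinearMap.zero_apply] at e1
    have hβ : β = 0 := by linarith
    rw [hβ, zero_smul, add_zero] at hαβ
    exact ⟨(smul_eq_zero.1 hαβ).resolve_right hh.1.1, hβ⟩
  have hdiv₁ : IsDivOn h v 1 := ⟨by simp, f, F.fh, hvf⟩
  have hp : IsPrimitiveSublattice (plane h v) := by
    intro k x hk hx
    obtain ⟨α, β, hαβ⟩ := mem_plane.1 hx
    have e1 := congrArg (fun x => form ℤ x f) hαβ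
    simp only [map_add, map_smul, LinearMap.add_apply, LinearMap.smul_apply, hvf, form_comm ℤ h f,
      F.fh, smul_eq_mul] at e1
    have hβ : β = k * form ℤ x f := by linarith
    obtain ⟨c, hc⟩ := hh.1.exists_eq_smul (y := x - form ℤ x f • v) (α := α) hk (by
      rw [smul_sub, ← hαβ, hβ]
      module)
    exact mem_plane.2 ⟨c, form ℤ x f, by rw [← hc]; module⟩
  refine ⟨v, hdiv₁, hvh, hvv, mem_NLPlanes_of_plane (c := γ) hn hh.2.1 hp hi hd
    (by exact_mod_cast hh.2.2.1.ne') (by rw [hvh, hvv, hbq]) ?_⟩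
  simpa using disc_orth_plane_of_isDivOn hh.2.2 one_ne_zero hdiv₁ (by simp)

theorem IsHalf.add_two_smul {v w : K3Lat} (H : IsHalf v) : IsHalf (v + (2 : ℤ) • w) := by
  refine ⟨fun y => ?_, fun x hx => H.2 (x - w) ?_⟩
  · rw [map_add, map_smul, LinearMap.add_apply, LinearMap.smul_apply, smul_eq_mul]
    exact dvd_add (H.1 y) (dvd_mul_right _ _)
  · rw [smul_sub, ← hx]
    abel

theorem isHalf_single : IsHalf (Pi.single dIdx 1) := by
  refine ⟨fun y => ⟨-y dIdx, ?_⟩, fun w hw => ?_⟩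
  · rw [form_eq]
    simp [e8]
  · have := congrFun hw dIdx
    simp at this
    omega

/-- Planes of divisibility `2` on `h^⊥` with prescribed invariants. -/
theorem exists_plane_of_isDivOn_two {n d : ℕ} {h : K3Lat} (hh : IsPolarization n 1 h)
    (hn : 0 < n) (hd : 0 < d) {b k : ℤ}
    (hbk : 2 * (d : ℤ) = (2 * b) ^ 2 - 2 * n * (8 * k - 2)) :
    ∃ v, IsDivOn h v 2 ∧ IsHalf v ∧ form ℤ h v = 2 * b ∧ form ℤ v v = 8 * k - 2 ∧
      plane h v ∈ NLPlanes h d := by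
  obtain ⟨e, f, e', f', F⟩ := exists_isFrame h
  obtain ⟨-, f₀, hf₀⟩ := exists_form_eq hh.2.2
  obtain ⟨f₁, h1, h2, h3⟩ := F.exists_orthogonal f₀
  rw [hf₀] at h1
  rw [Nat.cast_one] at h1
  set δ : K3Lat := Pi.single dIdx 1
  obtain ⟨x, hx⟩ := isHalf_single.1 e
  obtain ⟨y, hy⟩ := isHalf_single.1 f
  obtain ⟨z, hz⟩ := isHalf_single.1 h
  set r := δ + (2 : ℤ) • ((b - z) • f₁ - y • e - x • f) with hr
  have hre : form ℤ r e = 0 := by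
    simp only [hr, map_add, map_sub, map_smul, LinearMap.add_apply, LinearMap.sub_apply,
      LinearMap.smul_apply, smul_eq_mul, F.ee, F.fe, h2, δ, hx]
    ring
  have hrf : form ℤ r f = 0 := by
    simp only [hr, map_add, map_sub, map_smul, LinearMap.add_apply, LinearMap.sub_apply,
      LinearMap.smul_apply, smul_eq_mul, F.ef, F.ff, h3, δ, hy]
    ring
  have hrh : form ℤ r h = 2 * b := by
    simp only [hr, map_add, map_sub, map_smul, LinearMap.add_apply, LinearMap.sub_apply,
      LinearMap.smul_apply, smul_eq_mul, F.eh, F.fh, form_comm ℤ f₁ h, h1, δ, hz]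
    ring
  obtain ⟨j, hj⟩ : ∃ j : ℤ, form ℤ r r = 8 * j - 2 :=
    (isHalf_single.add_two_smul : IsHalf r).exists_form_self
  set v := r + (2 : ℤ) • (e + (k - j) • f) with hv
  have hhalf : IsHalf v := (isHalf_single.add_two_smul : IsHalf r).add_two_smul
  have hvf : form ℤ v f = 2 := by
    simp [hv, -zsmul_eq_mul, F.ef, F.ff, hrf]
  have hvh : form ℤ h v = 2 * b := by
    simp only [hv, map_add, map_smul, smul_eq_mul, form_comm ℤ h e, form_comm ℤ h f, F.eh, F.fh,
      form_comm ℤ h r, hrh]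
    ring
  have hvv : form ℤ v v = 8 * k - 2 := by
    simp only [hv, map_add, map_smul, LinearMap.add_apply, LinearMap.smul_apply, smul_eq_mul,
      F.ee, F.ef, F.fe, F.ff, hre, hrf, form_comm ℤ e r, form_comm ℤ f r, hj]
    ring
  have hi : IsIndep h v := by
    intro α β hαβ
    have e1 := congrArg (fun x => form ℤ x f) hαβ
    simp only [map_add, map_smul, LinearMap.add_apply, LinearMap.smul_apply, hvf, form_comm ℤ h f,
      F.fh, smul_eq_mul, map_zero, LinearMap.zero_apply] at e1
    have hβ : β = 0 := by linarith
    rw [hβ, zero_smul, add_zero] at hαβ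
    exact ⟨(smul_eq_zero.1 hαβ).resolve_right hh.1.1, hβ⟩
  have hdiv₂ : IsDivOn h v 2 := ⟨fun l _ => hhalf.1 l, f, F.fh, hvf⟩
  have hp : IsPrimitiveSublattice (plane h v) := by
    intro m x hm hx
    obtain ⟨α, β, hαβ⟩ := mem_plane.1 hx
    have e1 := congrArg (fun x => form ℤ x f) hαβ
    have e2 := congrArg (fun x => form ℤ x f₁) hαβ
    obtain ⟨c, hc⟩ := hhalf.1 f₁
    simp only [map_add, map_smul, LinearMap.add_apply, LinearMap.smul_apply, hvf, form_comm ℤ h f,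
      F.fh, smul_eq_mul, h1, hc] at e1 e2
    set y := form ℤ x f
    have hα : α = m * (form ℤ x f₁ - y * c) := by linear_combination e2 - c * e1
    set α' := form ℤ x f₁ - y * c
    have key : (2 : ℤ) • x = (2 * α') • h + y • v := by
      refine smul_right_injective K3Lat hm ?_
      simp only
      rw [smul_comm, ← hαβ, hα]
      have : (2 * β) • v = (m * y) • v := by rw [show 2 * β = m * y by linarith]
      rw [smul_add, smul_smul 2 β, this]
      module
    obtain ⟨t, ht⟩ | ⟨t, ht⟩ := Int.even_or_odd y
    · refine mem_plane.2 ⟨α', t, smul_right_injective K3Lat (two_ne_zero (α := ℤ)) ?_⟩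
      simp only
      rw [key, ht]
      module
    · refine absurd ?_ (hhalf.2 (x - α' • h - t • v))
      rw [smul_sub, smul_sub, key, ht]
      module
  refine ⟨v, hdiv₂, hhalf, hvh, hvv, mem_NLPlanes_of_plane (c := 2) hn hh.2.1 hp hi hd two_ne_zero
    (by rw [hvh, hvv]; linarith) ?_⟩
  simpa using disc_orth_plane_of_isDivOn hh.2.2 two_ne_zero hdiv₂ hhalf.1

/-! ### The signature of `Λ` -/

theorem eq_zero_of_form_nonneg_of_add_eq_zero {x : Idx → ℝ}
    (h : ∀ i : Fin 3, x (.inl (i, 0)) + x (.inl (i, 1)) = 0) (h0 : 0 ≤ form ℝ x x) : x = 0 := by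
  rw [form_eq] at h0
  have h1 : ∀ i : Fin 3, x (.inl (i, 1)) = -x (.inl (i, 0)) := fun i => by linarith [h i]
  simp_rw [h1] at h0
  have h2 : ∀ i : Fin 3, x (.inl (i, 0)) * -x (.inl (i, 0)) + -x (.inl (i, 0)) * x (.inl (i, 0))
      = -(2 * x (.inl (i, 0)) ^ 2) := fun i => by ring
  simp_rw [h2] at h0
  rw [Fin.sum_univ_three, Fin.sum_univ_two] at h0
  have n0 := sq_nonneg (x (.inl (0, 0)))
  have n1 := sq_nonneg (x (.inl (1, 0)))
  have n2 := sq_nonneg (x (.inl (2, 0)))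
  have e0 := e8_nonneg fun a => x (.inr (.inl (0, a)))
  have e1 := e8_nonneg fun a => x (.inr (.inl (1, a)))
  have nz := mul_self_nonneg (x (.inr (.inr ())))
  have z0 : x (.inl (0, 0)) = 0 := by rw [← sq_eq_zero_iff]; linarith
  have z1 : x (.inl (1, 0)) = 0 := by rw [← sq_eq_zero_iff]; linarith
  have z2 : x (.inl (2, 0)) = 0 := by rw [← sq_eq_zero_iff]; linarith
  have hU : ∀ i : Fin 3, x (.inl (i, 0)) = 0 := by
    intro i
    fin_cases i
    exacts [z0, z1, z2]
  have w0 := e8_eq_zero (x := fun a => x (.inr (.inl (0, a)))) (by linarith)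
  have w1 := e8_eq_zero (x := fun a => x (.inr (.inl (1, a)))) (by linarith)
  have hE : ∀ (j : Fin 2) a, x (.inr (.inl (j, a))) = 0 := by
    intro j a
    fin_cases j
    exacts [congrFun w0 a, congrFun w1 a]
  ext i
  match i with
  | .inl (i, 0) => exact hU i
  | .inl (i, 1) => rw [h1, hU]; simp
  | .inr (.inl (j, a)) => exact hE j a
  | .inr (.inr ()) => exact mul_self_eq_zero.1 (by linarith)

/-- The form has only three positive squares: the orthogonal of three orthogonal vectors of
positive square is negative definite. -/
theorem eq_zero_of_form_nonneg {p₁ p₂ p₃ w : Idx → ℝ} (h₁ : 0 < form ℝ p₁ p₁)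
    (h₂ : 0 < form ℝ p₂ p₂) (h₃ : 0 < form ℝ p₃ p₃) (h₁₂ : form ℝ p₁ p₂ = 0)
    (h₁₃ : form ℝ p₁ p₃ = 0) (h₂₃ : form ℝ p₂ p₃ = 0) (w₁ : form ℝ p₁ w = 0)
    (w₂ : form ℝ p₂ w = 0) (w₃ : form ℝ p₃ w = 0) (hw : 0 ≤ form ℝ w w) : w = 0 := by
  set T : (Fin 4 → ℝ) →ₗ[ℝ] (Idx → ℝ) := Fintype.linearCombination ℝ ![p₁, p₂, p₃, w] with hT
  have hTc : ∀ c, T c = c 0 • p₁ + c 1 • p₂ + c 2 • p₃ + c 3 • w := by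
    intro c
    simp [hT, Fintype.linearCombination_apply, Fin.sum_univ_four]
  let S : (Idx → ℝ) →ₗ[ℝ] (Fin 3 → ℝ) :=
    LinearMap.pi fun i => LinearMap.proj (.inl (i, 0)) + LinearMap.proj (.inl (i, 1))
  have hker : LinearMap.ker (S ∘ₗ T) ≠ ⊥ := LinearMap.ker_ne_bot_of_finrank_lt (by simp)
  obtain ⟨c, hc, hc0⟩ := Submodule.exists_mem_ne_zero_of_ne_bot hker
  have hq : form ℝ (T c) (T c) = c 0 ^ 2 * form ℝ p₁ p₁ + c 1 ^ 2 * form ℝ p₂ p₂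
      + c 2 ^ 2 * form ℝ p₃ p₃ + c 3 ^ 2 * form ℝ w w := by
    rw [hTc]
    simp only [map_add, map_smul, LinearMap.add_apply, LinearMap.smul_apply, smul_eq_mul, h₁₂,
      h₁₃, h₂₃, w₁, w₂, w₃, form_comm ℝ p₂ p₁, form_comm ℝ p₃ p₁, form_comm ℝ p₃ p₂,
      form_comm ℝ w]
    ring
  have hT0 : T c = 0 := by
    refine eq_zero_of_form_nonneg_of_add_eq_zero (fun i => congrFun hc i) ?_
    rw [hq]
    positivity
  rw [hT0, map_zero] at hq
  have a1 := mul_nonneg (sq_nonneg (c 0)) h₁.le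
  have a2 := mul_nonneg (sq_nonneg (c 1)) h₂.le
  have a3 := mul_nonneg (sq_nonneg (c 2)) h₃.le
  have a4 := mul_nonneg (sq_nonneg (c 3)) hw
  have c0 : c 0 = 0 := pow_eq_zero_iff two_ne_zero |>.1
    ((mul_eq_zero.1 (show c 0 ^ 2 * form ℝ p₁ p₁ = 0 by linarith)).resolve_right h₁.ne')
  have c1 : c 1 = 0 := pow_eq_zero_iff two_ne_zero |>.1
    ((mul_eq_zero.1 (show c 1 ^ 2 * form ℝ p₂ p₂ = 0 by linarith)).resolve_right h₂.ne')
  have c2 : c 2 = 0 := pow_eq_zero_iff two_ne_zero |>.1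
    ((mul_eq_zero.1 (show c 2 ^ 2 * form ℝ p₃ p₃ = 0 by linarith)).resolve_right h₃.ne')
  have c3 : c 3 ≠ 0 := by
    intro c3
    refine hc0 (funext fun i => ?_)
    fin_cases i
    exacts [c0, c1, c2, c3]
  rw [hTc, c0, c1, c2] at hT0
  simpa [c3] using hT0

/-! ### Complex points -/

/-- The complex vector with given real coordinates. -/
def cplx (x : Idx → ℝ) : K3LatC := fun i => (x i : ℂ)

/-- The real part of a complex vector. -/
def reP (x : K3LatC) : Idx → ℝ := fun i => (x i).re

/-- The imaginary part of a complex vector. -/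
def imP (x : K3LatC) : Idx → ℝ := fun i => (x i).im

theorem form_cplx (x y : Idx → ℝ) : form ℂ (cplx x) (cplx y) = (form ℝ x y : ℂ) := by
  simp [form_eq, e8, cplx]

theorem cplx_toR (k : K3Lat) : cplx (toR ℝ k) = toR ℂ k := by
  ext i
  simp [cplx, toR]

theorem eq_cplx_add (x : K3LatC) : x = cplx (reP x) + Complex.I • cplx (imP x) := by
  ext i
  simp [cplx, reP, imP, mul_comm Complex.I, Complex.re_add_im]

theorem star_eq_cplx_sub (x : K3LatC) : star x = cplx (reP x) - Complex.I • cplx (imP x) := by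
  ext i
  apply Complex.ext <;> simp [cplx, reP, imP]

theorem form_cplx_right (x : K3LatC) (y : Idx → ℝ) :
    form ℂ x (cplx y) = (form ℝ (reP x) y : ℂ) + Complex.I * (form ℝ (imP x) y : ℂ) := by
  conv_lhs => rw [eq_cplx_add x]
  simp [form_cplx]

theorem form_cplx_right_eq_zero {x : K3LatC} {y : Idx → ℝ} :
    form ℂ x (cplx y) = 0 ↔ form ℝ (reP x) y = 0 ∧ form ℝ (imP x) y = 0 := by
  rw [form_cplx_right, Complex.ext_iff]
  simp

theorem form_self_complex (x : K3LatC) : form ℂ x x =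
    ((form ℝ (reP x) (reP x) - form ℝ (imP x) (imP x) : ℝ) : ℂ)
      + Complex.I * ((2 * form ℝ (reP x) (imP x) : ℝ) : ℂ) := by
  conv_lhs => rw [eq_cplx_add x]
  simp only [map_add, map_smul, LinearMap.add_apply, LinearMap.smul_apply, smul_eq_mul, form_cplx,
    form_comm ℝ (imP x) (reP x)]
  push_cast
  linear_combination (form ℝ (imP x) (imP x) : ℂ) * Complex.I_mul_I

theorem form_star (x : K3LatC) : form ℂ x (star x) =
    ((form ℝ (reP x) (reP x) + form ℝ (imP x) (imP x) : ℝ) : ℂ) := by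
  conv_lhs => rw [star_eq_cplx_sub, eq_cplx_add x]
  have h1 : reP (cplx (reP x) + Complex.I • cplx (imP x)) = reP x := by rw [← eq_cplx_add]
  have h2 : imP (cplx (reP x) + Complex.I • cplx (imP x)) = imP x := by rw [← eq_cplx_add]
  rw [h1, h2]
  simp only [map_add, map_sub, map_smul, LinearMap.add_apply, LinearMap.smul_apply,
    smul_eq_mul, form_cplx, form_comm ℝ (imP x) (reP x)]
  push_cast
  linear_combination (-form ℝ (imP x) (imP x) : ℂ) * Complex.I_mul_I

/-- The conditions that define the cone over `Ω_h`. -/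
def InCone (h : K3Lat) (x : K3LatC) : Prop :=
  form ℂ x (toR ℂ h) = 0 ∧ form ℂ x x = 0 ∧ 0 < (form ℂ x (star x)).re

theorem inCone_iff {h : K3Lat} {x : K3LatC} : InCone h x ↔
    form ℝ (reP x) (toR ℝ h) = 0 ∧ form ℝ (imP x) (toR ℝ h) = 0 ∧ form ℝ (reP x) (imP x) = 0 ∧
      form ℝ (reP x) (reP x) = form ℝ (imP x) (imP x) ∧ 0 < form ℝ (reP x) (reP x) := by
  rw [InCone, ← cplx_toR, form_cplx_right_eq_zero, form_self_complex, form_star, Complex.ext_iff]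
  simp only [Complex.add_re, Complex.ofReal_re, Complex.mul_re, Complex.I_re, zero_mul,
    Complex.I_im, Complex.ofReal_im, mul_zero, sub_zero, add_zero, Complex.zero_re,
    Complex.add_im, Complex.mul_im, one_mul, zero_add, Complex.zero_im]
  constructor
  · rintro ⟨⟨h1, h2⟩, ⟨h3, h4⟩, h5⟩
    exact ⟨h1, h2, by linarith, by linarith, by linarith⟩
  · rintro ⟨h1, h2, h3, h4, h5⟩
    exact ⟨⟨h1, h2⟩, ⟨by linarith, by linarith⟩, by linarith⟩

theorem InCone.ne_zero {h : K3Lat} {x : K3LatC} (hx : InCone h x) : x ≠ 0 := by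
  rintro rfl
  simpa using hx.2.2

theorem InCone.smul {h : K3Lat} {x : K3LatC} (hx : InCone h x) {c : ℂ} (hc : c ≠ 0) :
    InCone h (c • x) := by
  obtain ⟨h1, h2, h3⟩ := hx
  refine ⟨by simp [h1], by simp [h2], ?_⟩
  have : form ℂ (c • x) (star (c • x)) = (Complex.normSq c : ℂ) * form ℂ x (star x) := by
    rw [star_smul]
    simp only [map_smul, LinearMap.smul_apply, smul_eq_mul]
    rw [← mul_assoc, ← Complex.mul_conj, mul_comm (star c)]
    rfl
  rw [this, Complex.re_ofReal_mul]
  exact mul_pos (Complex.normSq_pos.2 hc) h3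

theorem mk_mem_Omega {h : K3Lat} {x : K3LatC} (hx : x ≠ 0) :
    Projectivization.mk ℂ x hx ∈ Omega h ↔ InCone h x := by
  obtain ⟨a, ha⟩ := Projectivization.exists_smul_eq_mk_rep ℂ x hx
  change InCone h (Projectivization.mk ℂ x hx).rep ↔ _
  rw [← ha]
  refine ⟨fun H => ?_, fun H => H.smul a.ne_zero⟩
  have := H.smul (c := ((a⁻¹ : ℂˣ) : ℂ)) (Units.ne_zero _)
  rwa [Units.smul_def, smul_smul, ← Units.val_mul, inv_mul_cancel, Units.val_one,
    one_smul] at this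

/-- The point of `Ω_h` defined by a vector of the cone. -/
noncomputable def pt {h : K3Lat} {x : K3LatC} (hx : InCone h x) : Omega h :=
  ⟨Projectivization.mk ℂ x hx.ne_zero, (mk_mem_Omega hx.ne_zero).2 hx⟩

theorem mem_cone {h : K3Lat} {Z : Set (PeriodSpace h)} {x : K3LatC} :
    x ∈ cone h Z ↔ ∃ hx : InCone h x, proj h (pt hx) ∈ Z := by
  constructor
  · rintro ⟨h0, hp, hZ⟩
    exact ⟨(mk_mem_Omega h0).1 hp, hZ⟩
  · rintro ⟨hx, hZ⟩
    exact ⟨hx.ne_zero, (pt hx).2, hZ⟩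

theorem mem_cone_univ {h : K3Lat} {x : K3LatC} : x ∈ cone h Set.univ ↔ InCone h x := by
  rw [mem_cone]
  exact ⟨fun ⟨hx, _⟩ => hx, fun hx => ⟨hx, trivial⟩⟩

theorem exists_pt_eq {h : K3Lat} (z : PeriodSpace h) :
    ∃ x, ∃ hx : InCone h x, proj h (pt hx) = z := by
  obtain ⟨p, rfl⟩ := Quotient.exists_rep z
  have hp : InCone h p.1.rep := p.2
  refine ⟨p.1.rep, hp, ?_⟩
  have : pt hp = p := Subtype.ext (Projectivization.mk_rep p.1)
  rw [this]
  rfl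

/-- The action of an integral matrix on `Λ ⊗ ℂ`. -/
def actC (g : GL Idx ℤ) (x : K3LatC) : K3LatC := g.1.map (Int.castRingHom ℂ) *ᵥ x

theorem actC_mul (g g' : GL Idx ℤ) (x : K3LatC) : actC (g * g') x = actC g (actC g' x) := by
  simp only [actC]
  rw [Units.val_mul, Matrix.map_mul, Matrix.mulVec_mulVec]

theorem actC_one (x : K3LatC) : actC 1 x = x := by
  simp [actC]

theorem form_actC {h : K3Lat} {g : GL Idx ℤ} (hg : g ∈ Ohat h) (x y : K3LatC) :
    form ℂ (actC g x) (actC g y) = form ℂ x y := by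
  have h1 := congrArg (fun M : Matrix Idx Idx ℤ => M.map (Int.castRingHom ℂ))
    (transpose_mul_gram_mul hg.1)
  simp only [Matrix.map_mul, Matrix.transpose_map] at h1
  rw [form, actC, actC, ← h1]
  nth_rewrite 1 [h1]
  rw [← Matrix.toBilin'_comp]
  simp

theorem actC_toR (g : GL Idx ℤ) (k : K3Lat) : actC g (toR ℂ k) = toR ℂ (g.1 *ᵥ k) := by
  ext i
  simp [actC, Matrix.mulVec, dotProduct, toR]

theorem form_actC_left {h : K3Lat} {g : GL Idx ℤ} (hg : g ∈ Ohat h) (x : K3LatC) (k : K3Lat) :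
    form ℂ (actC g x) (toR ℂ (g.1 *ᵥ k)) = form ℂ x (toR ℂ k) := by
  rw [← actC_toR, form_actC hg]

theorem InCone.actC {h : K3Lat} {g : GL Idx ℤ} (hg : g ∈ Ohat h) {x : K3LatC}
    (hx : InCone h x) : InCone h (actC g x) := by
  obtain ⟨h1, h2, h3⟩ := hx
  refine ⟨?_, by rwa [form_actC hg], ?_⟩
  · rw [← hg.2.1, form_actC_left hg, h1]
  · have : star (HK.actC g x) = HK.actC g (star x) := by
      ext i
      simp [HK.actC, Matrix.mulVec, dotProduct]
    rwa [this, form_actC hg]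

theorem proj_pt_eq {h : K3Lat} {x y : K3LatC} (hx : InCone h x) (hy : InCone h y) :
    proj h (pt hx) = proj h (pt hy) ↔ ∃ g ∈ Ohat h, ∃ c : ℂ, c ≠ 0 ∧ c • x = actC g y := by
  refine (Quotient.eq (r := periodSetoid h)).trans ?_
  constructor
  · rintro ⟨⟨_, g, hg, rfl⟩, hgy⟩
    have h1 : Projectivization.mk ℂ (actC g y) (hy.actC hg).ne_zero =
        Projectivization.mk ℂ x hx.ne_zero := hgy
    obtain ⟨a, ha⟩ := (Projectivization.mk_eq_mk_iff ℂ _ _ _ _).1 h1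
    exact ⟨g, hg, a, a.ne_zero, ha⟩
  · rintro ⟨g, hg, c, hc, hgy⟩
    have h1 : Projectivization.mk ℂ (actC g y) (hy.actC hg).ne_zero =
        Projectivization.mk ℂ x hx.ne_zero :=
      (Projectivization.mk_eq_mk_iff ℂ _ _ _ _).2 ⟨Units.mk0 c hc, hgy⟩
    exact ⟨⟨_, g, hg, rfl⟩, h1⟩

/-- The inverse image in the cone of the image of `P(K^⊥ ⊗ ℂ) ∩ Ω_h`. -/
theorem mem_cone_NLDivisor {h : K3Lat} {K : Submodule ℤ K3Lat} {x : K3LatC} :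
    x ∈ cone h (NLDivisor h K) ↔
      InCone h x ∧ ∃ g ∈ Ohat h, ∀ k ∈ act g K, form ℂ x (toR ℂ k) = 0 := by
  rw [mem_cone]
  constructor
  · rintro ⟨hx, p, hp, hpx⟩
    have hp' : InCone h p.1.rep := p.2
    have hpp : pt hp' = p := Subtype.ext (Projectivization.mk_rep p.1)
    rw [← hpp, eq_comm, proj_pt_eq] at hpx
    obtain ⟨g, hg, c, hc, hgx⟩ := hpx
    refine ⟨hx, g, hg, ?_⟩
    rintro _ ⟨k, hk, rfl⟩
    have := form_actC_left hg p.1.rep k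
    rw [← hgx, map_smul, LinearMap.smul_apply, hp k hk, smul_eq_mul] at this
    exact (mul_eq_zero.1 this).resolve_left hc
  · rintro ⟨hx, g, hg, hk⟩
    have hg' := inv_mem hg
    have hy := hx.actC hg'
    refine ⟨hx, pt hy, fun k hkK => ?_, ?_⟩
    · obtain ⟨a, ha⟩ := Projectivization.exists_smul_eq_mk_rep ℂ _ hy.ne_zero
      change form ℂ (Projectivization.mk ℂ _ hy.ne_zero).rep (toR ℂ k) = 0
      have h1 := form_actC_left hg (actC g⁻¹ x) k
      rw [← actC_mul, mul_inv_cancel, actC_one,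
        show form ℂ x (toR ℂ (g.1 *ᵥ k)) = 0 from hk _ ⟨k, hkK, rfl⟩] at h1
      rw [← ha, Units.smul_def, map_smul, LinearMap.smul_apply, ← h1, smul_zero]
    · rw [proj_pt_eq]
      exact ⟨g⁻¹, hg', 1, one_ne_zero, one_smul _ _⟩

/-! ### Local finiteness of the hyperplanes -/

theorem continuous_form {X : Type*} [TopologicalSpace X] {f g : X → K3LatC} (hf : Continuous f)
    (hg : Continuous g) : Continuous fun t => form ℂ (f t) (g t) := by
  simp only [form, Matrix.toBilin'_apply]
  fun_prop

theorem continuous_form_real {X : Type*} [TopologicalSpace X] {f g : X → Idx → ℝ}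
    (hf : Continuous f) (hg : Continuous g) : Continuous fun t => form ℝ (f t) (g t) := by
  simp only [form, Matrix.toBilin'_apply]
  fun_prop

theorem continuous_cplx : Continuous cplx := by
  unfold cplx
  fun_prop

theorem analyticAt_form {E : Type*} [NormedAddCommGroup E] [NormedSpace ℂ E] {f g : E → K3LatC}
    {z : E} (hf : AnalyticAt ℂ f z) (hg : AnalyticAt ℂ g z) :
    AnalyticAt ℂ (fun t => form ℂ (f t) (g t)) z := by
  have hp : ∀ {f : E → K3LatC}, AnalyticAt ℂ f z → ∀ i, AnalyticAt ℂ (fun t => f t i) z :=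
    fun hf i => (analyticAt_pi_iff.1 hf) i
  simp only [form, Matrix.toBilin'_apply]
  refine Finset.analyticAt_fun_sum _ fun i _ => Finset.analyticAt_fun_sum _ fun j _ => ?_
  exact ((hp hf i).mul analyticAt_const).mul (hp hg j)

/-- The real vectors orthogonal to `h` and to a point of the cone have negative square. -/
theorem InCone.form_neg {h : K3Lat} (hh : 0 < form ℤ h h) {x : K3LatC} (hx : InCone h x)
    {k : Idx → ℝ} (hk : k ≠ 0) (hkh : form ℝ k (toR ℝ h) = 0) (hxk : form ℂ x (cplx k) = 0) :
    form ℝ k k < 0 := by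
  obtain ⟨h1, h2, h3, h4, h5⟩ := inCone_iff.1 hx
  obtain ⟨k1, k2⟩ := form_cplx_right_eq_zero.1 hxk
  by_contra hneg
  refine hk (eq_zero_of_form_nonneg (p₁ := toR ℝ h) (p₂ := reP x) (p₃ := imP x) ?_ h5 (h4 ▸ h5) ?_
    ?_ h3 ?_ k1 k2 (not_lt.1 hneg))
  · rw [form_toR]
    exact_mod_cast hh
  · rw [form_comm, h1]
  · rw [form_comm, h2]
  · rw [form_comm, hkh]

/-- Near a point of the cone over `Ω_h`, the negative definiteness of the orthogonal is uniform. -/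
theorem exists_uniform_neg {h : K3Lat} (hh : 0 < form ℤ h h) {x : K3LatC} (hx : InCone h x) :
    ∃ c : ℝ, 0 < c ∧ ∃ V : Set K3LatC, IsOpen V ∧ x ∈ V ∧ ∀ y ∈ V, ∀ k : Idx → ℝ, ‖k‖ = 1 →
      form ℝ k (toR ℝ h) = 0 → form ℂ y (cplx k) = 0 → form ℝ k k < -c := by
  set F : Set ((K3LatC × ℝ) × (Idx → ℝ)) := {p | form ℝ p.2 (toR ℝ h) = 0 ∧
    form ℂ p.1.1 (cplx p.2) = 0 ∧ -p.1.2 ≤ form ℝ p.2 p.2}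
  have hF : IsClosed F := by
    refine IsClosed.inter ?_ (IsClosed.inter ?_ ?_)
    · exact isClosed_eq (continuous_form_real continuous_snd continuous_const) continuous_const
    · exact isClosed_eq (continuous_form (by fun_prop) (continuous_cplx.comp continuous_snd))
        continuous_const
    · exact isClosed_le (by fun_prop) (continuous_form_real continuous_snd continuous_snd)
  have hev : ∀ᶠ z in 𝓝 (x, (0 : ℝ)), ∀ k ∈ Metric.sphere (0 : Idx → ℝ) 1, (z, k) ∉ F := by
    refine (isCompact_sphere 0 1).eventually_forall_of_forall_eventually fun k hk => ?_
    refine hF.isOpen_compl.mem_nhds fun hkF => ?_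
    have hk0 : k ≠ 0 := by
      rintro rfl
      simp at hk
    have := hx.form_neg hh hk0 hkF.1 hkF.2.1
    have h2 := hkF.2.2
    simp only [neg_zero] at h2
    linarith
  rw [nhds_prod_eq, Filter.eventually_prod_iff] at hev
  obtain ⟨pa, hpa, pb, hpb, hab⟩ := hev
  obtain ⟨c, hc, hc0⟩ := ((hpb.filter_mono nhdsWithin_le_nhds : ∀ᶠ c in 𝓝[>] (0 : ℝ), pb c).and
    self_mem_nhdsWithin).exists
  obtain ⟨V, hV, hVo, hxV⟩ := mem_nhds_iff.1 hpa
  refine ⟨c, hc0, V, hVo, hxV, fun y hy k hk h1 h2 => ?_⟩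
  have := hab (hV hy) hc k (by simpa using hk)
  by_contra hcon
  exact this ⟨h1, h2, not_lt.1 hcon⟩

/-- The hyperplanes orthogonal to the vectors of `h^⊥` of bounded square are locally finite: a
bound on `-κ²` bounds the coordinates of the `κ` orthogonal to a nearby point. -/
theorem exists_finite_nhds {h : K3Lat} (hh : 0 < form ℤ h h) (N : ℤ) {x : K3LatC}
    (hx : InCone h x) : ∃ V : Set K3LatC, IsOpen V ∧ x ∈ V ∧
      {κ : K3Lat | form ℤ κ h = 0 ∧ -N ≤ form ℤ κ κ ∧
        ∃ y ∈ V, form ℂ y (toR ℂ κ) = 0}.Finite := by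
  obtain ⟨c, hc, V, hV, hxV, H⟩ := exists_uniform_neg hh hx
  refine ⟨V, hV, hxV, ?_⟩
  set B : ℤ := ⌈(N : ℝ) / c⌉
  refine (Set.finite_Icc (fun _ : Idx => -B) fun _ => B).subset ?_
  rintro κ ⟨h1, h2, y, hy, h3⟩
  have key : ‖toR ℝ κ‖ ^ 2 ≤ N / c := by
    by_cases h0 : toR ℝ κ = 0
    · have hκ : κ = 0 := by
        ext i
        have := congrFun h0 i
        simpa [toR] using this
      rw [h0, norm_zero]
      rw [hκ] at h2
      simp only [map_zero, Left.neg_nonpos_iff] at h2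
      have : (0 : ℝ) ≤ N := by exact_mod_cast h2
      rw [zero_pow two_ne_zero]
      exact div_nonneg this hc.le
    · have hn : 0 < ‖toR ℝ κ‖ := norm_pos_iff.2 h0
      have := H y hy (‖toR ℝ κ‖⁻¹ • toR ℝ κ) (by
        rw [norm_smul, norm_inv, norm_norm, inv_mul_cancel₀ hn.ne']) (by
        rw [map_smul, LinearMap.smul_apply, form_toR, h1]
        simp) (by
        have : cplx (‖toR ℝ κ‖⁻¹ • toR ℝ κ) = ((‖toR ℝ κ‖⁻¹ : ℝ) : ℂ) • toR ℂ κ := by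
          ext i
          simp [cplx, toR]
        rw [this, map_smul, h3, smul_zero])
      simp only [map_smul, LinearMap.smul_apply, smul_eq_mul, form_toR] at this
      have h2' : -(N : ℝ) ≤ (form ℤ κ κ : ℝ) := by exact_mod_cast h2
      rw [le_div_iff₀ hc]
      have h4 : (form ℤ κ κ : ℝ) < -c * ‖toR ℝ κ‖ ^ 2 := by
        have h5 := mul_lt_mul_of_pos_right this (pow_pos hn 2)
        have h6 : ‖toR ℝ κ‖⁻¹ * (‖toR ℝ κ‖⁻¹ * (form ℤ κ κ : ℝ)) * ‖toR ℝ κ‖ ^ 2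
            = (form ℤ κ κ : ℝ) := by
          field_simp
        rwa [h6] at h5
      nlinarith
  have hb : ∀ i, |κ i| ≤ B := by
    intro i
    have h5 : |(κ i : ℝ)| ≤ ‖toR ℝ κ‖ := norm_le_pi_norm (toR ℝ κ) i
    have h6 : ((κ i : ℝ)) ^ 2 ≤ N / c := by
      rw [← sq_abs]
      exact (pow_le_pow_left₀ (abs_nonneg _) h5 2).trans key
    have h7 : ((κ i ^ 2 : ℤ) : ℝ) ≤ (B : ℝ) := by
      push_cast
      exact h6.trans (Int.le_ceil _)
    have h8 : κ i ^ 2 ≤ B := by exact_mod_cast h7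
    have h9 : |κ i| ≤ κ i ^ 2 := by
      rw [← sq_abs]
      exact Int.le_self_sq _
    exact h9.trans h8
  exact ⟨fun i => (abs_le.1 (hb i)).1, fun i => (abs_le.1 (hb i)).2⟩

theorem form_star_star (x y : K3LatC) : form ℂ (star x) (star y) = star (form ℂ x y) := by
  simp only [form, Matrix.toBilin'_apply, star_sum, star_mul']
  simp

theorem star_cplx (a : Idx → ℝ) : star (cplx a) = cplx a := by
  ext i
  simp [cplx]

theorem form_star_cplx {x : K3LatC} {a : Idx → ℝ} (h : form ℂ x (cplx a) = 0) :
    form ℂ (star x) (cplx a) = 0 := by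
  rw [← star_cplx a, form_star_star, h, star_zero]

/-- A point `x` of the cone can be moved in the direction of a real vector `a` orthogonal to it:
the condition `x · x = 0` is restored by a multiple of the conjugate of `x`. -/
theorem exists_perturb {h : K3Lat} {x : K3LatC} (hx : InCone h x) {W : Set K3LatC}
    (hW : IsOpen W) (hxW : x ∈ W) {a : Idx → ℝ} (ha : form ℝ a (toR ℝ h) = 0)
    (hxa : form ℂ x (cplx a) = 0) : ∃ ε : ℝ, ε ≠ 0 ∧ ∃ c : ℂ,
      x + (ε : ℂ) • cplx a + c • star x ∈ W ∧ InCone h (x + (ε : ℂ) • cplx a + c • star x) := by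
  set r : ℂ := form ℂ x (star x) with hr
  have hr0 : r ≠ 0 := by
    intro h0
    have := hx.2.2
    rw [← hr, h0] at this
    simp at this
  set p : ℝ → K3LatC := fun t => x + (t : ℂ) • cplx a +
    (-((t : ℂ) ^ 2 * form ℂ (cplx a) (cplx a)) / (2 * r)) • star x with hp
  have hpc : Continuous p := by
    simp only [hp]
    fun_prop
  have hp0 : p 0 = x := by simp [hp]
  have hpW : ∀ᶠ t in 𝓝 (0 : ℝ), p t ∈ W :=
    hpc.continuousAt.eventually (by rw [hp0]; exact hW.mem_nhds hxW)
  have hpos : ∀ᶠ t in 𝓝 (0 : ℝ), 0 < (form ℂ (p t) (star (p t))).re := by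
    have hc : Continuous fun t => (form ℂ (p t) (star (p t))).re :=
      Complex.continuous_re.comp (continuous_form hpc (by fun_prop))
    refine hc.continuousAt.eventually (lt_mem_nhds ?_)
    change 0 < (form ℂ (p 0) (star (p 0))).re
    rw [hp0]
    exact hx.2.2
  obtain ⟨ε, ⟨h1, h2⟩, h3⟩ := (((hpW.and hpos).filter_mono
    (nhdsWithin_le_nhds (s := {0}ᶜ))).and self_mem_nhdsWithin).exists
  refine ⟨ε, h3, _, h1, ?_, ?_, h2⟩
  · have e1 : form ℂ (star x) (toR ℂ h) = 0 := by
      rw [← cplx_toR]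
      exact form_star_cplx (by rw [cplx_toR]; exact hx.1)
    have e2 : form ℂ (cplx a) (toR ℂ h) = 0 := by
      rw [← cplx_toR, form_cplx, ha, Complex.ofReal_zero]
    simp only [map_add, map_smul, LinearMap.add_apply, LinearMap.smul_apply, hx.1, e1, e2,
      smul_zero, add_zero]
  · have e1 := form_star_cplx hxa
    have e2 : form ℂ (star x) (star x) = 0 := by rw [form_star_star, hx.2.1, star_zero]
    simp only [map_add, map_smul, LinearMap.add_apply, LinearMap.smul_apply, hx.2.1, e1, e2, hxa,
      form_comm ℂ (cplx a) x, form_comm ℂ (cplx a) (star x), form_comm ℂ (star x) x, ← hr,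
      smul_eq_mul]
    field_simp
    ring

/-- Finitely many hyperplanes do not cover a neighbourhood of a point of `κ₁^⊥` in the cone if none
of them contains `κ₁^⊥`. -/
theorem exists_avoid {h κ₁ : K3Lat} (hh : 0 < form ℤ h h) (hκ₁ : form ℤ κ₁ h = 0)
    (T : Finset K3Lat) (hT : ∀ κ ∈ T, form ℤ κ h = 0 ∧ ∃ α β : ℤ, α • κ + β • κ₁ ≠ 0 ∧
      form ℤ (α • κ + β • κ₁) κ₁ = 0) {W : Set K3LatC} (hW : IsOpen W) {x : K3LatC} (hxW : x ∈ W)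
    (hx : InCone h x) (hxκ : form ℂ x (toR ℂ κ₁) = 0) :
    ∃ y ∈ W, InCone h y ∧ form ℂ y (toR ℂ κ₁) = 0 ∧ ∀ κ ∈ T, form ℂ y (toR ℂ κ) ≠ 0 := by
  classical
  induction T using Finset.induction_on with
  | empty => exact ⟨x, hxW, hx, hxκ, by simp⟩
  | insert κ T hκT IH =>
    obtain ⟨y, hyW, hy, hyκ₁, hyT⟩ := IH fun κ' hκ' => hT κ' (Finset.mem_insert_of_mem hκ')
    by_cases hyκ : form ℂ y (toR ℂ κ) = 0
    swap
    · refine ⟨y, hyW, hy, hyκ₁, fun κ' hκ' => ?_⟩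
      rcases Finset.mem_insert.1 hκ' with rfl | hκ'
      exacts [hyκ, hyT _ hκ']
    obtain ⟨hκh, α, β, ha0, haκ₁⟩ := hT κ (Finset.mem_insert_self κ T)
    set a := α • κ + β • κ₁ with ha
    have hah : form ℤ a h = 0 := by
      simp [ha, -zsmul_eq_mul, hκh, hκ₁]
    have haC : toR ℂ a = (α : ℂ) • toR ℂ κ + (β : ℂ) • toR ℂ κ₁ := by
      ext i
      simp [ha, toR]
    have hya : form ℂ y (toR ℂ a) = 0 := by
      rw [haC, map_add, map_smul, map_smul, hyκ, hyκ₁]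
      simp
    have hneg : form ℤ a a < 0 := by
      have := hy.form_neg hh (k := toR ℝ a) (fun h0 => ha0 (by
        ext i
        simpa [toR] using congrFun h0 i)) (by rw [form_toR, hah, Int.cast_zero])
        (by rw [cplx_toR]; exact hya)
      rw [form_toR] at this
      exact_mod_cast this
    have haκ : form ℤ a κ ≠ 0 := by
      intro h0
      have : form ℤ a a = 0 := by
        nth_rewrite 2 [ha]
        rw [map_add, map_smul, map_smul, h0, haκ₁]
        simp
      omega
    have hW' : IsOpen (W ∩ ⋂ κ' ∈ T, {z | form ℂ z (toR ℂ κ') ≠ 0}) :=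
      hW.inter (isOpen_biInter_finset fun κ' _ =>
        isOpen_ne_fun (continuous_form continuous_id continuous_const) continuous_const)
    obtain ⟨ε, hε, c, hzW, hz⟩ := exists_perturb hy hW' ⟨hyW, Set.mem_iInter₂.2 hyT⟩
      (a := toR ℝ a) (by rw [form_toR, hah, Int.cast_zero]) (by rw [cplx_toR]; exact hya)
    have hform : ∀ k : K3Lat, form ℂ y (toR ℂ k) = 0 →
        form ℂ (y + (ε : ℂ) • cplx (toR ℝ a) + c • star y) (toR ℂ k) = ε * form ℤ a k := by
      intro k hk
      have hk' : form ℂ (star y) (toR ℂ k) = 0 := by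
        rw [← cplx_toR]
        exact form_star_cplx (by rw [cplx_toR]; exact hk)
      simp only [map_add, map_smul, LinearMap.add_apply, LinearMap.smul_apply, hk, hk', cplx_toR,
        form_toR, smul_eq_mul]
      ring
    refine ⟨_, hzW.1, hz, by rw [hform κ₁ hyκ₁, haκ₁]; simp, fun κ' hκ' => ?_⟩
    rcases Finset.mem_insert.1 hκ' with rfl | hκ'
    · rw [hform _ hyκ]
      exact mul_ne_zero (by exact_mod_cast hε) (by exact_mod_cast haκ)
    · exact Set.mem_iInter₂.1 hzW.2 κ' hκ'

/-- A union of hyperplane sections of `Ω_h` by vectors of bounded square is a hypersurface. -/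
theorem isHypersurface_of_cone {h : K3Lat} (hh : 0 < form ℤ h h) {Z : Set (PeriodSpace h)}
    (hne : Z.Nonempty) {S : Set K3Lat} (N : ℤ)
    (hS : ∀ κ ∈ S, κ ≠ 0 ∧ form ℤ κ h = 0 ∧ -N ≤ form ℤ κ κ)
    (hZ : ∀ x, x ∈ cone h Z ↔ InCone h x ∧ ∃ κ ∈ S, form ℂ x (toR ℂ κ) = 0) :
    IsHypersurface h Z ∧ IsAnalyticSubset h Z := by
  have key : ∀ x ∈ cone h Set.univ, ∃ V : Set K3LatC, IsOpen V ∧ x ∈ V ∧ ∃ T : Finset K3Lat,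
      (∀ κ ∈ T, κ ∈ S) ∧ ∀ y ∈ V ∩ cone h Set.univ,
        y ∈ cone h Z ↔ ∏ κ ∈ T, form ℂ y (toR ℂ κ) = 0 := by
    intro x hx
    obtain ⟨V, hV, hxV, hfin⟩ := exists_finite_nhds hh N (mem_cone_univ.1 hx)
    have hfin' := hfin.inter_of_right S
    refine ⟨V, hV, hxV, hfin'.toFinset, fun κ hκ => ((Set.Finite.mem_toFinset _).1 hκ).1,
      fun y hy => ?_⟩
    rw [hZ, Finset.prod_eq_zero_iff]
    constructor
    · rintro ⟨-, κ, hκ, hyκ⟩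
      exact ⟨κ, (Set.Finite.mem_toFinset _).2
        ⟨hκ, (hS κ hκ).2.1, (hS κ hκ).2.2, y, hy.1, hyκ⟩, hyκ⟩
    · rintro ⟨κ, hκ, hyκ⟩
      exact ⟨mem_cone_univ.1 hy.2, κ, ((Set.Finite.mem_toFinset _).1 hκ).1, hyκ⟩
  have han : ∀ (T : Finset K3Lat) (V : Set K3LatC),
      AnalyticOnNhd ℂ (fun y => ∏ κ ∈ T, form ℂ y (toR ℂ κ)) V := fun T V y _ =>
    Finset.analyticAt_fun_prod _ fun κ _ => analyticAt_form analyticAt_id analyticAt_const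
  refine ⟨⟨hne, fun x hx => ?_⟩, fun x hx => ?_⟩
  · obtain ⟨V, hV, hxV, T, hT, hTV⟩ := key x hx
    refine ⟨V, hV, hxV, _, han T V, hTV, ?_⟩
    rintro W - hW ⟨y, hyW, hy⟩
    obtain ⟨z, hzW, hz, -, hzT⟩ := exists_avoid (κ₁ := 0) hh (by simp) T (fun κ hκ =>
      ⟨(hS κ (hT κ hκ)).2.1, 1, 0, by simpa using (hS κ (hT κ hκ)).1, by simp⟩) hW hyW
      (mem_cone_univ.1 hy) (by rw [show toR ℂ 0 = 0 by ext; simp [toR]]; simp)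
    exact ⟨z, ⟨hzW, mem_cone_univ.2 hz⟩, Finset.prod_ne_zero_iff.2 hzT⟩
  · obtain ⟨V, hV, hxV, T, hT, hTV⟩ := key x hx
    exact ⟨V, hV, hxV, 1, fun _ => _, fun _ => han T V, fun y hy => by simp [hTV y hy]⟩

/-! ### The Noether–Lefschetz divisors as hypersurfaces -/

/-- The orthogonal projection of `v` to `h^⊥`, multiplied by `h²`. -/
def nrm (h v : K3Lat) : K3Lat := form ℤ h h • v - form ℤ h v • h

theorem form_nrm_left (h v l : K3Lat) :
    form ℤ (nrm h v) l = form ℤ h h * form ℤ v l - form ℤ h v * form ℤ h l := by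
  simp only [nrm, map_sub, map_smul, LinearMap.sub_apply, LinearMap.smul_apply, smul_eq_mul]

theorem form_nrm_right (h v : K3Lat) : form ℤ (nrm h v) h = 0 := by
  rw [form_nrm_left, form_comm ℤ v h]
  ring

theorem form_nrm_self (h v : K3Lat) :
    form ℤ (nrm h v) (nrm h v) = form ℤ h h * (form ℤ h h * form ℤ v v - form ℤ h v ^ 2) := by
  rw [form_nrm_left, form_comm ℤ v, form_comm ℤ h (nrm h v), form_nrm_right, form_nrm_left]
  ring

theorem toR_nrm (h v : K3Lat) :
    toR ℂ (nrm h v) = (form ℤ h h : ℂ) • toR ℂ v - (form ℤ h v : ℂ) • toR ℂ h := by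
  ext i
  simp [nrm, toR]

theorem form_nrm_eq_zero_iff {h v : K3Lat} (hh : 0 < form ℤ h h) {x : K3LatC}
    (hx : form ℂ x (toR ℂ h) = 0) :
    form ℂ x (toR ℂ (nrm h v)) = 0 ↔ ∀ k ∈ plane h v, form ℂ x (toR ℂ k) = 0 := by
  have hh' : (form ℤ h h : ℂ) ≠ 0 := by exact_mod_cast hh.ne'
  rw [toR_nrm, map_sub, map_smul, map_smul, hx, smul_zero, sub_zero, smul_eq_mul, mul_eq_zero,
    or_iff_right hh']
  constructor
  · rintro hv k hk
    obtain ⟨a, b, rfl⟩ := mem_plane.1 hk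
    have : toR ℂ (a • h + b • v) = (a : ℂ) • toR ℂ h + (b : ℂ) • toR ℂ v := by
      ext i
      simp [toR]
    rw [this, map_add, map_smul, map_smul, hx, hv]
    simp
  · exact fun H => H v (right_mem_plane h v)

theorem mem_cone_NLDivisor_plane {h v : K3Lat} (hh : 0 < form ℤ h h) {x : K3LatC} :
    x ∈ cone h (NLDivisor h (plane h v)) ↔
      InCone h x ∧ ∃ w ∈ orb h v, form ℂ x (toR ℂ (nrm h w)) = 0 := by
  rw [mem_cone_NLDivisor]
  refine and_congr_right fun hx => ?_
  constructor
  · rintro ⟨g, hg, H⟩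
    refine ⟨g.1 *ᵥ v, ⟨g, hg, rfl⟩, (form_nrm_eq_zero_iff hh hx.1).2 ?_⟩
    rwa [act_plane, hg.2.1] at H
  · rintro ⟨_, ⟨g, hg, rfl⟩, H⟩
    refine ⟨g, hg, ?_⟩
    rw [act_plane, hg.2.1]
    exact (form_nrm_eq_zero_iff hh hx.1).1 H

theorem eq_of_cone_eq {h : K3Lat} {Z Z' : Set (PeriodSpace h)}
    (H : ∀ x, x ∈ cone h Z ↔ x ∈ cone h Z') : Z = Z' := by
  ext z
  obtain ⟨x, hx, rfl⟩ := exists_pt_eq z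
  have := H x
  rw [mem_cone, mem_cone] at this
  simpa [hx] using this

theorem NLDivisor_act {h : K3Lat} {g : GL Idx ℤ} (hg : g ∈ Ohat h) (K : Submodule ℤ K3Lat) :
    NLDivisor h (act g K) = NLDivisor h K := by
  have hact : ∀ g₁ g₂ : GL Idx ℤ, act g₁ (act g₂ K) = act (g₁ * g₂) K := by
    intro g₁ g₂
    rw [act, act, act, ← Submodule.map_comp, ← Matrix.mulVecLin_mul, Units.val_mul]
  refine eq_of_cone_eq fun x => ?_
  rw [mem_cone_NLDivisor, mem_cone_NLDivisor]
  refine and_congr_right fun _ => ⟨?_, ?_⟩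
  · rintro ⟨g', hg', H⟩
    exact ⟨g' * g, mul_mem hg' hg, by rwa [hact] at H⟩
  · rintro ⟨g', hg', H⟩
    exact ⟨g' * g⁻¹, mul_mem hg' (inv_mem hg), by rwa [hact, inv_mul_cancel_right]⟩

theorem NLDivisor_plane_of_mem_orb {h v w : K3Lat} (hw : w ∈ orb h v) :
    NLDivisor h (plane h w) = NLDivisor h (plane h v) := by
  obtain ⟨g, hg, rfl⟩ := hw
  rw [← NLDivisor_act hg (plane h v), act_plane, hg.2.1]

theorem NLLocus_eq (h : K3Lat) (d : ℕ) : NLLocus h d = ⋃ K ∈ NLPlanes h d, NLDivisor h K := rfl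

theorem mem_cone_NLLocus {h : K3Lat} {d : ℕ} {x : K3LatC} :
    x ∈ cone h (NLLocus h d) ↔ ∃ K ∈ NLPlanes h d, x ∈ cone h (NLDivisor h K) := by
  simp only [mem_cone, NLLocus_eq, Set.mem_iUnion, exists_prop]
  grind

/-- The normal vectors of an orbit of hyperbolic planes satisfy the hypotheses of
`isHypersurface_of_cone`. -/
theorem nrm_bound {h v w : K3Lat} {N : ℤ} (hh : 0 < form ℤ h h)
    (hv : form ℤ h h * form ℤ v v < form ℤ h v ^ 2)
    (hN : form ℤ h v ^ 2 - form ℤ h h * form ℤ v v ≤ N) (hw : w ∈ orb h v) :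
    nrm h w ≠ 0 ∧ form ℤ (nrm h w) h = 0 ∧
      -(form ℤ h h * N) ≤ form ℤ (nrm h w) (nrm h w) := by
  obtain ⟨h1, h2⟩ := form_of_mem_orb hw
  have e := form_nrm_self h w
  rw [h1, form_comm ℤ h w, h2, form_comm ℤ v h] at e
  refine ⟨fun h0 => ?_, form_nrm_right h w, ?_⟩
  · rw [h0] at e
    simp only [map_zero] at e
    nlinarith
  · rw [e]
    nlinarith

theorem isAnalyticSubset_NLDivisor {h v : K3Lat} (hh : 0 < form ℤ h h)
    (hv : form ℤ h h * form ℤ v v < form ℤ h v ^ 2)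
    (hne : (NLDivisor h (plane h v)).Nonempty) : IsAnalyticSubset h (NLDivisor h (plane h v)) := by
  refine (isHypersurface_of_cone hh hne (S := {κ | ∃ w ∈ orb h v, κ = nrm h w})
    (form ℤ h h * (form ℤ h v ^ 2 - form ℤ h h * form ℤ v v)) ?_ fun x => ?_).2
  · rintro _ ⟨w, hw, rfl⟩
    exact nrm_bound hh hv le_rfl hw
  · rw [mem_cone_NLDivisor_plane hh]
    exact and_congr_right fun _ => ⟨fun ⟨w, hw, H⟩ => ⟨_, ⟨w, hw, rfl⟩, H⟩,
      fun ⟨_, ⟨w, hw, e⟩, H⟩ => ⟨w, hw, e ▸ H⟩⟩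

theorem isHypersurface_NLLocus {h : K3Lat} {d : ℕ} (hh : 0 < form ℤ h h) (N : ℤ)
    (hd : ∀ K ∈ NLPlanes h d, ∃ v, K = plane h v ∧ form ℤ h h * form ℤ v v < form ℤ h v ^ 2 ∧
      form ℤ h v ^ 2 - form ℤ h h * form ℤ v v ≤ N)
    (hne : (NLLocus h d).Nonempty) : IsHypersurface h (NLLocus h d) := by
  refine (isHypersurface_of_cone hh hne (S := {κ | ∃ v w, plane h v ∈ NLPlanes h d ∧
    form ℤ h h * form ℤ v v < form ℤ h v ^ 2 ∧ form ℤ h v ^ 2 - form ℤ h h * form ℤ v v ≤ N ∧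
    w ∈ orb h v ∧ κ = nrm h w}) (form ℤ h h * N) ?_ fun x => ?_).1
  · rintro _ ⟨v, w, -, hv, hN, hw, rfl⟩
    exact nrm_bound hh hv hN hw
  · rw [mem_cone_NLLocus]
    constructor
    · rintro ⟨K, hK, hx⟩
      obtain ⟨v, rfl, h1, h2⟩ := hd K hK
      obtain ⟨hx, w, hw, H⟩ := (mem_cone_NLDivisor_plane hh).1 hx
      exact ⟨hx, _, ⟨v, w, hK, h1, h2, hw, rfl⟩, H⟩
    · rintro ⟨hx, _, ⟨v, w, hK, -, -, hw, rfl⟩, H⟩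
      exact ⟨_, hK, (mem_cone_NLDivisor_plane hh).2 ⟨hx, w, hw, H⟩⟩

/-! ### Tube domains -/

/-- The data of a tube domain: a vector `κ`, a hyperbolic plane `⟨e, f⟩` orthogonal to both,
and a vector `p` of positive square orthogonal to all of these. -/
structure IsTubeData (h κ e f p : K3Lat) : Prop where
  hh : 0 < form ℤ h h
  pp : 0 < form ℤ p p
  ee : form ℤ e e = 0
  ff : form ℤ f f = 0
  ef : form ℤ e f = 1
  eh : form ℤ e h = 0
  fh : form ℤ f h = 0
  ek : form ℤ e κ = 0
  fk : form ℤ f κ = 0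
  ep : form ℤ e p = 0
  fp : form ℤ f p = 0
  ph : form ℤ p h = 0
  pk : form ℤ p κ = 0

/-- The complex orthogonal of `h`, `κ`, `e` and `f`. -/
noncomputable def tubeSpace (h κ e f : K3Lat) : Submodule ℂ K3LatC :=
  LinearMap.ker ((form ℂ).flip (toR ℂ h)) ⊓ LinearMap.ker ((form ℂ).flip (toR ℂ κ)) ⊓
    LinearMap.ker ((form ℂ).flip (toR ℂ e)) ⊓ LinearMap.ker ((form ℂ).flip (toR ℂ f))

theorem mem_tubeSpace {h κ e f : K3Lat} {z : K3LatC} : z ∈ tubeSpace h κ e f ↔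
    form ℂ z (toR ℂ h) = 0 ∧ form ℂ z (toR ℂ κ) = 0 ∧ form ℂ z (toR ℂ e) = 0 ∧
      form ℂ z (toR ℂ f) = 0 := by
  simp [tubeSpace, Submodule.mem_inf, and_assoc]

/-- The points of the complex orthogonal of `h`, `κ`, `e` and `f` whose imaginary part lies in one
of the two halves of the cone of vectors of positive square. -/
def tube (h κ e f p : K3Lat) : Set (tubeSpace h κ e f) :=
  {z | 0 < form ℝ (imP z.1) (imP z.1) ∧ 0 < form ℝ (imP z.1) (toR ℝ p)}

/-- The parametrization of a hyperplane section of `Ω_h` by a tube domain. -/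
noncomputable def tubeMap (h κ e f : K3Lat) (z : tubeSpace h κ e f) : K3LatC :=
  z.1 + toR ℂ e - (form ℂ z.1 z.1 / 2) • toR ℂ f

theorem imP_add (x y : K3LatC) : imP (x + y) = imP x + imP y := by
  ext i
  simp [imP]

theorem imP_real_smul (c : ℝ) (x : K3LatC) : imP (c • x) = c • imP x := by
  ext i
  simp [imP]

theorem imP_neg (x : K3LatC) : imP (-x) = -imP x := by
  ext i
  simp [imP]

theorem continuous_imP : Continuous imP := by
  unfold imP
  fun_prop

theorem isOpen_tube (h κ e f p : K3Lat) : IsOpen (tube h κ e f p) := by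
  have hc : Continuous fun z : tubeSpace h κ e f => imP z.1 :=
    continuous_imP.comp continuous_subtype_val
  exact (isOpen_lt continuous_const (continuous_form_real hc hc)).inter
    (isOpen_lt continuous_const (continuous_form_real hc continuous_const))

theorem analyticAt_tubeMap {h κ e f : K3Lat} (z : tubeSpace h κ e f) :
    AnalyticAt ℂ (tubeMap h κ e f) z := by
  have hs : AnalyticAt ℂ (fun z : tubeSpace h κ e f => z.1) z :=
    (tubeSpace h κ e f).subtypeL.analyticAt z
  unfold tubeMap
  exact (hs.add analyticAt_const).sub (((analyticAt_form hs hs).div_const).smul analyticAt_const)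

theorem imP_form_eq_zero {z : K3LatC} {k : K3Lat} (hz : form ℂ z (toR ℂ k) = 0) :
    form ℝ (imP z) (toR ℝ k) = 0 := by
  rw [← cplx_toR] at hz
  exact (form_cplx_right_eq_zero.1 hz).2

theorem toR_inj_zero {k : K3Lat} (hk : toR ℝ k = 0) : k = 0 := by
  ext i
  simpa [toR] using congrFun hk i

namespace IsTubeData

variable {h κ e f p : K3Lat}

/-- The form has signature `(1, *)` on the real orthogonal of `h`, `e` and `f`. -/
theorem eq_zero (D : IsTubeData h κ e f p) {y : Idx → ℝ} (yh : form ℝ y (toR ℝ h) = 0)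
    (ye : form ℝ y (toR ℝ e) = 0) (yf : form ℝ y (toR ℝ f) = 0) (yp : form ℝ y (toR ℝ p) = 0)
    (hy : 0 ≤ form ℝ y y) : y = 0 := by
  have hadd : toR ℝ (e + f) = toR ℝ e + toR ℝ f := by
    ext i
    simp [toR]
  have c1 := D.eh
  have c2 := D.fh
  have c3 := D.ep
  have c4 := D.fp
  have c5 := D.ph
  have c6 := D.ef
  refine eq_zero_of_form_nonneg (p₁ := toR ℝ h) (p₂ := toR ℝ (e + f)) (p₃ := toR ℝ p) ?_ ?_ ?_ ?_
    ?_ ?_ ?_ ?_ ?_ hy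
  · rw [form_toR]
    exact_mod_cast D.hh
  · rw [form_toR]
    have : form ℤ (e + f) (e + f) = 2 := by
      simp only [map_add, LinearMap.add_apply, D.ee, D.ff, D.ef, form_comm ℤ f e]
      norm_num
    rw [this]
    norm_num
  · rw [form_toR]
    exact_mod_cast D.pp
  · rw [form_toR, form_comm, map_add, LinearMap.add_apply, c1, c2]
    norm_num
  · rw [form_toR, form_comm, c5, Int.cast_zero]
  · rw [form_toR, map_add, LinearMap.add_apply, c3, c4]
    norm_num
  · rw [form_comm, yh]
  · rw [form_comm, hadd, map_add, ye, yf, add_zero]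
  · rw [form_comm, yp]

/-- Two vectors of the same half of the positive cone have positive product. -/
theorem form_pos (D : IsTubeData h κ e f p) {z₁ z₂ : tubeSpace h κ e f}
    (h₁ : z₁ ∈ tube h κ e f p) (h₂ : z₂ ∈ tube h κ e f p) :
    0 < form ℝ (imP z₁.1) (imP z₂.1) := by
  obtain ⟨a1, a2, a3, a4⟩ := mem_tubeSpace.1 z₁.2
  obtain ⟨b1, b2, b3, b4⟩ := mem_tubeSpace.1 z₂.2
  set y₁ := imP z₁.1
  set y₂ := imP z₂.1
  set s := form ℝ y₁ (toR ℝ p) with hs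
  set t := form ℝ y₂ (toR ℝ p) with ht
  have hs0 : 0 < s := h₁.2
  have ht0 : 0 < t := h₂.2
  have hq : form ℝ (t • y₁ - s • y₂) (t • y₁ - s • y₂) =
      t ^ 2 * form ℝ y₁ y₁ - 2 * (s * t) * form ℝ y₁ y₂ + s ^ 2 * form ℝ y₂ y₂ := by
    simp only [map_sub, map_smul, LinearMap.sub_apply, LinearMap.smul_apply, smul_eq_mul,
      form_comm ℝ y₂ y₁]
    ring
  have key : form ℝ (t • y₁ - s • y₂) (t • y₁ - s • y₂) ≤ 0 := by
    by_contra hpos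
    have := D.eq_zero (y := t • y₁ - s • y₂) ?_ ?_ ?_ ?_ (not_le.1 hpos).le
    · rw [this] at hpos
      simp at hpos
    all_goals
      simp only [map_sub, map_smul, LinearMap.sub_apply, LinearMap.smul_apply, smul_eq_mul]
    · rw [imP_form_eq_zero a1, imP_form_eq_zero b1]
      ring
    · rw [imP_form_eq_zero a3, imP_form_eq_zero b3]
      ring
    · rw [imP_form_eq_zero a4, imP_form_eq_zero b4]
      ring
    · rw [← hs, ← ht]
      ring
  rw [hq] at key
  have e1 : 0 < t ^ 2 * form ℝ y₁ y₁ := mul_pos (pow_pos ht0 2) h₁.1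
  have e2 : 0 < s ^ 2 * form ℝ y₂ y₂ := mul_pos (pow_pos hs0 2) h₂.1
  have e3 : 0 < s * t * form ℝ y₁ y₂ := by linarith
  exact (mul_pos_iff_of_pos_left (mul_pos hs0 ht0)).1 e3

theorem convex_tube (D : IsTubeData h κ e f p) : Convex ℝ (tube h κ e f p) := by
  intro z₁ h₁ z₂ h₂ a b ha hb hab
  have h12 := D.form_pos h₁ h₂
  have him : imP (a • z₁ + b • z₂ : tubeSpace h κ e f).1 = a • imP z₁.1 + b • imP z₂.1 := by
    rw [← imP_real_smul, ← imP_real_smul, ← imP_add]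
    rfl
  rcases ha.eq_or_lt with rfl | ha
  · rw [zero_add] at hab
    rwa [hab, zero_smul, one_smul, zero_add]
  refine ⟨?_, ?_⟩
  · rw [him]
    simp only [map_add, map_smul, LinearMap.add_apply, LinearMap.smul_apply, smul_eq_mul,
      form_comm ℝ (imP z₂.1) (imP z₁.1)]
    have e1 := mul_pos (mul_pos ha ha) h₁.1
    have e2 := mul_nonneg (mul_nonneg hb hb) h₂.1.le
    have e3 := mul_nonneg (mul_nonneg ha.le hb) h12.le
    nlinarith
  · rw [him]
    simp only [map_add, map_smul, LinearMap.add_apply, LinearMap.smul_apply, smul_eq_mul]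
    exact add_pos_of_pos_of_nonneg (mul_pos ha h₁.2) (mul_nonneg hb h₂.2.le)

theorem tube_nonempty (D : IsTubeData h κ e f p) : (tube h κ e f p).Nonempty := by
  have hz : Complex.I • toR ℂ p ∈ tubeSpace h κ e f := by
    simp only [mem_tubeSpace, map_smul, LinearMap.smul_apply, form_toR, D.ph, D.pk,
      form_comm ℤ p e, form_comm ℤ p f, D.ep, D.fp, Int.cast_zero, smul_zero, and_self]
  have him : imP (Complex.I • toR ℂ p) = toR ℝ p := by
    ext i
    simp [imP, toR]
  refine ⟨⟨_, hz⟩, ?_, ?_⟩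
  all_goals
    simp only [him, form_toR]
    exact_mod_cast D.pp

theorem form_tubeMap_self (D : IsTubeData h κ e f p) (z : tubeSpace h κ e f) :
    form ℂ (tubeMap h κ e f z) (tubeMap h κ e f z) = 0 := by
  obtain ⟨-, -, z3, z4⟩ := mem_tubeSpace.1 z.2
  simp only [tubeMap, map_add, map_sub, map_smul, LinearMap.add_apply, LinearMap.sub_apply,
    LinearMap.smul_apply, smul_eq_mul, z3, z4, form_comm ℂ _ z.1, form_toR, D.ee, D.ff, D.ef,
    form_comm ℤ f e]
  push_cast
  ring

theorem form_tubeMap_star (D : IsTubeData h κ e f p) (z : tubeSpace h κ e f) :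
    (form ℂ (tubeMap h κ e f z) (star (tubeMap h κ e f z))).re =
      2 * form ℝ (imP z.1) (imP z.1) := by
  obtain ⟨-, -, z3, z4⟩ := mem_tubeSpace.1 z.2
  have hst : star (tubeMap h κ e f z) =
      star z.1 + toR ℂ e - (star (form ℂ z.1 z.1) / 2) • toR ℂ f := by
    have hR : ∀ k : K3Lat, star (toR ℂ k) = toR ℂ k := fun k => by
      rw [← cplx_toR, star_cplx]
    rw [tubeMap, star_sub, star_add, star_smul, hR, hR]
    congr 2
    simp
  have w3 : form ℂ (star z.1) (toR ℂ e) = 0 := by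
    rw [← cplx_toR] at z3 ⊢
    exact form_star_cplx z3
  have w4 : form ℂ (star z.1) (toR ℂ f) = 0 := by
    rw [← cplx_toR] at z4 ⊢
    exact form_star_cplx z4
  have key : form ℂ (tubeMap h κ e f z) (star (tubeMap h κ e f z)) =
      form ℂ z.1 (star z.1) - (form ℂ z.1 z.1 + star (form ℂ z.1 z.1)) / 2 := by
    rw [hst]
    simp only [tubeMap, map_add, map_sub, map_smul, LinearMap.add_apply, LinearMap.sub_apply,
      LinearMap.smul_apply, smul_eq_mul, z3, z4, form_comm ℂ _ (star z.1), w3, w4, form_toR,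
      D.ee, D.ff, D.ef, form_comm ℤ f e]
    push_cast
    ring
  rw [key, form_star, form_self_complex]
  simp
  ring

theorem inCone_tubeMap (D : IsTubeData h κ e f p) {z : tubeSpace h κ e f}
    (hz : 0 < form ℝ (imP z.1) (imP z.1)) : InCone h (tubeMap h κ e f z) := by
  obtain ⟨z1, -, -, -⟩ := mem_tubeSpace.1 z.2
  refine ⟨?_, D.form_tubeMap_self z, ?_⟩
  · simp only [tubeMap, map_add, map_sub, map_smul, LinearMap.add_apply, LinearMap.sub_apply,
      LinearMap.smul_apply, smul_eq_mul, z1, form_toR, D.eh, D.fh]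
    push_cast
    ring
  · rw [D.form_tubeMap_star]
    linarith

theorem form_tubeMap (D : IsTubeData h κ e f p) (z : tubeSpace h κ e f) :
    form ℂ (tubeMap h κ e f z) (toR ℂ κ) = 0 := by
  obtain ⟨-, z2, -, -⟩ := mem_tubeSpace.1 z.2
  simp only [tubeMap, map_add, map_sub, map_smul, LinearMap.add_apply, LinearMap.sub_apply,
    LinearMap.smul_apply, smul_eq_mul, z2, form_toR, D.ek, D.fk]
  push_cast
  ring

/-- The tube domain covers the image of the hyperplane section: the reflection in the plane
`⟨e, f⟩` exchanges the two halves of the cone of vectors of positive square. -/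
theorem exists_tube (D : IsTubeData h κ e f p) {x : K3LatC} (hx : InCone h x)
    (hxκ : form ℂ x (toR ℂ κ) = 0) : ∃ z ∈ tube h κ e f p,
      ∃ hz : InCone h (tubeMap h κ e f z), proj h (pt hx) = proj h (pt hz) := by
  have hlam : form ℂ x (toR ℂ f) ≠ 0 := by
    intro h0
    have hf0 : toR ℝ f ≠ 0 := by
      intro hf0
      have := D.ef
      rw [toR_inj_zero hf0, map_zero] at this
      exact zero_ne_one this
    have := hx.form_neg D.hh hf0 (by rw [form_toR, D.fh, Int.cast_zero]) (by rwa [cplx_toR])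
    rw [form_toR, D.ff] at this
    simp at this
  set lam := form ℂ x (toR ℂ f) with hlam'
  obtain ⟨c, hc⟩ : ∃ c, c = form ℂ x (toR ℂ e) / lam := ⟨_, rfl⟩
  set z₀ : K3LatC := lam⁻¹ • x - toR ℂ e - c • toR ℂ f with hz₀
  have hz₀m : z₀ ∈ tubeSpace h κ e f := by
    rw [mem_tubeSpace]
    simp only [hz₀, map_sub, map_smul, LinearMap.sub_apply, LinearMap.smul_apply, smul_eq_mul,
      hx.1, hxκ, form_toR, D.eh, D.fh, D.ek, D.fk, D.ee, D.ff, D.ef, form_comm ℤ f e, ← hlam', hc]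
    refine ⟨by simp, by simp, ?_, ?_⟩
    · push_cast
      field_simp
      ring
    · push_cast
      field_simp
      ring
  set z : tubeSpace h κ e f := ⟨z₀, hz₀m⟩ with hz
  have hxz : x = lam • tubeMap h κ e f z := by
    have h1 : form ℂ z₀ z₀ = -2 * c := by
      obtain ⟨-, -, z3, z4⟩ := mem_tubeSpace.1 hz₀m
      have h2 : lam⁻¹ • x = z₀ + toR ℂ e + c • toR ℂ f := by
        rw [hz₀]
        abel
      have h3 : form ℂ (lam⁻¹ • x) (lam⁻¹ • x) = 0 := by simp [hx.2.1]
      rw [h2] at h3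
      simp only [map_add, map_smul, LinearMap.add_apply,
        LinearMap.smul_apply, smul_eq_mul, z3, z4, form_comm ℂ _ z₀, form_toR, D.ee, D.ff, D.ef,
        form_comm ℤ f e] at h3
      push_cast at h3
      linear_combination h3
    have h2 : tubeMap h κ e f z = lam⁻¹ • x := by
      rw [tubeMap, h1]
      simp only [hz, hz₀]
      rw [show -2 * c / 2 = -c by ring, neg_smul]
      abel
    rw [h2, smul_smul, mul_inv_cancel₀ hlam, one_smul]
  obtain ⟨z1, z2, z3, z4⟩ := mem_tubeSpace.1 hz₀m
  have hpos : 0 < form ℝ (imP z₀) (imP z₀) := by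
    have h1 : InCone h (tubeMap h κ e f z) := by
      have := hx.smul (inv_ne_zero hlam)
      rwa [hxz, smul_smul, inv_mul_cancel₀ hlam, one_smul] at this
    have h2 := h1.2.2
    rw [D.form_tubeMap_star] at h2
    linarith
  have hne : form ℝ (imP z₀) (toR ℝ p) ≠ 0 := by
    intro h0
    have := D.eq_zero (imP_form_eq_zero z1) (imP_form_eq_zero z3) (imP_form_eq_zero z4) h0 hpos.le
    rw [this] at hpos
    simp at hpos
  rcases hne.lt_or_gt with hneg | hpos'
  · have hmem : -z ∈ tube h κ e f p := by
      refine ⟨?_, ?_⟩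
      · change 0 < form ℝ (imP (-z₀)) (imP (-z₀))
        rw [imP_neg]
        simpa using hpos
      · change 0 < form ℝ (imP (-z₀)) (toR ℝ p)
        rw [imP_neg]
        simpa using hneg
    refine ⟨-z, hmem, D.inCone_tubeMap hmem.1, ?_⟩
    rw [proj_pt_eq]
    obtain ⟨g, hg, -, hgC⟩ := exists_reflection D.ee D.ff D.ef D.eh D.fh
    refine ⟨g, hg, -lam⁻¹, neg_ne_zero.2 (inv_ne_zero hlam), ?_⟩
    have hx' : -lam⁻¹ • x = -tubeMap h κ e f z := by
      nth_rewrite 1 [hxz]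
      rw [smul_smul, neg_mul, inv_mul_cancel₀ hlam, neg_one_smul]
    rw [hx', actC, hgC]
    simp only [tubeMap, map_add, map_sub, map_smul, map_neg, LinearMap.neg_apply, smul_eq_mul,
      form_toR, D.ee, D.ff, D.ef, form_comm ℤ f e, form_comm ℂ _ z₀, NegMemClass.coe_neg, hz, z3, z4]
    push_cast
    module
  · have hmem : z ∈ tube h κ e f p := ⟨hpos, hpos'⟩
    refine ⟨z, hmem, D.inCone_tubeMap hmem.1, ?_⟩
    rw [proj_pt_eq]
    refine ⟨1, one_mem _, lam⁻¹, inv_ne_zero hlam, ?_⟩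
    rw [actC_one]
    nth_rewrite 1 [hxz]
    rw [smul_smul, inv_mul_cancel₀ hlam, one_smul]

end IsTubeData

/-! ### Irreducibility of the Noether–Lefschetz divisors -/

/-- The points of the tube domain that map to `A`. -/
def tubePreimage (h κ e f p : K3Lat) (A : Set (PeriodSpace h)) : Set (tubeSpace h κ e f) :=
  {z ∈ tube h κ e f p | tubeMap h κ e f z ∈ cone h A}

namespace IsTubeData

variable {h κ e f p : K3Lat}

theorem mem_cone_univ_tubeMap (D : IsTubeData h κ e f p) {z : tubeSpace h κ e f}
    (hz : z ∈ tube h κ e f p) : tubeMap h κ e f z ∈ cone h Set.univ :=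
  mem_cone_univ.2 (D.inCone_tubeMap hz.1)

/-- The inverse image of an analytic subset is closed in the tube domain. -/
theorem isOpen_diff (D : IsTubeData h κ e f p) {A : Set (PeriodSpace h)}
    (hA : IsAnalyticSubset h A) : IsOpen (tube h κ e f p \ tubePreimage h κ e f p A) := by
  refine isOpen_iff_mem_nhds.2 fun z ⟨hzU, hzA⟩ => ?_
  obtain ⟨V, hV, hzV, k, F, hF, hFA⟩ := hA _ (D.mem_cone_univ_tubeMap hzU)
  have hcont := (analyticAt_tubeMap z).continuousAt
  have h0 : ¬ ∀ i, F i (tubeMap h κ e f z) = 0 := fun H =>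
    hzA ⟨hzU, (hFA _ ⟨hzV, D.mem_cone_univ_tubeMap hzU⟩).2 H⟩
  push Not at h0
  obtain ⟨i, hi⟩ := h0
  have hc : ContinuousAt (fun w => F i (tubeMap h κ e f w)) z :=
    ContinuousAt.comp (g := F i) (hF i _ hzV).continuousAt hcont
  filter_upwards [(isOpen_tube h κ e f p).mem_nhds hzU, hcont (hV.mem_nhds hzV),
    hc.eventually_ne hi] with w hwU hwV hwi
  exact ⟨hwU, fun hwA => hwi ((hFA _ ⟨hwV, D.mem_cone_univ_tubeMap hwU⟩).1 hwA.2 i)⟩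

/-- The identity theorem: an analytic subset whose inverse image in the tube domain has an interior
point contains the image of the tube domain. -/
theorem subset_tubePreimage (D : IsTubeData h κ e f p) {A : Set (PeriodSpace h)}
    (hA : IsAnalyticSubset h A) (hne : (interior (tubePreimage h κ e f p A)).Nonempty) :
    tube h κ e f p ⊆ tubePreimage h κ e f p A := by
  refine subset_trans ?_ interior_subset
  refine D.convex_tube.isPreconnected.subset_of_closure_inter_subset isOpen_interior ?_ ?_
  · obtain ⟨z, hz⟩ := hne
    exact ⟨z, (interior_subset hz).1, hz⟩
  · rintro z ⟨hz, hzU⟩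
    obtain ⟨V, hV, hzV, k, F, hF, hFA⟩ := hA _ (D.mem_cone_univ_tubeMap hzU)
    have hcont := (analyticAt_tubeMap z).continuousAt
    obtain ⟨r, hr, hball⟩ := Metric.mem_nhds_iff.1 (Filter.inter_mem
      ((isOpen_tube h κ e f p).mem_nhds hzU) (hcont (hV.mem_nhds hzV)))
    obtain ⟨w, hwball, hw⟩ := mem_closure_iff.1 hz _ Metric.isOpen_ball (Metric.mem_ball_self hr)
    refine mem_interior.2 ⟨Metric.ball z r, fun u hu => ⟨(hball hu).1, ?_⟩, Metric.isOpen_ball,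
      Metric.mem_ball_self hr⟩
    refine (hFA _ ⟨(hball hu).2, D.mem_cone_univ_tubeMap (hball hu).1⟩).2 fun i => ?_
    have han : AnalyticOnNhd ℂ (fun u => F i (tubeMap h κ e f u)) (Metric.ball z r) := fun u hu =>
      AnalyticAt.comp (g := F i) (hF i _ (hball hu).2) (analyticAt_tubeMap u)
    refine han.eqOn_zero_of_preconnected_of_eventuallyEq_zero
      (convex_ball z r).isPreconnected hwball ?_ hu
    filter_upwards [isOpen_interior.mem_nhds hw, Metric.isOpen_ball.mem_nhds hwball] with u hu hub
    exact (hFA _ ⟨(hball hub).2, D.mem_cone_univ_tubeMap (hball hub).1⟩).1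
      (interior_subset hu).2 i

/-- A set covered by the image of the tube domain is irreducible: of two analytic subsets that cover
it, either the first contains the image, or the inverse image of the second contains the nonempty
open complement of that of the first. -/
theorem eq_or_eq (D : IsTubeData h κ e f p) {Z A B : Set (PeriodSpace h)}
    (hZ : ∀ ζ ∈ Z, ∃ z ∈ tube h κ e f p, ∃ hz : InCone h (tubeMap h κ e f z), ζ = proj h (pt hz))
    (hZ' : ∀ z ∈ tube h κ e f p, tubeMap h κ e f z ∈ cone h Z)
    (hA : IsAnalyticSubset h A) (hB : IsAnalyticSubset h B) (hAB : Z = A ∪ B) :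
    Z = A ∨ Z = B := by
  have hcov : tube h κ e f p \ tubePreimage h κ e f p A ⊆ tubePreimage h κ e f p B := by
    rintro z ⟨hzU, hzA⟩
    obtain ⟨hz, hzZ⟩ := mem_cone.1 (hZ' z hzU)
    rw [hAB] at hzZ
    exact ⟨hzU, mem_cone.2 ⟨hz, hzZ.resolve_left fun H => hzA ⟨hzU, mem_cone.2 ⟨hz, H⟩⟩⟩⟩
  have hsub : ∀ C, tube h κ e f p ⊆ tubePreimage h κ e f p C → Z ⊆ C := by
    intro C hC ζ hζ
    obtain ⟨z, hzU, hz, rfl⟩ := hZ ζ hζ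
    exact (mem_cone.1 (hC hzU).2).2
  by_cases hUA : tube h κ e f p ⊆ tubePreimage h κ e f p A
  · exact .inl ((hsub A hUA).antisymm (hAB ▸ Set.subset_union_left))
  · obtain ⟨z, hzU, hzA⟩ := Set.not_subset.1 hUA
    refine .inr ((hsub B (D.subset_tubePreimage hB ⟨z, ?_⟩)).antisymm
      (hAB ▸ Set.subset_union_right))
    exact mem_interior.2 ⟨_, hcov, D.isOpen_diff hA, hzU, hzA⟩

end IsTubeData

/-- The normal vector of a plane in normal form belongs to the data of a tube domain. -/
theorem exists_isTubeData {h v : K3Lat} (hh : 0 < form ℤ h h)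
    (hv : form ℤ h h * form ℤ v v < form ℤ h v ^ 2) :
    ∃ w ∈ orb h v, ∃ e f p, IsTubeData h (nrm h w) e f p := by
  obtain ⟨e, f, e', f', F⟩ := exists_isFrame h
  obtain ⟨w, hw, -, we, wf, hdiv⟩ := F.exists_normal_form v
  obtain ⟨h1, h2⟩ := form_of_mem_orb hw
  have hκκ := form_nrm_self h w
  rw [h1, form_comm ℤ h w, h2, form_comm ℤ v h] at hκκ
  set κ := nrm h w with hκ
  have hκh : form ℤ κ h = 0 := form_nrm_right h w
  have hκ0 : form ℤ κ κ < 0 := by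
    rw [hκκ]
    nlinarith
  have hwf : form ℤ w f ≠ 0 := by
    intro h0
    obtain ⟨c, hc⟩ := hdiv κ hκh
    have : form ℤ κ κ = form ℤ h h * form ℤ w κ - form ℤ h w * form ℤ h κ :=
      form_nrm_left h w κ
    rw [hc, h0, form_comm ℤ h κ, hκh] at this
    simp at this
    omega
  have hκf : form ℤ κ f = form ℤ h h * form ℤ w f := by
    rw [hκ, form_nrm_left, form_comm ℤ h f, F.fh]
    ring
  have hκf0 : form ℤ κ f ≠ 0 := by
    rw [hκf]
    exact mul_ne_zero hh.ne' hwf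
  have hκe' : form ℤ e' κ = 0 := by
    rw [form_comm, hκ, form_nrm_left, we, form_comm ℤ h e', F.eh₂]
    ring
  have hκf' : form ℤ f' κ = 0 := by
    rw [form_comm, hκ, form_nrm_left, wf, form_comm ℤ h f', F.fh₂]
    ring
  refine ⟨w, hw, e', f', (-form ℤ κ κ) • f + form ℤ κ f • κ, ?_⟩
  refine ⟨hh, ?_, F.ee₂, F.ff₂, F.ef₂, F.eh₂, F.fh₂, hκe', hκf', ?_, ?_, ?_, ?_⟩
  · have : form ℤ ((-form ℤ κ κ) • f + form ℤ κ f • κ) ((-form ℤ κ κ) • f + form ℤ κ f • κ) =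
        -form ℤ κ κ * form ℤ κ f ^ 2 := by
      simp only [map_add, map_smul, LinearMap.add_apply, LinearMap.smul_apply, smul_eq_mul, F.ff,
        form_comm ℤ f κ]
      ring
    rw [this]
    exact mul_pos (neg_pos.2 hκ0) (by positivity)
  · simp only [map_add, map_smul, smul_eq_mul, F.Ef, hκe']
    ring
  · simp only [map_add, map_smul, smul_eq_mul, F.Ff, hκf']
    ring
  · simp only [map_add, map_smul, LinearMap.add_apply, LinearMap.smul_apply, smul_eq_mul, F.fh,
      hκh]
    ring
  · rw [← hκ]
    simp only [map_add, map_smul, LinearMap.add_apply, LinearMap.smul_apply, smul_eq_mul,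
      form_comm ℤ f κ]
    ring

/-- The orthogonal of a hyperbolic plane through `h` has an irreducible image. -/
theorem isIrreducibleAnalytic_NLDivisor {h v : K3Lat} (hh : 0 < form ℤ h h)
    (hv : form ℤ h h * form ℤ v v < form ℤ h v ^ 2) :
    IsIrreducibleAnalytic h (NLDivisor h (plane h v)) := by
  obtain ⟨w, hw, e, f, p, D⟩ := exists_isTubeData hh hv
  have hcone : ∀ z ∈ tube h (nrm h w) e f p,
      tubeMap h (nrm h w) e f z ∈ cone h (NLDivisor h (plane h v)) := fun z hz =>
    (mem_cone_NLDivisor_plane hh).2 ⟨D.inCone_tubeMap hz.1, w, hw, D.form_tubeMap z⟩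
  have hne : (NLDivisor h (plane h v)).Nonempty := by
    obtain ⟨z, hz⟩ := D.tube_nonempty
    obtain ⟨_, H⟩ := mem_cone.1 (hcone z hz)
    exact ⟨_, H⟩
  refine ⟨isAnalyticSubset_NLDivisor hh hv hne, hne, fun A B hA hB hAB =>
    D.eq_or_eq (fun ζ hζ => ?_) hcone hA hB hAB⟩
  -- a point of the divisor can be moved to the hyperplane orthogonal to `w`
  obtain ⟨x, hx, rfl⟩ := exists_pt_eq ζ
  obtain ⟨-, g, hg, H⟩ := mem_cone_NLDivisor.1
    (mem_cone.2 ⟨hx, (NLDivisor_plane_of_mem_orb hw).symm ▸ hζ⟩ :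
      x ∈ cone h (NLDivisor h (plane h w)))
  have hy := hx.actC (inv_mem hg)
  have hyκ : form ℂ (actC g⁻¹ x) (toR ℂ (nrm h w)) = 0 := by
    rw [form_nrm_eq_zero_iff hh hy.1]
    intro k hk
    rw [← form_actC_left hg, ← actC_mul, mul_inv_cancel, actC_one]
    exact H _ ⟨k, hk, rfl⟩
  obtain ⟨z, hzU, hz, hyz⟩ := D.exists_tube hy hyκ
  refine ⟨z, hzU, hz, hyz ▸ ?_⟩
  rw [proj_pt_eq]
  exact ⟨g, hg, 1, one_ne_zero, by rw [one_smul, ← actC_mul, mul_inv_cancel, actC_one]⟩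

/-! ### Irreducible components -/

theorem IsAnalyticSubset.inter {h : K3Lat} {A B : Set (PeriodSpace h)}
    (hA : IsAnalyticSubset h A) (hB : IsAnalyticSubset h B) : IsAnalyticSubset h (A ∩ B) := by
  intro x hx
  obtain ⟨V, hV, hxV, k, F, hF, hFA⟩ := hA x hx
  obtain ⟨W, hW, hxW, l, G, hG, hGB⟩ := hB x hx
  refine ⟨V ∩ W, hV.inter hW, ⟨hxV, hxW⟩, k + l, Fin.append F G, ?_, ?_⟩
  · refine fun i => Fin.addCases (fun i => ?_) (fun i => ?_) i
    · rw [Fin.append_left]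
      exact (hF i).mono Set.inter_subset_left
    · rw [Fin.append_right]
      exact (hG i).mono Set.inter_subset_right
  · rintro y ⟨⟨hyV, hyW⟩, hy⟩
    have hAB : y ∈ cone h (A ∩ B) ↔ y ∈ cone h A ∧ y ∈ cone h B := by
      simp only [mem_cone]
      exact ⟨fun ⟨hx, h1, h2⟩ => ⟨⟨hx, h1⟩, hx, h2⟩, fun ⟨⟨hx, h1⟩, _, h2⟩ => ⟨hx, h1, h2⟩⟩
    rw [hAB, hFA y ⟨hyV, hy⟩, hGB y ⟨hyW, hy⟩, Fin.forall_fin_add]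
    simp

theorem IsIrreducibleAnalytic.subset_or_subset {h : K3Lat} {C Z₁ Z₂ : Set (PeriodSpace h)}
    (hC : IsIrreducibleAnalytic h C) (h₁ : IsAnalyticSubset h Z₁) (h₂ : IsAnalyticSubset h Z₂)
    (H : C ⊆ Z₁ ∪ Z₂) : C ⊆ Z₁ ∨ C ⊆ Z₂ := by
  have := hC.2.2 (C ∩ Z₁) (C ∩ Z₂) (hC.1.inter h₁) (hC.1.inter h₂)
    (by rw [← Set.inter_union_distrib_left, Set.inter_eq_left.2 H])
  exact this.imp (fun e => Set.inter_eq_left.1 e.symm) fun e => Set.inter_eq_left.1 e.symm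

theorem components_union {h : K3Lat} {Z₁ Z₂ : Set (PeriodSpace h)}
    (h₁ : IsIrreducibleAnalytic h Z₁) (h₂ : IsIrreducibleAnalytic h Z₂) (h₁₂ : ¬ Z₁ ⊆ Z₂)
    (h₂₁ : ¬ Z₂ ⊆ Z₁) : components h (Z₁ ∪ Z₂) = {Z₁, Z₂} := by
  ext C
  simp only [components, Set.mem_ofPred_eq, Set.mem_insert_iff, Set.mem_singleton_iff]
  constructor
  · rintro ⟨⟨hC, hCZ⟩, hmax⟩
    rcases hC.subset_or_subset h₁.1 h₂.1 hCZ with H | H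
    · exact .inl (H.antisymm (hmax ⟨h₁, Set.subset_union_left⟩ H))
    · exact .inr (H.antisymm (hmax ⟨h₂, Set.subset_union_right⟩ H))
  · rintro (rfl | rfl)
    · refine ⟨⟨h₁, Set.subset_union_left⟩, fun C' ⟨hC', hC'Z⟩ H => ?_⟩
      exact (hC'.subset_or_subset h₁.1 h₂.1 hC'Z).resolve_right fun H' => h₁₂ (H.trans H')
    · refine ⟨⟨h₂, Set.subset_union_right⟩, fun C' ⟨hC', hC'Z⟩ H => ?_⟩
      exact (hC'.subset_or_subset h₁.1 h₂.1 hC'Z).resolve_left fun H' => h₂₁ (H.trans H')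

/-- Two divisors are not contained in each other if the normal vectors of the planes are never
proportional. -/
theorem not_NLDivisor_subset {h v₁ v₂ : K3Lat} (hh : 0 < form ℤ h h)
    (hv₁ : form ℤ h h * form ℤ v₁ v₁ < form ℤ h v₁ ^ 2)
    (hv₂ : form ℤ h h * form ℤ v₂ v₂ < form ℤ h v₂ ^ 2)
    (H : ∀ w ∈ orb h v₂, ∀ α β : ℤ, α ≠ 0 → α • nrm h w + β • nrm h v₁ ≠ 0) :
    ¬ NLDivisor h (plane h v₁) ⊆ NLDivisor h (plane h v₂) := by
  intro hsub
  have hκ₁ : form ℤ (nrm h v₁) (nrm h v₁) ≠ 0 := by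
    rw [form_nrm_self]
    exact mul_ne_zero hh.ne' (by linarith [hv₁] : _ < (0 : ℤ)).ne
  obtain ⟨x, hx, hxκ⟩ : ∃ x, InCone h x ∧ form ℂ x (toR ℂ (nrm h v₁)) = 0 := by
    obtain ⟨ζ, hζ⟩ := (isIrreducibleAnalytic_NLDivisor hh hv₁).2.1
    obtain ⟨x, hx, rfl⟩ := exists_pt_eq ζ
    obtain ⟨-, g, hg, H⟩ := mem_cone_NLDivisor.1 (mem_cone.2 ⟨hx, hζ⟩)
    have hy := hx.actC (inv_mem hg)
    refine ⟨_, hy, (form_nrm_eq_zero_iff hh hy.1).2 fun k hk => ?_⟩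
    rw [← form_actC_left hg, ← actC_mul, mul_inv_cancel, actC_one]
    exact H _ ⟨k, hk, rfl⟩
  obtain ⟨V, hV, hxV, hfin⟩ := exists_finite_nhds hh
    (form ℤ h h * (form ℤ h v₂ ^ 2 - form ℤ h h * form ℤ v₂ v₂)) hx
  have hfin' := hfin.inter_of_right {κ | ∃ w ∈ orb h v₂, κ = nrm h w}
  obtain ⟨y, hyV, hy, hyκ, hyT⟩ := exists_avoid hh (form_nrm_right h v₁) hfin'.toFinset (by
    intro κ hκ
    obtain ⟨⟨w, hw, rfl⟩, -⟩ := (Set.Finite.mem_toFinset _).1 hκ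
    refine ⟨form_nrm_right h w, form ℤ (nrm h v₁) (nrm h v₁), -form ℤ (nrm h w) (nrm h v₁),
      H w hw _ _ hκ₁, ?_⟩
    simp only [map_add, map_smul, LinearMap.add_apply, LinearMap.smul_apply, smul_eq_mul]
    ring) hV hxV hx hxκ
  have hy₁ : y ∈ cone h (NLDivisor h (plane h v₁)) :=
    (mem_cone_NLDivisor_plane hh).2 ⟨hy, v₁, self_mem_orb h v₁, hyκ⟩
  obtain ⟨_, hyZ⟩ := mem_cone.1 hy₁
  obtain ⟨-, w, hw, hyw⟩ := (mem_cone_NLDivisor_plane hh).1 (mem_cone.2 ⟨hy, hsub hyZ⟩)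
  exact hyT _ ((Set.Finite.mem_toFinset _).2 ⟨⟨w, hw, rfl⟩, form_nrm_right h w,
    (nrm_bound hh hv₂ le_rfl hw).2.2, y, hyV, hyw⟩) hyw

/-! ### Square roots modulo `4n` and modulo `n` -/

theorem isSquareMod_iff {a : ℤ} {N : ℕ} : IsSquareMod a N ↔ ∃ b q : ℤ, a = b ^ 2 - N * q := by
  refine exists_congr fun b => ?_
  rw [Int.modEq_comm, Int.modEq_iff_dvd]
  exact exists_congr fun q => ⟨fun h => by linarith, fun h => by linarith⟩

/-- The square roots of `c` modulo `N` are unique up to sign modulo `M`. -/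
def UniqueSqrt (N M c : ℤ) : Prop :=
  ∀ b b', N ∣ b ^ 2 - c → N ∣ b' ^ 2 - c → ∃ ε m : ℤ, ε * ε = 1 ∧ b' = ε * b + M * m

theorem not_four_dvd_of_squarefree {n : ℕ} (hn : Squarefree n) : ¬ 4 ∣ n := fun h =>
  absurd (hn 2 h) (by decide)

/-- For `n` square-free, a square root of a multiple of `n` is itself a multiple of `n`, and only
its parity relative to `n` matters modulo `2n`. -/
theorem uniqueSqrt_of_squarefree {n : ℕ} (hn : Squarefree n) {c : ℤ} (hc : (n : ℤ) ∣ c) :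
    UniqueSqrt (4 * n) (2 * n) c := by
  have hn0 : (n : ℤ) ≠ 0 := by exact_mod_cast hn.ne_zero
  have hroot : ∀ b : ℤ, (4 * n : ℤ) ∣ b ^ 2 - c → (n : ℤ) ∣ b := by
    intro b hb
    refine (Int.squarefree_natCast.2 hn).isRadical 2 b ?_
    have := dvd_add ((dvd_mul_left (n : ℤ) 4).trans hb) hc
    rwa [sub_add_cancel] at this
  intro b b' hb hb'
  obtain ⟨x, rfl⟩ := hroot b hb
  obtain ⟨x', rfl⟩ := hroot b' hb'
  have h4 : (4 : ℤ) ∣ n * (x' ^ 2 - x ^ 2) := by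
    refine (mul_dvd_mul_iff_left hn0).1 ?_
    have := dvd_sub hb' hb
    rw [mul_comm (4 : ℤ)] at this
    convert this using 1
    ring
  have h2 : (2 : ℤ) ∣ x' - x := by
    by_contra hodd
    have hodd' : Odd (x' - x) := by
      rwa [← Int.not_even_iff_odd, even_iff_two_dvd]
    have hodd₂ : Odd (x' ^ 2 - x ^ 2) := by
      rw [show x' ^ 2 - x ^ 2 = (x' - x) * ((x' - x) + 2 * x) by ring]
      exact hodd'.mul (hodd'.add_even (even_two_mul x))
    have hco : IsCoprime (4 : ℤ) (x' ^ 2 - x ^ 2) := by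
      rw [show (4 : ℤ) = 2 ^ 2 by norm_num]
      refine IsCoprime.pow_left (Int.prime_two.coprime_iff_not_dvd.2 fun h => ?_)
      rw [← even_iff_two_dvd, ← Int.not_odd_iff_even] at h
      exact h hodd₂
    exact not_four_dvd_of_squarefree hn (by exact_mod_cast hco.dvd_of_dvd_mul_right h4)
  obtain ⟨m, hm⟩ := h2
  exact ⟨1, m, one_mul 1, by linear_combination (n : ℤ) * hm⟩

theorem uniqueSqrt_of_prime {n : ℕ} (hn : n.Prime) (c : ℤ) :
    UniqueSqrt (4 * n) (2 * n) c := by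
  intro b b' hb hb'
  obtain ⟨k, hk⟩ := dvd_sub hb' hb
  have heven : Even (b' - b) := by
    have h1 : Even (b' ^ 2 - b ^ 2) := ⟨2 * n * k, by linear_combination hk⟩
    simpa [Int.even_sub, Int.even_pow] using h1
  obtain ⟨u, hu⟩ := heven
  have hdvd : (n : ℤ) ∣ u * (u + b) := by
    have : b' = u + u + b := by linarith
    rw [this] at hk
    exact ⟨k, mul_left_cancel₀ (four_ne_zero (α := ℤ)) (by linear_combination hk)⟩
  rcases (Nat.prime_iff_prime_int.1 hn).dvd_or_dvd hdvd with ⟨m, hm⟩ | ⟨m, hm⟩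
  · exact ⟨1, m, one_mul 1, by linear_combination hu + 2 * hm⟩
  · exact ⟨-1, m, by norm_num, by linear_combination hu + 2 * hm⟩

theorem uniqueSqrt_self_of_squarefree {n : ℕ} (hn : Squarefree n) {c : ℤ} (hc : (n : ℤ) ∣ c) :
    UniqueSqrt n n c := by
  have hroot : ∀ b : ℤ, (n : ℤ) ∣ b ^ 2 - c → (n : ℤ) ∣ b := by
    intro b hb
    refine (Int.squarefree_natCast.2 hn).isRadical 2 b ?_
    have := dvd_add hb hc
    rwa [sub_add_cancel] at this
  intro b b' hb hb'
  obtain ⟨m, hm⟩ := dvd_sub (hroot b' hb') (hroot b hb)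
  exact ⟨1, m, one_mul 1, by linear_combination hm⟩

theorem uniqueSqrt_self_of_prime {n : ℕ} (hn : n.Prime) (c : ℤ) : UniqueSqrt n n c := by
  intro b b' hb hb'
  have hdvd : (n : ℤ) ∣ (b' - b) * (b' + b) := by
    rw [show (b' - b) * (b' + b) = b' ^ 2 - c - (b ^ 2 - c) by ring]
    exact dvd_sub hb' hb
  rcases (Nat.prime_iff_prime_int.1 hn).dvd_or_dvd hdvd with ⟨m, hm⟩ | ⟨m, hm⟩
  · exact ⟨1, m, one_mul 1, by linear_combination hm⟩
  · exact ⟨-1, m, by norm_num, by linear_combination hm⟩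

theorem sq_emod_four (b : ℤ) : b ^ 2 % 4 = 0 ∧ b % 2 = 0 ∨ b ^ 2 % 4 = 1 ∧ b % 2 = 1 := by
  rcases Int.even_or_odd' b with ⟨c, rfl | rfl⟩
  · exact .inl ⟨by rw [show (2 * c) ^ 2 = 4 * (c ^ 2) by ring]; omega, by omega⟩
  · exact .inr ⟨by rw [show (2 * c + 1) ^ 2 = 4 * (c ^ 2 + c) + 1 by ring]; omega, by omega⟩

/-- The classes modulo `4` for which both `e` and `e - n` can be squares modulo `4n`, when `n` is
not a multiple of `4`. -/
def IsExceptional (n e : ℕ) : Prop :=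
  n ≡ 1 [MOD 4] ∧ e ≡ 1 [MOD 4] ∨ n ≡ 3 [MOD 4] ∧ e ≡ 0 [MOD 4]

theorem isExceptional_of_isSquareMod {n e : ℕ} (hn : ¬ 4 ∣ n) (h₁ : IsSquareMod e (4 * n))
    (h₂ : IsSquareMod ((e : ℤ) - n) (4 * n)) : IsExceptional n e := by
  obtain ⟨b, q, h₁⟩ := isSquareMod_iff.1 h₁
  obtain ⟨b', q', h₂⟩ := isSquareMod_iff.1 h₂
  push_cast at h₁ h₂
  rw [mul_assoc] at h₁ h₂
  have hb := sq_emod_four b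
  have hb' := sq_emod_four b'
  simp only [IsExceptional, Nat.ModEq]
  generalize b ^ 2 = x, b' ^ 2 = y, (n : ℤ) * q = z, (n : ℤ) * q' = t at *
  omega

theorem isSquareMod_of_isExceptional {n e : ℕ} (H : IsExceptional n e) :
    IsSquareMod e (4 * n) ↔ IsSquareMod ((e : ℤ) - n) (4 * n) := by
  simp only [IsExceptional, Nat.ModEq] at H
  rw [isSquareMod_iff, isSquareMod_iff]
  push_cast
  -- the square roots are exchanged by translation by `n`
  constructor
  · rintro ⟨b, q, h⟩
    have hb := sq_emod_four b
    have h' := h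
    rw [mul_assoc] at h'
    obtain ⟨m, hm⟩ : (4 : ℤ) ∣ 2 * b + n + 1 := by
      generalize b ^ 2 = x, (n : ℤ) * q = z at *
      omega
    exact ⟨b + n, q + m, by linear_combination h - n * hm⟩
  · rintro ⟨b, q, h⟩
    have hb := sq_emod_four b
    have h' := h
    rw [mul_assoc] at h'
    obtain ⟨m, hm⟩ : (4 : ℤ) ∣ 2 * b + n - 1 := by
      generalize b ^ 2 = x, (n : ℤ) * q = z at *
      omega
    exact ⟨b + n, q + m, by linear_combination h - n * hm⟩

theorem isExceptional_iff_of_dvd {n e : ℕ} (hn : 0 < n) (hne : n ∣ e) : IsExceptional n e ↔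
    n ≡ 1 [MOD 4] ∧ e ≡ n [MOD 4 * n] ∨ n ≡ 3 [MOD 4] ∧ e ≡ 0 [MOD 4 * n] := by
  obtain ⟨k, rfl⟩ := hne
  have h1 : n * k ≡ n [MOD 4 * n] ↔ k ≡ 1 [MOD 4] := by
    have := Nat.ModEq.mul_left_cancel_iff' (a := k) (b := 1) (m := 4) hn.ne'
    rwa [mul_one, mul_comm n 4] at this
  have h2 : n * k ≡ 0 [MOD 4 * n] ↔ k ≡ 0 [MOD 4] := by
    have := Nat.ModEq.mul_left_cancel_iff' (a := k) (b := 0) (m := 4) hn.ne'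
    rwa [mul_zero, mul_comm n 4] at this
  rw [h1, h2]
  simp only [IsExceptional, Nat.ModEq, Nat.mul_mod n k 4]
  have := Nat.mod_lt n (show 0 < 4 by norm_num)
  have := Nat.mod_lt k (show 0 < 4 by norm_num)
  generalize n % 4 = x, k % 4 = y at *
  interval_cases x <;> interval_cases y <;> simp

/-! ### Divisibility one -/

/-- The vectors `v` of divisibility `1` on `h^⊥` for which `disc ⟨h, v⟩^⊥ = -2e`, where `h` has
square `2n` and divisibility `1`. -/
def TypeA (h : K3Lat) (n e : ℕ) (v : K3Lat) : Prop :=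
  IsDivOn h v 1 ∧ (e : ℤ) = form ℤ h v ^ 2 - 2 * n * form ℤ v v

/-- The vectors `v` of divisibility `2` on `h^⊥`, with `v / 2` in the dual lattice, for which
`disc ⟨h, v⟩^⊥ = -2e`, where `h` has square `2n` and divisibility `1`. -/
def TypeB (h : K3Lat) (n e : ℕ) (v : K3Lat) : Prop :=
  IsDivOn h v 2 ∧ IsHalf v ∧ 4 * (e : ℤ) = form ℤ h v ^ 2 - 2 * n * form ℤ v v

section One

variable {n e : ℕ} {h v v' : K3Lat}

theorem IsPolarization.form_pos {γ : ℕ} (hh : IsPolarization n γ h) (hn : 0 < n) :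
    0 < form ℤ h h := by
  rw [hh.2.1]
  positivity

theorem exists_type (hh : IsPolarization n 1 h) {K : Submodule ℤ K3Lat}
    (hK : K ∈ NLPlanes h (2 * e)) : ∃ v, K = plane h v ∧ (TypeA h n e v ∨ TypeB h n e v) := by
  obtain ⟨v, hv, -, ⟨h1, h2⟩ | ⟨h1, h2, h3⟩⟩ := exists_of_mem_NLPlanes_one hh hK
  · push_cast at h2
    exact ⟨v, hv, .inl ⟨h1, by linarith⟩⟩
  · push_cast at h3
    exact ⟨v, hv, .inr ⟨h1, h2, by linarith⟩⟩

theorem TypeA.dvd (H : TypeA h n e v) : (4 * n : ℤ) ∣ form ℤ h v ^ 2 - e := by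
  obtain ⟨q, hq⟩ := form_even v
  exact ⟨q, by rw [H.2, hq]; ring⟩

theorem TypeB.exists_dvd (H : TypeB h n e v) :
    ∃ b : ℤ, form ℤ h v = 2 * b ∧ (4 * n : ℤ) ∣ b ^ 2 - (e - n) := by
  obtain ⟨b, hb⟩ := H.2.1.1 h
  obtain ⟨k, hk⟩ := H.2.1.exists_form_self
  rw [form_comm] at hb
  refine ⟨b, hb, k, ?_⟩
  have := H.2.2
  rw [hb, hk] at this
  linarith

theorem isSquareMod_of_dvd {a b : ℤ} {N : ℕ} (H : (N : ℤ) ∣ b ^ 2 - a) : IsSquareMod a N :=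
  ⟨b, (Int.modEq_iff_dvd.2 H).symm⟩

theorem TypeA.isSquareMod (H : TypeA h n e v) : IsSquareMod e (4 * n) :=
  isSquareMod_of_dvd (by exact_mod_cast H.dvd)

theorem TypeB.isSquareMod (H : TypeB h n e v) : IsSquareMod ((e : ℤ) - n) (4 * n) := by
  obtain ⟨b, -, hb⟩ := H.exists_dvd
  exact isSquareMod_of_dvd (by exact_mod_cast hb)

theorem exists_typeA (hh : IsPolarization n 1 h) (hn : 0 < n) (he : 0 < e)
    (H : IsSquareMod e (4 * n)) : ∃ v, TypeA h n e v ∧ plane h v ∈ NLPlanes h (2 * e) := by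
  obtain ⟨b, q, hbq⟩ := isSquareMod_iff.1 H
  push_cast at hbq
  obtain ⟨v, h1, h2, h3, h4⟩ := exists_plane_of_isDivOn_one (d := 2 * e) (b := b) (q := q) hh hn
    (by positivity) (by push_cast; linarith)
  refine ⟨v, ⟨h1, ?_⟩, h4⟩
  rw [h2, h3, hbq]
  push_cast
  ring

theorem exists_typeB (hh : IsPolarization n 1 h) (hn : 0 < n) (he : 0 < e)
    (H : IsSquareMod ((e : ℤ) - n) (4 * n)) :
    ∃ v, TypeB h n e v ∧ plane h v ∈ NLPlanes h (2 * e) := by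
  obtain ⟨b, q, hbq⟩ := isSquareMod_iff.1 H
  push_cast at hbq
  obtain ⟨v, h1, h2, h3, h4, h5⟩ := exists_plane_of_isDivOn_two (d := 2 * e) (b := b) (k := q) hh
    hn (by positivity) (by push_cast; linarith)
  refine ⟨v, ⟨h1, h2, ?_⟩, h5⟩
  rw [h3, h4]
  linarith

theorem TypeA.NLDivisor_eq (hh : IsPolarization n 1 h) (hn : 0 < n)
    (hU : UniqueSqrt (4 * n) (2 * n) e) (H : TypeA h n e v) (H' : TypeA h n e v') :
    NLDivisor h (plane h v') = NLDivisor h (plane h v) := by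
  obtain ⟨ε, m, hε, hb⟩ := hU _ _ H.dvd H'.dvd
  obtain ⟨g, hg, hgv⟩ := exists_act_eq_of_isDivOn_one hn hh.2.1 H.1 H'.1 hε hb
    (H.2.symm.trans H'.2)
  rw [← hgv, NLDivisor_act hg]

theorem TypeB.NLDivisor_eq (hh : IsPolarization n 1 h) (hn : 0 < n)
    (hU : UniqueSqrt (4 * n) (2 * n) (e - n)) (H : TypeB h n e v) (H' : TypeB h n e v') :
    NLDivisor h (plane h v') = NLDivisor h (plane h v) := by
  obtain ⟨b, hb, hbd⟩ := H.exists_dvd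
  obtain ⟨b', hb', hbd'⟩ := H'.exists_dvd
  obtain ⟨ε, m, hε, hbb⟩ := hU _ _ hbd hbd'
  obtain ⟨g, hg, hgv⟩ := exists_act_eq_of_isDivOn_two (m := m) hn hh.2.1 H.1 H'.1 H.2.1 H'.2.1 hε
    (by rw [hb, hb', hbb]; ring) (H.2.2.symm.trans H'.2.2)
  rw [← hgv, NLDivisor_act hg]

theorem TypeA.lt (hh : IsPolarization n 1 h) (he : 0 < e) (H : TypeA h n e v) :
    form ℤ h h * form ℤ v v < form ℤ h v ^ 2 := by
  have := H.2
  rw [hh.2.1]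
  omega

theorem TypeB.lt (hh : IsPolarization n 1 h) (he : 0 < e) (H : TypeB h n e v) :
    form ℤ h h * form ℤ v v < form ℤ h v ^ 2 := by
  have := H.2.2
  rw [hh.2.1]
  omega

theorem isHypersurface_NLLocus_one (hh : IsPolarization n 1 h) (hn : 0 < n) (he : 0 < e)
    (hne : (NLLocus h (2 * e)).Nonempty) : IsHypersurface h (NLLocus h (2 * e)) := by
  refine isHypersurface_NLLocus (hh.form_pos hn) (4 * e) (fun K hK => ?_) hne
  obtain ⟨v, hv, H | H⟩ := exists_type hh hK
  · refine ⟨v, hv, H.lt hh he, ?_⟩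
    rw [hh.2.1, ← H.2]
    omega
  · refine ⟨v, hv, H.lt hh he, ?_⟩
    rw [hh.2.1, ← H.2.2]

/-- The normal vectors of planes of different types are not proportional: their types are
distinguished by the parity of the pairing of the plane with `h^⊥`. -/
theorem smul_nrm_add_smul_nrm_ne_zero (hh : IsPolarization n 1 h) (hn : 0 < n)
    (H : IsDivOn h v 1) (H' : IsDivOn h v' 2) (Hh : IsHalf v') {α β : ℤ} (hαβ : α ≠ 0 ∨ β ≠ 0) :
    α • nrm h v + β • nrm h v' ≠ 0 := by
  intro h0
  have hN := (hh.form_pos hn).ne'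
  have hpair : ∀ l, form ℤ l h = 0 → α * form ℤ v l + β * form ℤ v' l = 0 := by
    intro l hl
    have := congrArg (fun x => form ℤ x l) h0
    simp only [map_add, map_smul, LinearMap.add_apply, LinearMap.smul_apply, form_nrm_left,
      form_comm ℤ h l, hl, smul_eq_mul, map_zero, LinearMap.zero_apply] at this
    exact (mul_eq_zero.1 (show form ℤ h h * _ = 0 by linear_combination this)).resolve_left hN
  obtain ⟨l, hl, hvl⟩ := H.2
  obtain ⟨l', hl', hvl'⟩ := H'.2
  obtain ⟨c, hc⟩ := Hh.1 l
  have e1 := hpair l hl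
  have e2 := hpair l' hl'
  rw [hvl, hc] at e1
  rw [hvl'] at e2
  have hα : α = -(2 * c * β) := by linarith
  have hβ : β ≠ 0 := by
    rintro rfl
    simp at hα
    simp [hα] at hαβ
  -- modulo the multiples of `h`, the vector `v'` is an even multiple of `v`
  have hprop : nrm h v' = (2 * c) • nrm h v := by
    refine smul_right_injective K3Lat hβ ?_
    simp only
    rw [eq_neg_of_add_eq_zero_right h0, hα]
    module
  obtain ⟨m, hm⟩ := hh.1.exists_eq_smul (y := v' - (2 * c) • v)
    (α := form ℤ h v' - 2 * c * form ℤ h v) hN (by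
      have h1 : form ℤ h h • v' = nrm h v' + form ℤ h v' • h := by
        rw [nrm]
        abel
      rw [smul_sub, h1, hprop, nrm]
      module)
  obtain ⟨-, y, hy⟩ := exists_form_eq hh.2.2
  obtain ⟨k, hk⟩ := Hh.1 y
  have hm2 : m = 2 * (k - c * form ℤ v y) := by
    have := congrArg (fun x => form ℤ x y) hm
    simp only [map_sub, map_smul, LinearMap.sub_apply, LinearMap.smul_apply, smul_eq_mul, hk,
      hy] at this
    push_cast at this
    linarith
  refine Hh.2 (c • v + (k - c * form ℤ v y) • h) ?_
  rw [eq_add_of_sub_eq hm, hm2]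
  module

theorem nonempty_NLLocus_one_iff (hh : IsPolarization n 1 h) (hn : 0 < n) (he : 0 < e) :
    (NLLocus h (2 * e)).Nonempty ↔
      IsSquareMod e (4 * n) ∨ IsSquareMod ((e : ℤ) - n) (4 * n) := by
  constructor
  · rintro ⟨ζ, hζ⟩
    rw [NLLocus_eq] at hζ
    obtain ⟨K, hK, -⟩ := Set.mem_iUnion₂.1 hζ
    obtain ⟨v, -, H | H⟩ := exists_type hh hK
    exacts [.inl H.isSquareMod, .inr H.isSquareMod]
  · have key : ∀ v, plane h v ∈ NLPlanes h (2 * e) →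
        form ℤ h h * form ℤ v v < form ℤ h v ^ 2 → (NLLocus h (2 * e)).Nonempty := by
      intro v hv hlt
      exact (isIrreducibleAnalytic_NLDivisor (hh.form_pos hn) hlt).2.1.mono
        (NLLocus_eq h _ ▸ Set.subset_biUnion_of_mem hv)
    rintro (H | H)
    · obtain ⟨v, hv, hK⟩ := exists_typeA hh hn he H
      exact key v hK (hv.lt hh he)
    · obtain ⟨v, hv, hK⟩ := exists_typeB hh hn he H
      exact key v hK (hv.lt hh he)

theorem NLLocus_eq_NLDivisor {d : ℕ} {v : K3Lat} (hv : plane h v ∈ NLPlanes h d)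
    (H : ∀ K ∈ NLPlanes h d, NLDivisor h K = NLDivisor h (plane h v)) :
    NLLocus h d = NLDivisor h (plane h v) := by
  rw [NLLocus_eq]
  exact (Set.iUnion₂_subset fun K hK => (H K hK).subset).antisymm
    (Set.subset_biUnion_of_mem (u := fun K => NLDivisor h K) hv)

/-- If square roots are unique, there is one divisor for each type of plane, and both types occur
only in the exceptional classes. -/
theorem NLLocus_one (hh : IsPolarization n 1 h) (hn : 0 < n) (hn4 : ¬ 4 ∣ n) (he : 0 < e)
    (hA : UniqueSqrt (4 * n) (2 * n) e) (hB : UniqueSqrt (4 * n) (2 * n) (e - n))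
    (hsq : IsSquareMod e (4 * n) ∨ IsSquareMod ((e : ℤ) - n) (4 * n)) :
    (IsExceptional n e → IsHypersurfaceWithTwoComponents h (NLLocus h (2 * e))) ∧
      (¬ IsExceptional n e → IsIrreducibleHypersurface h (NLLocus h (2 * e))) := by
  have hhyp := isHypersurface_NLLocus_one hh hn he ((nonempty_NLLocus_one_iff hh hn he).2 hsq)
  have hpos := hh.form_pos hn
  constructor
  · intro hex
    have hiff := isSquareMod_of_isExceptional hex
    obtain ⟨v₁, H₁, hK₁⟩ := exists_typeA hh hn he (hsq.elim id hiff.2)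
    obtain ⟨v₂, H₂, hK₂⟩ := exists_typeB hh hn he (hsq.elim hiff.1 id)
    have heq : NLLocus h (2 * e) = NLDivisor h (plane h v₁) ∪ NLDivisor h (plane h v₂) := by
      rw [NLLocus_eq]
      refine (Set.iUnion₂_subset fun K hK => ?_).antisymm (Set.union_subset
        (Set.subset_biUnion_of_mem (u := fun K => NLDivisor h K) hK₁)
        (Set.subset_biUnion_of_mem (u := fun K => NLDivisor h K) hK₂))
      obtain ⟨v, rfl, H | H⟩ := exists_type hh hK
      · exact (H₁.NLDivisor_eq hh hn hA H).subset.trans Set.subset_union_left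
      · exact (H₂.NLDivisor_eq hh hn hB H).subset.trans Set.subset_union_right
    have h₁₂ : ¬ NLDivisor h (plane h v₁) ⊆ NLDivisor h (plane h v₂) :=
      not_NLDivisor_subset hpos (H₁.lt hh he) (H₂.lt hh he) fun w hw α β hα => by
        rw [add_comm]
        exact smul_nrm_add_smul_nrm_ne_zero hh hn H₁.1 (IsDivOn.of_mem_orb (orb_symm hw) H₂.1)
          (H₂.2.1.of_mem_orb hw) (.inr hα)
    have h₂₁ : ¬ NLDivisor h (plane h v₂) ⊆ NLDivisor h (plane h v₁) :=
      not_NLDivisor_subset hpos (H₂.lt hh he) (H₁.lt hh he) fun w hw α β hα =>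
        smul_nrm_add_smul_nrm_ne_zero hh hn (IsDivOn.of_mem_orb (orb_symm hw) H₁.1) H₂.1 H₂.2.1
          (.inl hα)
    refine ⟨hhyp, ?_⟩
    rw [heq, components_union (isIrreducibleAnalytic_NLDivisor hpos (H₁.lt hh he))
      (isIrreducibleAnalytic_NLDivisor hpos (H₂.lt hh he)) h₁₂ h₂₁]
    exact Set.ncard_pair fun h0 => h₁₂ h0.subset
  · intro hex
    refine ⟨hhyp, ?_⟩
    rcases hsq with H | H
    · obtain ⟨v₁, H₁, hK₁⟩ := exists_typeA hh hn he H
      rw [NLLocus_eq_NLDivisor hK₁ fun K hK => ?_]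
      · exact isIrreducibleAnalytic_NLDivisor hpos (H₁.lt hh he)
      · obtain ⟨v, rfl, H' | H'⟩ := exists_type hh hK
        · exact H₁.NLDivisor_eq hh hn hA H'
        · exact absurd (isExceptional_of_isSquareMod hn4 H H'.isSquareMod) hex
    · obtain ⟨v₂, H₂, hK₂⟩ := exists_typeB hh hn he H
      rw [NLLocus_eq_NLDivisor hK₂ fun K hK => ?_]
      · exact isIrreducibleAnalytic_NLDivisor hpos (H₂.lt hh he)
      · obtain ⟨v, rfl, H' | H'⟩ := exists_type hh hK
        · exact absurd (isExceptional_of_isSquareMod hn4 H'.isSquareMod H) hex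
        · exact H₂.NLDivisor_eq hh hn hB H'

end One

/-! ### Divisibility two -/

section Two

variable {n e : ℕ} {h v v' : K3Lat}

theorem exists_invariant_two {d : ℕ} (hh : IsPolarization n 2 h) {K : Submodule ℤ K3Lat}
    (hK : K ∈ NLPlanes h d) : ∃ v, ∃ b q : ℤ, K = plane h v ∧ IsDivOn h v 1 ∧
      form ℤ h v = 2 * b ∧ form ℤ v v = 2 * q ∧ (d : ℤ) = 2 * (b ^ 2 - n * q) := by
  obtain ⟨v, hv, -, h1, h2⟩ := exists_of_mem_NLPlanes_two hh hK
  obtain ⟨b, hb⟩ := (exists_form_eq hh.2.2).1 v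
  obtain ⟨q, hq⟩ := form_even v
  push_cast at hb
  refine ⟨v, b, q, hv, h1, hb, by rw [hq]; ring, ?_⟩
  rw [hb, hq] at h2
  linarith

theorem exists_plane_two (hh : IsPolarization n 2 h) (hn : 0 < n) (he : 0 < e)
    (H : IsSquareMod e n) : ∃ v, plane h v ∈ NLPlanes h (2 * e) := by
  obtain ⟨b, q, hbq⟩ := isSquareMod_iff.1 H
  obtain ⟨v, -, -, -, h4⟩ := exists_plane_of_isDivOn_one (d := 2 * e) (b := b) (q := q) hh hn
    (by positivity) (by push_cast; linarith)
  exact ⟨v, h4⟩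

theorem lt_of_invariant_two (hh : IsPolarization n 2 h) (he : 0 < e) {b q : ℤ}
    (hb : form ℤ h v = 2 * b) (hq : form ℤ v v = 2 * q)
    (hd : ((2 * e : ℕ) : ℤ) = 2 * (b ^ 2 - n * q)) :
    form ℤ h h * form ℤ v v < form ℤ h v ^ 2 ∧
      form ℤ h v ^ 2 - form ℤ h h * form ℤ v v = 4 * e := by
  have : form ℤ h v ^ 2 - form ℤ h h * form ℤ v v = 4 * e := by
    rw [hb, hq, hh.2.1]
    push_cast at hd
    linarith
  exact ⟨by omega, this⟩

theorem nonempty_NLLocus_two_iff (hh : IsPolarization n 2 h) (hn : 0 < n) (he : 0 < e) :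
    (NLLocus h (2 * e)).Nonempty ↔ IsSquareMod e n := by
  constructor
  · rintro ⟨ζ, hζ⟩
    rw [NLLocus_eq] at hζ
    obtain ⟨K, hK, -⟩ := Set.mem_iUnion₂.1 hζ
    obtain ⟨v, b, q, -, -, -, -, hd⟩ := exists_invariant_two hh hK
    push_cast at hd
    exact isSquareMod_iff.2 ⟨b, q, by linarith⟩
  · intro H
    obtain ⟨v₀, hK⟩ := exists_plane_two hh hn he H
    obtain ⟨v, b, q, hv, -, hb, hq, hd⟩ := exists_invariant_two hh hK
    rw [hv] at hK
    exact (isIrreducibleAnalytic_NLDivisor (hh.form_pos hn)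
      (lt_of_invariant_two hh he hb hq hd).1).2.1.mono
        (NLLocus_eq h _ ▸ Set.subset_biUnion_of_mem hK)

theorem NLLocus_two (hh : IsPolarization n 2 h) (hn : 0 < n) (he : 0 < e)
    (hU : UniqueSqrt n n e) (hsq : IsSquareMod e n) :
    IsIrreducibleHypersurface h (NLLocus h (2 * e)) := by
  refine ⟨isHypersurface_NLLocus (hh.form_pos hn) (4 * e) (fun K hK => ?_)
    ((nonempty_NLLocus_two_iff hh hn he).2 hsq), ?_⟩
  · obtain ⟨v, b, q, hv, -, hb, hq, hd⟩ := exists_invariant_two hh hK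
    have := lt_of_invariant_two hh he hb hq hd
    exact ⟨v, hv, this.1, this.2.le⟩
  · obtain ⟨v₀, hK⟩ := exists_plane_two hh hn he hsq
    obtain ⟨v, b, q, hv, h1, hb, hq, hd⟩ := exists_invariant_two hh hK
    rw [hv] at hK
    have hlt := lt_of_invariant_two hh he hb hq hd
    rw [NLLocus_eq_NLDivisor hK fun K' hK' => ?_]
    · exact isIrreducibleAnalytic_NLDivisor (hh.form_pos hn) hlt.1
    · obtain ⟨v', b', q', rfl, h1', hb', hq', hd'⟩ := exists_invariant_two hh hK'
      have hlt' := lt_of_invariant_two hh he hb' hq' hd'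
      push_cast at hd hd'
      obtain ⟨ε, m, hε, hbb⟩ := hU b b' ⟨q, by linarith⟩ ⟨q', by linarith⟩
      obtain ⟨g, hg, hgv⟩ := exists_act_eq_of_isDivOn_one (m := m) hn hh.2.1 h1 h1' hε
        (by rw [hb, hb', hbb]; ring) (by rw [← hh.2.1, hlt.2, hlt'.2])
      rw [← hgv, NLDivisor_act hg]

end Two

theorem even_of_nonempty_NLLocus {n d γ : ℕ} {h : K3Lat} (hγ : γ = 1 ∨ γ = 2)
    (hh : IsPolarization n γ h) (hne : (NLLocus h d).Nonempty) : Even d := by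
  obtain ⟨ζ, hζ⟩ := hne
  rw [NLLocus_eq] at hζ
  obtain ⟨K, hK, -⟩ := Set.mem_iUnion₂.1 hζ
  rw [← Int.even_coe_nat]
  rcases hγ with rfl | rfl
  · obtain ⟨v, -, -, ⟨-, h2⟩ | ⟨-, h1, h2⟩⟩ := exists_of_mem_NLPlanes_one hh hK
    · rw [h2]
      exact even_two_mul _
    · obtain ⟨b, hb⟩ := h1.1 h
      obtain ⟨k, hk⟩ := h1.exists_form_self
      rw [form_comm] at hb
      rw [hb, hk] at h2
      exact ⟨b ^ 2 + n - 4 * n * k, by linarith⟩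
  · obtain ⟨v, b, q, -, -, -, -, hd⟩ := exists_invariant_two hh hK
    rw [hd]
    exact even_two_mul _

end HK

theorem mainTheorem3 :
    -- if the locus is nonempty, its discriminant is even
    (∀ (n d γ : ℕ) (h : HK.K3Lat), 0 < n → 0 < d → (γ = 1 ∨ γ = 2) → HK.IsPolarization n γ h →
      (HK.NLLocus h d).Nonempty → Even d) ∧
    -- divisibility 1
    (∀ (n e : ℕ) (h : HK.K3Lat), 0 < n → 0 < e → HK.IsPolarization n 1 h →
      ((HK.NLLocus h (2 * e)).Nonempty ↔
        HK.IsSquareMod e (4 * n) ∨ HK.IsSquareMod ((e : ℤ) - n) (4 * n)) ∧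
      (Squarefree n → n ∣ e →
        (HK.IsSquareMod e (4 * n) ∨ HK.IsSquareMod ((e : ℤ) - n) (4 * n)) →
        (((n ≡ 1 [MOD 4] ∧ e ≡ n [MOD 4 * n]) ∨ (n ≡ 3 [MOD 4] ∧ e ≡ 0 [MOD 4 * n])) →
          HK.IsHypersurfaceWithTwoComponents h (HK.NLLocus h (2 * e))) ∧
        (¬ ((n ≡ 1 [MOD 4] ∧ e ≡ n [MOD 4 * n]) ∨ (n ≡ 3 [MOD 4] ∧ e ≡ 0 [MOD 4 * n])) →
          HK.IsIrreducibleHypersurface h (HK.NLLocus h (2 * e)))) ∧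
      (n.Prime →
        (HK.IsSquareMod e (4 * n) ∨ HK.IsSquareMod ((e : ℤ) - n) (4 * n)) →
        (((n ≡ 1 [MOD 4] ∧ e ≡ 1 [MOD 4]) ∨ (n ≡ 3 [MOD 4] ∧ e ≡ 0 [MOD 4])) →
          HK.IsHypersurfaceWithTwoComponents h (HK.NLLocus h (2 * e))) ∧
        (¬ ((n ≡ 1 [MOD 4] ∧ e ≡ 1 [MOD 4]) ∨ (n ≡ 3 [MOD 4] ∧ e ≡ 0 [MOD 4])) →
          HK.IsIrreducibleHypersurface h (HK.NLLocus h (2 * e))))) ∧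
    -- divisibility 2
    (∀ (n e : ℕ) (h : HK.K3Lat), 0 < n → 0 < e → n ≡ 3 [MOD 4] → HK.IsPolarization n 2 h →
      ((HK.NLLocus h (2 * e)).Nonempty ↔ HK.IsSquareMod e n) ∧
      (Squarefree n → n ∣ e →
        HK.IsIrreducibleHypersurface h (HK.NLLocus h (2 * e))) ∧
      (n.Prime → HK.IsSquareMod e n →
        HK.IsIrreducibleHypersurface h (HK.NLLocus h (2 * e)))) := by
  refine ⟨fun n d γ h _ _ hγ hh hne => HK.even_of_nonempty_NLLocus hγ hh hne,
    fun n e h hn he hh => ⟨HK.nonempty_NLLocus_one_iff hh hn he, fun hsf hne hsq => ?_,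
      fun hp hsq => ?_⟩,
    fun n e h hn he _ hh => ⟨HK.nonempty_NLLocus_two_iff hh hn he, fun hsf hne => ?_,
      fun hp hsq => HK.NLLocus_two hh hn he (HK.uniqueSqrt_self_of_prime hp _) hsq⟩⟩
  · have hne' : (n : ℤ) ∣ e := Int.natCast_dvd_natCast.2 hne
    rw [← HK.isExceptional_iff_of_dvd hn hne]
    exact HK.NLLocus_one hh hn (HK.not_four_dvd_of_squarefree hsf) he
      (HK.uniqueSqrt_of_squarefree hsf hne')
      (HK.uniqueSqrt_of_squarefree hsf (dvd_sub hne' dvd_rfl)) hsq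
  · exact HK.NLLocus_one hh hn (HK.not_four_dvd_of_squarefree hp.prime.squarefree) he
      (HK.uniqueSqrt_of_prime hp _) (HK.uniqueSqrt_of_prime hp _) hsq
  · have hne' : (n : ℤ) ∣ e := Int.natCast_dvd_natCast.2 hne
    exact HK.NLLocus_two hh hn he (HK.uniqueSqrt_self_of_squarefree hsf hne')
      (HK.isSquareMod_of_dvd (b := 0) (by simpa using hne'))
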